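/- **Setting.** Let $M\ge 2$ and $1\le k_0<2M$ be integers, let $f:\mathbb Z\to\mathbb C$ have period $M$, and let $\mathcal M$ be a non-empty subset of $\{1\le k\le M/2 : k^2\equiv k_0 \pmod{2M}\}$ such that $f(j)=0$ unless $j\equiv \pm k\pmod M$ for some $k\in\mathcal M$. For $z\in\mathbb H$ and $q=e^{2\pi i z}$ put $$\theta_f(z)=\sum_{n\ge0}f(n)\,q^{n^2/2M},\qquad \Theta_f(z)=\sum_{n\ge0}n f(n)\,q^{n^2/2M},$$ and for $\alpha\in\mathbb Q$ let $\theta_f(\alpha)$, $\Theta_f(\alpha)$ denote the limits of $\theta_f(\alpha+iy)$, $\Theta_f(\alpha+iy)$ as $y\to0^+$, when they exist. Let $\Gamma_M=\Gamma_1(2M)$ if $M$ is even, and $\Gamma_M=\{\gamma\in\Gamma_1(2M): b\equiv0 \pmod 2\}$ if $M$ is odd, where $\gamma=\begin{pmatrix}a&b\\c&d\end{pmatrix}$. Let $B_M$ be the set of rationals $\Gamma_M$-equivalent to $i\infty$. Let $A_M=B_M$ if $\sum'_{k\in\mathcal M}f(k)\ne0$ (the prime means that a term $k=M/2$ is weighted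 by $\tfrac12$), and otherwise let $A_M$ be the set of rationals $\Gamma_M$-equivalent to $0$ or $i\infty$. For $\gamma\in\Gamma_M$ let $$\chi(\gamma)=e^{\pi i ab k_0/M}\left(\frac{2cM}{d}\right)\varepsilon_d^{-1},$$ where $\varepsilon_d=1$ or $i$ according as $d\equiv1$ or $3\pmod4$, and where $\left(\frac{m}{d}\right)$ is the extended Jacobi symbol for odd $d$: it equals the Jacobi symbol $\left(\frac{m}{|d|}\right)$, with the sign changed if $m<0$ and $d<0$ (so $\left(\frac{0}{\pm1}\right)=1$). Put $$(g|_{k,\chi}\gamma)(\tau)=\overline{\chi(\gamma)}\,(c\tau+d)^{-k}\,g\!\left(\frac{a\tau+b}{c\tau+d}\right).$$ Here $(c\tau+d)^{-k}$ is the principal power for $\tau\in\mathbb H_-=\{\operatorname{Im}\tau<0\}$, and for real $\tau$ with $c\tau+d\neq0$ it is the limit of the values from $\mathbb H_-$. All other powers and roots are principal. Integrals to $i\infty$ are taken along vertical half-lines; an integral from $i\infty$ to $i\infty$ is $0$. A function $g$ on $A\subseteq\mathbb Q$ is a *quantum modular form* of weight $k$ and multiplier $\chi$ for $\Gamma_M$,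 with period functions $r_\gamma$, if for every $\gamma\in\Gamma_M$ the function $r_\gamma:\mathbb R\to\mathbb C$ is real-analytic outside a finite set and $g(\alpha)-(g|_{k,\chi}\gamma)(\alpha)=r_\gamma(\alpha)$ for all $\alpha\in A$ with $c\alpha+d\ne0$. **Theorem 1.1.** (a) Let $f$ be even. Then $\Theta_f(\alpha)$ exists for every $\alpha\in A_M$, and $\Theta_f$ is a quantum modular form of weight $3/2$ on $A_M$ for $\Gamma_M$, with multiplier $\chi$ and period functions $$r_{\gamma,f}(x)=-\frac{\sqrt M\,e^{\pi i/4}}{2\pi}\int_{\gamma^{-1}(i\infty)}^{i\infty}\theta_f(\tau)(\tau-x)^{-3/2}\,d\tau .$$ For each $\gamma\in\Gamma_M$ this integral converges absolutely for all $x\in\mathbb R$, and $r_{\gamma,f}$ is $C^\infty$ on $\mathbb R$ and real-analytic on $\mathbb R\setminus\{\gamma^{-1}(i\infty)\}$. (b) Let $f$ be odd. For $\tau\in\mathbb H_-$ the integral $$\hat\Theta_f(\tau)=\frac1{\sqrt{iM}}\int_{\bar\tau}^{i\infty}\Theta_f(w)(w-\tau)^{-1/2}\,dw$$ converges absolutely.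 For $\gamma\in\Gamma_M$ and $\operatorname{Im}\tau\le0$ put $$r_{\gamma,f}(\tau)=\frac1{\sqrt{iM}}\int_{\gamma^{-1}(i\infty)}^{i\infty}\Theta_f(w)(w-\tau)^{-1/2}\,dw,$$ which also converges absolutely. Then $\theta_f(\alpha)$ exists for every $\alpha\in\mathbb Q$, and $\theta_f$ is a strong quantum modular form of weight $1/2$ on $\mathbb Q$ for $\Gamma_M$ with multiplier $\chi$, in the following sense. 1. The functions $\theta_f$ and $\hat\Theta_f$ agree to infinite order at every $\alpha\in\mathbb Q$: there are $a_0,a_1,\dots\in\mathbb C$ such that, for every $N\ge 0$, as $y\to0^+$, $$\theta_f(\alpha+iy)=\sum_{r<N}a_r(iy)^r+O(y^N),\qquad \hat\Theta_f(\alpha-iy)=\sum_{r<N}a_r(-iy)^r+O(y^N).$$ 2. For all $\gamma\in\Gamma_M$ and $\tau\in\mathbb H_-$, $\hat\Theta_f(\tau)-(\hat\Theta_f|_{1/2,\chi}\gamma)(\tau)=r_{\gamma,f}(\tau)$. Moreover $r_{\gamma,f}$ is holomorphic on $\mathbb H_-$, is $C^\infty$ on $\mathbb H_-\cup\mathbb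 R$, and on the real line is $C^\infty$ and real-analytic on $\mathbb R\setminus\{\gamma^{-1}(i\infty)\}$. In addition, $\theta_f$ is a quantum modular form of weight $1/2$ on $B_M$ for $\Gamma_M$, with multiplier $\chi$ and period functions $r_{\gamma,f}|_{\mathbb R}$. -/

import Mathlib

open scoped MatrixGroups ContDiff Topology ComplexConjugate

noncomputable section

/-! ### Arithmetic data -/

/-- The set of `1 ≤ k ≤ M / 2` with `k ^ 2 ≡ k₀ (mod 2 M)`. -/
def squareClass (M k₀ : ℕ) : Finset ℕ :=
  (Finset.Icc 1 (M / 2)).filter fun k => k ^ 2 ≡ k₀ [MOD 2 * M]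

/-- `f` vanishes at every integer that is not congruent to `k` or `-k` modulo `M` for some
`k ∈ 𝓜`. For an `M`-periodic `f` this says that, among `1, …, M`, `f` is supported in
`𝓜 ∪ {M - k : k ∈ 𝓜}`. -/
def IsSupportedOn (f : ℤ → ℂ) (M : ℕ) (𝓜 : Finset ℕ) : Prop :=
  ∀ j : ℤ, (∀ k ∈ 𝓜, ¬ j ≡ (k : ℤ) [ZMOD (M : ℤ)] ∧ ¬ j ≡ -(k : ℤ) [ZMOD (M : ℤ)]) → f j = 0

/-- The sum of `f` over `𝓜`, in which the term `k = M / 2` (if present) is weighted by `1 / 2`. -/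
def primedSum (f : ℤ → ℂ) (M : ℕ) (𝓜 : Finset ℕ) : ℂ :=
  ∑ k ∈ 𝓜, if 2 * k = M then f k / 2 else f k

/-- `Γ_M`: the group `Γ₁(2M)` if `M` is even, and its subgroup of matrices with even upper
right entry if `M` is odd. -/
def GammaM (M : ℕ) : Subgroup SL(2, ℤ) where
  carrier := {γ | γ ∈ CongruenceSubgroup.Gamma1 (2 * M) ∧ (Odd M → (2 : ℤ) ∣ γ 0 1)}
  one_mem' := ⟨one_mem _, fun _ => by simp⟩
  mul_mem' := by
    rintro γ δ ⟨hγ, hγ'⟩ ⟨hδ, hδ'⟩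
    refine ⟨mul_mem hγ hδ, fun hM => ?_⟩
    rw [Matrix.SpecialLinearGroup.coe_mul, Matrix.mul_apply, Fin.sum_univ_two]
    exact dvd_add (Dvd.dvd.mul_left (hδ' hM) _) (Dvd.dvd.mul_right (hγ' hM) _)
  inv_mem' := by
    rintro γ ⟨hγ, hγ'⟩
    refine ⟨inv_mem hγ, fun hM => ?_⟩
    rw [Matrix.SpecialLinearGroup.SL2_inv_expl]
    simpa using hγ' hM

/-- The rational numbers that are equivalent to `i∞` under `G`: those of the form
`γ(i∞) = a / c` with `c ≠ 0`. -/
def cuspsInfty (G : Subgroup SL(2, ℤ)) : Set ℚ :=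
  {α | ∃ γ ∈ G, γ 1 0 ≠ 0 ∧ α = (γ 0 0 : ℚ) / (γ 1 0 : ℚ)}

/-- The rational numbers that are equivalent to `0` under `G`: those of the form
`γ(0) = b / d` with `d ≠ 0`. -/
def cuspsZero (G : Subgroup SL(2, ℤ)) : Set ℚ :=
  {α | ∃ γ ∈ G, γ 1 1 ≠ 0 ∧ α = (γ 0 1 : ℚ) / (γ 1 1 : ℚ)}

/-- `B_M`, the rationals equivalent to `i∞` under `Γ_M`. -/
def setB (M : ℕ) : Set ℚ := cuspsInfty (GammaM M)

/-- `A_M = A_{M,f}`: it is `B_M` if the primed sum of `f` is nonzero; otherwise it consists of the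
rationals equivalent to `0` or `i∞` under `Γ_M`. -/
def setA (f : ℤ → ℂ) (M : ℕ) (𝓜 : Finset ℕ) : Set ℚ :=
  {α | α ∈ setB M ∨ (primedSum f M 𝓜 = 0 ∧ α ∈ cuspsZero (GammaM M))}

/-- The extended Jacobi symbol `(c / d)` for odd `d`, possibly negative:
`(c / d) = (c / |d|)` except that the sign is changed when `c < 0` and `d < 0`. In particular
`(0 / ±1) = 1`. -/
def extendedJacobi (c d : ℤ) : ℤ :=
  if c < 0 ∧ d < 0 then -jacobiSym c d.natAbs else jacobiSym c d.natAbs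

/-- `ε_d = 1` or `i` according as `d ≡ 1` or `3 (mod 4)`. -/
def epsilonFactor (d : ℤ) : ℂ := if d % 4 = 1 then 1 else Complex.I

/-- The multiplier `χ(γ) = e^{π i a b k₀ / M} (2 c M / d) ε_d⁻¹`. -/
def multiplier (M k₀ : ℕ) (γ : SL(2, ℤ)) : ℂ :=
  Complex.exp (Real.pi * Complex.I * (γ 0 0 : ℂ) * (γ 0 1 : ℂ) * (k₀ : ℂ) / (M : ℂ)) *
    (extendedJacobi (2 * γ 1 0 * (M : ℤ)) (γ 1 1) : ℂ) * (epsilonFactor (γ 1 1))⁻¹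

/-! ### Partial theta series and their boundary values -/

/-- `θ_f(z) = ∑_{n ≥ 0} f(n) q^{n² / 2M}`, `q = e^{2 π i z}`, for `z` in the upper half-plane. -/
def partialTheta (f : ℤ → ℂ) (M : ℕ) (z : ℂ) : ℂ :=
  ∑' n : ℕ, f n * Complex.exp (2 * Real.pi * Complex.I * z * ((n : ℂ) ^ 2 / (2 * (M : ℂ))))

/-- `Θ_f(z) = ∑_{n ≥ 0} n f(n) q^{n² / 2M}`, `q = e^{2 π i z}`, for `z` in the upper
half-plane. -/
def partialThetaDeriv (f : ℤ → ℂ) (M : ℕ) (z : ℂ) : ℂ :=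
  ∑' n : ℕ, (n : ℂ) * f n *
    Complex.exp (2 * Real.pi * Complex.I * z * ((n : ℂ) ^ 2 / (2 * (M : ℂ))))

/-- `F(α + i y) → v` as `y → 0⁺`. -/
def HasRadialLimit (F : ℂ → ℂ) (α : ℚ) (v : ℂ) : Prop :=
  Filter.Tendsto (fun y : ℝ => F ((α : ℂ) + y * Complex.I)) (𝓝[>] (0 : ℝ)) (𝓝 v)

/-- The value at the rational number `α` of a function `F` on the upper half-plane, namely
`lim_{y → 0⁺} F(α + i y)` (meaningful when this limit exists). -/
def radialValue (F : ℂ → ℂ) (α : ℚ) : ℂ :=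
  Filter.limUnder (𝓝[>] (0 : ℝ)) (fun y : ℝ => F ((α : ℂ) + y * Complex.I))

/-! ### The slash operator on the closed lower half-plane -/

/-- The automorphy factor `(c τ + d)^k` for `τ` in the closed lower half-plane, `c τ + d ≠ 0`.
For `Im τ < 0` it is the principal power (see `autFactor_of_im_neg`); for real `τ` it is the limit
of the values at points of the lower half-plane (see `tendsto_autFactor`). So if `c > 0` then
`arg (c τ + d) ∈ [-π, 0]`, and if `c < 0` then `arg (c τ + d) ∈ [0, π]`. -/
def autFactor (k : ℝ) (γ : SL(2, ℤ)) (τ : ℂ) : ℂ :=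
  if 0 < γ 1 0 then conj (((γ 1 0 : ℂ) * conj τ + (γ 1 1 : ℂ)) ^ (k : ℂ))
  else ((γ 1 0 : ℂ) * τ + (γ 1 1 : ℂ)) ^ (k : ℂ)

/-- The slash operator `(g|_{k,χ} γ)(τ) = conj χ(γ) (cτ + d)^{-k} g((aτ + b)/(cτ + d))` on
functions on the lower half-plane. -/
def slashLower (k : ℝ) (χ : SL(2, ℤ) → ℂ) (g : ℂ → ℂ) (γ : SL(2, ℤ)) (τ : ℂ) : ℂ :=
  conj (χ γ) * autFactor (-k) γ τ *
    g (((γ 0 0 : ℂ) * τ + (γ 0 1 : ℂ)) / ((γ 1 0 : ℂ) * τ + (γ 1 1 : ℂ)))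

/-- The slash operator on functions on rational numbers, at `α` with `c α + d ≠ 0`. -/
def slashRat (k : ℝ) (χ : SL(2, ℤ) → ℂ) (g : ℚ → ℂ) (γ : SL(2, ℤ)) (α : ℚ) : ℂ :=
  conj (χ γ) * autFactor (-k) γ (α : ℂ) *
    g (((γ 0 0 : ℚ) * α + (γ 0 1 : ℚ)) / ((γ 1 0 : ℚ) * α + (γ 1 1 : ℚ)))

theorem autFactor_of_im_neg (k : ℝ) (γ : SL(2, ℤ)) (τ : ℂ) (hτ : τ.im < 0) :
    autFactor k γ τ = ((γ 1 0 : ℂ) * τ + (γ 1 1 : ℂ)) ^ (k : ℂ) := by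
  unfold autFactor
  split_ifs with hc
  · have him : ((γ 1 0 : ℂ) * τ + (γ 1 1 : ℂ)).im < 0 := by
      have hc' : (0 : ℝ) < (γ 1 0 : ℤ) := by exact_mod_cast hc
      simpa using mul_neg_of_pos_of_neg hc' hτ
    have harg : ((γ 1 0 : ℂ) * τ + (γ 1 1 : ℂ)).arg ≠ Real.pi := by
      intro h
      rw [Complex.arg_eq_pi_iff] at h
      exact him.ne h.2
    have := Complex.cpow_conj ((γ 1 0 : ℂ) * τ + (γ 1 1 : ℂ)) (k : ℂ) harg
    simp only [map_add, map_mul, map_intCast, Complex.conj_ofReal] at this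
    simp [this]
  · rfl

theorem tendsto_cpow_upper (k : ℂ) (z : ℂ) (hz : z ≠ 0) (him : z.im = 0) :
    ContinuousWithinAt (fun w : ℂ => w ^ k) {w : ℂ | 0 ≤ w.im} z := by
  by_cases hs : z ∈ Complex.slitPlane
  · exact (continuousAt_cpow_const hs).continuousWithinAt
  · have hre : z.re < 0 := by
      rw [Complex.mem_slitPlane_iff] at hs
      push Not at hs
      refine lt_of_le_of_ne hs.1 fun h => hz (Complex.ext h him)
    have hlog := Complex.continuousWithinAt_log_of_re_neg_of_im_zero hre him
    have hexp : ContinuousWithinAt (fun w : ℂ => Complex.exp (Complex.log w * k))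
        {w : ℂ | 0 ≤ w.im} z := (hlog.mul continuousWithinAt_const).cexp
    have hev : (fun w : ℂ => w ^ k) =ᶠ[𝓝[{w : ℂ | 0 ≤ w.im}] z]
        fun w => Complex.exp (Complex.log w * k) := by
      filter_upwards [mem_nhdsWithin_of_mem_nhds (isOpen_ne.mem_nhds hz)] with w hw
      exact Complex.cpow_def_of_ne_zero hw k
    exact hexp.congr_of_eventuallyEq hev (Complex.cpow_def_of_ne_zero hz k)

theorem tendsto_autFactor (k : ℝ) (γ : SL(2, ℤ)) (x : ℝ)
    (hx : (γ 1 0 : ℝ) * x + (γ 1 1 : ℝ) ≠ 0) :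
    Filter.Tendsto (autFactor k γ) (𝓝[{τ : ℂ | τ.im < 0}] (x : ℂ)) (𝓝 (autFactor k γ x)) := by
  have hx' : ((γ 1 0 : ℂ) * (x : ℂ) + (γ 1 1 : ℂ)) ≠ 0 := by exact_mod_cast hx
  have him : ((γ 1 0 : ℂ) * (x : ℂ) + (γ 1 1 : ℂ)).im = 0 := by simp
  have key := tendsto_cpow_upper (k : ℂ) _ hx' him
  by_cases hc : 0 < γ 1 0
  · have hc' : (0 : ℝ) < (γ 1 0 : ℤ) := by exact_mod_cast hc
    have heq : autFactor k γ = fun τ => conj (((γ 1 0 : ℂ) * conj τ + (γ 1 1 : ℂ)) ^ (k : ℂ)) := by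
      funext τ
      simp [autFactor, hc]
    rw [heq]
    refine (Complex.continuous_conj.tendsto _).comp ?_
    rw [Complex.conj_ofReal]
    refine key.tendsto.comp (tendsto_nhdsWithin_iff.2 ⟨?_, ?_⟩)
    · have h : Continuous fun τ : ℂ => (γ 1 0 : ℂ) * conj τ + (γ 1 1 : ℂ) := by fun_prop
      have h2 := h.tendsto (x : ℂ)
      rw [Complex.conj_ofReal] at h2
      exact h2.mono_left nhdsWithin_le_nhds
    · filter_upwards [self_mem_nhdsWithin] with τ hτ
      have : (γ 1 0 : ℝ) * τ.im < 0 := mul_neg_of_pos_of_neg hc' hτ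
      simpa using this.le
  · have hc' : (γ 1 0 : ℝ) ≤ 0 := by exact_mod_cast not_lt.1 hc
    have heq : autFactor k γ = fun τ => ((γ 1 0 : ℂ) * τ + (γ 1 1 : ℂ)) ^ (k : ℂ) := by
      funext τ
      simp [autFactor, hc]
    rw [heq]
    refine key.tendsto.comp (tendsto_nhdsWithin_iff.2 ⟨?_, ?_⟩)
    · have h : Continuous fun τ : ℂ => (γ 1 0 : ℂ) * τ + (γ 1 1 : ℂ) := by fun_prop
      exact (h.tendsto (x : ℂ)).mono_left nhdsWithin_le_nhds
    · filter_upwards [self_mem_nhdsWithin] with τ hτ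
      have : 0 ≤ (γ 1 0 : ℝ) * τ.im := mul_nonneg_of_nonpos_of_nonpos hc' (le_of_lt hτ)
      simpa using this

/-! ### Quantum modular forms -/

/-- `g`, a function on the set `A` of rationals, is a quantum modular form of weight `k` and
multiplier `χ` for `G` with period functions `r γ`: for each `γ ∈ G`, the function `r γ` is
real-analytic on the real line outside a finite set and
`g(α) - (g|_{k,χ} γ)(α) = r_γ(α)` for all `α ∈ A` other than `γ⁻¹(i∞)`. -/
def IsQuantumModularForm (k : ℝ) (G : Subgroup SL(2, ℤ)) (χ : SL(2, ℤ) → ℂ) (A : Set ℚ)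
    (g : ℚ → ℂ) (r : SL(2, ℤ) → ℝ → ℂ) : Prop :=
  ∀ γ ∈ G,
    (∃ S : Set ℝ, S.Finite ∧ AnalyticOnNhd ℝ (r γ) Sᶜ) ∧
    ∀ α ∈ A, (γ 1 0 : ℚ) * α + (γ 1 1 : ℚ) ≠ 0 → g α - slashRat k χ g γ α = r γ (α : ℝ)

/-- A function `F` on the upper half-plane and a function `Fhat` on the lower half-plane agree to
infinite order at `α`: as `y → 0⁺`, `F(α + i y)` and `Fhat(α - i y)` have asymptotic expansions
given by the same formal power series `∑ a_r (z - α)^r`, at `z = α + i y` and `z = α - i y`. -/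
def AgreeToInfiniteOrderAt (F Fhat : ℂ → ℂ) (α : ℚ) : Prop :=
  ∃ a : ℕ → ℂ, ∀ N : ℕ,
    (fun y : ℝ => F ((α : ℂ) + y * Complex.I) -
        ∑ r ∈ Finset.range N, a r * ((y : ℂ) * Complex.I) ^ r)
      =O[𝓝[>] (0 : ℝ)] (fun y : ℝ => y ^ N) ∧
    (fun y : ℝ => Fhat ((α : ℂ) - y * Complex.I) -
        ∑ r ∈ Finset.range N, a r * (-((y : ℂ) * Complex.I)) ^ r)
      =O[𝓝[>] (0 : ℝ)] (fun y : ℝ => y ^ N)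

/-- `F` (on the upper half-plane) is a strong quantum modular form of weight `k` and multiplier
`χ` on `ℚ` for `G`, through the companion `Fhat` on the lower half-plane and the period functions
`r γ`: `F` and `Fhat` agree to infinite order at all rationals, and for each `γ ∈ G`,
`Fhat - Fhat|_{k,χ} γ = r_γ` on the lower half-plane, where `r_γ` is holomorphic on the lower
half-plane, is `C^∞` up to the real line, and on the real line is real-analytic outside a finite
set. -/
def IsStrongQuantumModularForm (k : ℝ) (G : Subgroup SL(2, ℤ)) (χ : SL(2, ℤ) → ℂ)
    (F Fhat : ℂ → ℂ) (r : SL(2, ℤ) → ℂ → ℂ) : Prop :=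
  (∀ α : ℚ, AgreeToInfiniteOrderAt F Fhat α) ∧
  ∀ γ ∈ G,
    (∀ τ : ℂ, τ.im < 0 → Fhat τ - slashLower k χ Fhat γ τ = r γ τ) ∧
    DifferentiableOn ℂ (r γ) {τ : ℂ | τ.im < 0} ∧
    ContDiffOn ℝ ∞ (r γ) {τ : ℂ | τ.im ≤ 0} ∧
    ∃ S : Set ℝ, S.Finite ∧ AnalyticOnNhd ℝ (fun x : ℝ => r γ (x : ℂ)) Sᶜ

/-! ### Eichler integrals -/

/-- The integral of `F` along the vertical half-line from `z₀` to `i∞`. -/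
def verticalIntegral (F : ℂ → ℂ) (z₀ : ℂ) : ℂ :=
  ∫ s in Set.Ioi (0 : ℝ), F (z₀ + s * Complex.I) * Complex.I

/-- Absolute convergence of the integral of `F` along the vertical half-line from `z₀` to
`i∞`. -/
def VerticalIntegrable (F : ℂ → ℂ) (z₀ : ℂ) : Prop :=
  MeasureTheory.IntegrableOn (fun s : ℝ => F (z₀ + s * Complex.I) * Complex.I) (Set.Ioi (0 : ℝ))

/-- `γ⁻¹(i∞) = -d / c`, for `c ≠ 0`. -/
def cuspPoint (γ : SL(2, ℤ)) : ℝ := -(γ 1 1 : ℝ) / (γ 1 0 : ℝ)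

/-- The integrand `θ_f(τ) (τ - z̄)^{-3/2}`. -/
def evenKernel (f : ℤ → ℂ) (M : ℕ) (z τ : ℂ) : ℂ :=
  partialTheta f M τ * (τ - conj z) ^ (-(3 / 2) : ℂ)

/-- The integrand `Θ_f(w) (w - τ)^{-1/2}`. -/
def oddKernel (f : ℤ → ℂ) (M : ℕ) (τ w : ℂ) : ℂ :=
  partialThetaDeriv f M w * (w - τ) ^ (-(1 / 2) : ℂ)

/-- The period function
`-(√M e^{π i / 4} / 2π) ∫_{γ⁻¹(i∞)}^{i∞} θ_f(τ) (τ - z̄)^{-3/2} dτ`;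
it is `0` if `γ⁻¹(i∞) = i∞`. -/
def evenPeriod (f : ℤ → ℂ) (M : ℕ) (γ : SL(2, ℤ)) (z : ℂ) : ℂ :=
  if γ 1 0 = 0 then 0
  else -((Real.sqrt M : ℂ) * Complex.exp (Real.pi * Complex.I / 4) / (2 * Real.pi)) *
    verticalIntegral (evenKernel f M z) (cuspPoint γ : ℂ)

/-- The non-holomorphic Eichler integral of `Θ_f`,
`(1 / √(i M)) ∫_{τ̄}^{i∞} Θ_f(w) (w - τ)^{-1/2} dw`, for `τ` in the lower half-plane. -/
def eichlerIntegral (f : ℤ → ℂ) (M : ℕ) (τ : ℂ) : ℂ :=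
  1 / (Complex.I * (M : ℂ)) ^ (1 / 2 : ℂ) * verticalIntegral (oddKernel f M τ) (conj τ)

/-- The period function `(1 / √(i M)) ∫_{γ⁻¹(i∞)}^{i∞} Θ_f(w) (w - τ)^{-1/2} dw`;
it is `0` if `γ⁻¹(i∞) = i∞`. -/
def oddPeriod (f : ℤ → ℂ) (M : ℕ) (γ : SL(2, ℤ)) (τ : ℂ) : ℂ :=
  if γ 1 0 = 0 then 0
  else 1 / (Complex.I * (M : ℂ)) ^ (1 / 2 : ℂ) *
    verticalIntegral (oddKernel f M τ) (cuspPoint γ : ℂ)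

end

noncomputable section

/-! ### The Jacobi theta function under matrices congruent to the identity modulo `2` -/

/-! For even `f` the series θ_f is half of a sum over all of ℤ, hence a modular form of weight 1/2
on Γ_M; for odd `f` the same holds for Θ_f in weight 3/2. The other series of the pair is not
modular, but its boundary values are Eichler integrals of the modular one, and these obey a
transformation law up to a period integral.

Modularity. `thetaLaw` gives the two-variable Jacobi theta function its explicit multiplier by
Euclidean descent on the bottom row. `residueTheta_moebius` transports it to theta series of residue
classes: since a ≡ 1 mod 2M the classes are not permuted, and each is only multiplied by e^{πi a b
h²/M}. On the support of `f` this factor does not depend on h, because h² lies in one fixed class.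
Differentiating in the elliptic variable gives the odd case.

Eichler integrals. Since the integral of n s^{-1/2} e^{-πn²s/M} over s > 0 is √M,
`integral_rpow_mul_qSeries` expresses Σ c(n) q^{n²/2M} through Σ n c(n) q^{n²/2M}. For odd `f` and t
running from y to ∞, θ_f(α+iy) is the integral of (t-y)^{-1/2} Θ_f(α+it) up to 1/√M, while the
Eichler integral at α-iy has (t+y)^{-1/2} instead. Expanding in y gives the same moments with signs
(-1)^r (`IsFlat.halfIntegral_expansion`), which is agreement to infinite order. For even `f`, Θ_f is
such an integral of the derivative of θ_f, and an integration by parts at y = 0 produces the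
exponent -3/2 (`IsCuspidal.moment_deriv`).

Periods. If Φ has weight m/2, then Φ(w)(w-τ)^{(m-4)/2} dw is equivariant in (w, τ), so applying γ to
an Eichler integral costs exactly the integral from γ⁻¹(i∞) to i∞ (`verticalIntegral_moebius`).
Contours are never deformed: vertical integrals are primitives
(`IsCuspidal.hasDerivAt_verticalIntegral`), two primitives differ by a constant, and the constant is
read off at the cusp.

Decay. Everything at the real line rests on Φ vanishing there to infinite order in cones. At cusps
equivalent to i∞ this is modularity. At 0 the inversion formula leaves the constant term Σ f, which
is twice the primed sum, whence the set A_M; for odd `f` there is no constant term, and twisting `f`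
by an additive character reaches every rational. The same decay pays for the negative powers of s
that appear on differentiating the period integrals, so these are smooth up to the real line; away
from γ⁻¹(i∞) they extend holomorphically. -/

theorem jacobiSym_four_mul (m : ℤ) {n : ℕ} (hn : Odd n) : jacobiSym (4 * m) n = jacobiSym m n := by
  rw [jacobiSym.mul_left, jacobiSym.at_four hn, one_mul]

/-- Modulo N the number 4m is ±1 with the sign of m, 4 is a square, and N ≡ 3 mod 4 gives (-1/N) =
-1. -/
theorem jacobiSym_four_mul_natAbs_sub_one {m : ℤ} {N : ℕ}
    (hN : N + 1 = 4 * m.natAbs) : jacobiSym m N = if m < 0 then -1 else 1 := by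
  have hodd : Odd N := by
    rw [Nat.odd_iff]; omega
  rw [← jacobiSym_four_mul m hodd]
  split_ifs with h
  · have h1 : (4 * m) % (N : ℤ) = (-1) % (N : ℤ) := by
      have : 4 * m = -1 + (N : ℤ) * (-1) := by omega
      rw [this, Int.add_mul_emod_self_left]
    rw [jacobiSym.mod_left' h1, jacobiSym.at_neg_one hodd,
      ZMod.χ₄_nat_three_mod_four (by omega)]
  · have h1 : (4 * m) % (N : ℤ) = 1 % (N : ℤ) := by
      have : 4 * m = 1 + (N : ℤ) * 1 := by omega
      rw [this, Int.add_mul_emod_self_left]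
    rw [jacobiSym.mod_left' h1, jacobiSym.one_left]

/-- With N = 4|m| - 1 one has e ≡ -d ≡ N d modulo 4|m|, and the symbol (m/·) depends only on its odd
lower entry modulo 4|m|. -/
theorem jacobiSym_reflect {m : ℤ} (hm : m ≠ 0) {d e : ℕ} (hd : Odd d) (he : Odd e)
    (h : d + e = 4 * m.natAbs) :
    jacobiSym m e = (if m < 0 then -1 else 1) * jacobiSym m d := by
  obtain ⟨N, hN⟩ : ∃ N, N + 1 = 4 * m.natAbs := ⟨4 * m.natAbs - 1, by omega⟩
  have hNo : Odd N := by rw [Nat.odd_iff]; omega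
  have hd0 : d ≠ 0 := by rintro rfl; simp at hd
  rw [← jacobiSym_four_mul_natAbs_sub_one hN, ← jacobiSym.mul_right' m (by omega) hd0,
    jacobiSym.mod_right m he, jacobiSym.mod_right m (hNo.mul hd)]
  congr 1
  obtain ⟨k, rfl⟩ : ∃ k, d = k + 1 := ⟨d - 1, by omega⟩
  have : N * (k + 1) = e + (4 * m.natAbs) * k := by
    rw [← hN] at h ⊢
    have : N = k + e := by omega
    rw [this]; ring
  rw [this, Nat.add_mul_mod_self_left]

/-- Periodicity modulo 4|m| if the shift stays positive. If it crosses zero, reflection contributes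
the sign of m, and the sign convention of the extended symbol undoes it. -/
theorem extendedJacobi_sub_four_mul_natAbs {m d : ℤ} (hm : m ≠ 0) (hd : Odd d) (hd0 : 0 < d) :
    extendedJacobi (4 * m) (d - 4 * m.natAbs) = extendedJacobi (4 * m) d := by
  have hdn : Odd d.natAbs := Int.natAbs_odd.2 hd
  have hen : Odd (d - 4 * m.natAbs).natAbs :=
    Int.natAbs_odd.2 (hd.sub_even ⟨2 * m.natAbs, by ring⟩)
  unfold extendedJacobi
  rw [if_neg (by omega : ¬ (4 * m < 0 ∧ d < 0)), jacobiSym_four_mul _ hdn, jacobiSym_four_mul _ hen]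
  rcases lt_or_ge (d - 4 * m.natAbs) 0 with h | h
  · rw [jacobiSym_reflect hm hdn hen (by omega)]
    split_ifs <;> omega
  · rw [if_neg (by omega), jacobiSym.mod_right m hen, jacobiSym.mod_right m hdn]
    congr 1
    have : d.natAbs = (d - 4 * m.natAbs).natAbs + 4 * m.natAbs := by omega
    rw [this, Nat.add_mod_right]

theorem epsilonFactor_neg {d : ℤ} (hd : Odd d) : epsilonFactor (-d) =
    if d % 4 = 1 then Complex.I else 1 := by
  unfold epsilonFactor
  rw [Int.odd_iff] at hd
  split_ifs <;> first | omega | rfl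

theorem epsilonFactor_add_four_mul (d k : ℤ) : epsilonFactor (d + 4 * k) = epsilonFactor d := by
  unfold epsilonFactor
  rw [Int.add_mul_emod_self_left]

/-- The multiplier of the Jacobi theta function at a matrix with bottom row `(c, d)`, with `c` even
and `d` odd. -/
def thetaMultiplier (c d : ℤ) : ℂ := (extendedJacobi (2 * c) d : ℂ) * (epsilonFactor d)⁻¹

/-- The symbol (-1/|d|) and the exchange of the values of ε combine to ∓i, the factor gained by the
principal root of cτ + d when the row is negated; see `thetaLaw_neg`. -/
theorem thetaMultiplier_of_neg {c d : ℤ} (hc : c ≠ 0) (hd : Odd d) (hd0 : d < 0) :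
    thetaMultiplier c d =
      (if 0 < c then -Complex.I else Complex.I) * thetaMultiplier (-c) (-d) := by
  have hdn : Odd d.natAbs := Int.natAbs_odd.2 hd
  have hd2 := Int.odd_iff.1 hd
  unfold thetaMultiplier extendedJacobi
  rw [if_neg (by omega : ¬(2 * -c < 0 ∧ -d < 0)), Int.natAbs_neg, epsilonFactor_neg hd,
    show 2 * -c = -(2 * c) by ring, jacobiSym.neg _ hdn, epsilonFactor]
  rcases (by omega : d % 4 = 1 ∨ d % 4 = 3) with h | h
  · rw [ZMod.χ₄_nat_three_mod_four (by omega)]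
    split_ifs <;> first | omega | (push_cast; rw [inv_one]; ring_nf; rw [Complex.inv_I]; ring_nf; simp)
  · rw [ZMod.χ₄_nat_one_mod_four (by omega)]
    split_ifs <;> first | omega | (push_cast; rw [Complex.inv_I]; ring)

/-! ### Multiplicativity of the principal square root. -/

theorem cpow_half_sq (z : ℂ) : (z ^ (1 / 2 : ℂ)) ^ 2 = z := by
  rw [← Complex.cpow_nat_mul]; norm_num

theorem cpow_half_eq (z : ℂ) (hz : z ≠ 0) :
    z ^ (1 / 2 : ℂ) = (Real.sqrt ‖z‖ : ℂ) * (Real.cos (z.arg / 2) + Real.sin (z.arg / 2) * Complex.I) := by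
  rw [Complex.cpow_def_of_ne_zero hz, Complex.log, show ((Real.log ‖z‖ : ℂ) + z.arg * Complex.I) * (1 / 2) =
    ((Real.log ‖z‖ / 2 : ℝ) : ℂ) + ((z.arg / 2 : ℝ) : ℂ) * Complex.I by push_cast; ring, Complex.exp_add,
    Complex.exp_mul_I, ← Complex.ofReal_exp, ← Complex.ofReal_cos, ← Complex.ofReal_sin]
  congr 2
  rw [Real.sqrt_eq_rpow, Real.rpow_def_of_pos (norm_pos_iff.2 hz)]
  congr 1; ring

theorem re_cpow_half_pos {z : ℂ} (hz : z ∈ Complex.slitPlane) : 0 < (z ^ (1 / 2 : ℂ)).re := by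
  have hz0 := Complex.slitPlane_ne_zero hz
  rw [cpow_half_eq z hz0]
  have h1 := Complex.mem_slitPlane_iff_arg.1 hz
  have h2 := Complex.arg_le_pi z
  have h3 := Complex.neg_pi_lt_arg z
  have hpi : z.arg < Real.pi := lt_of_le_of_ne h2 h1.1
  have hs : 0 < Real.sqrt ‖z‖ := Real.sqrt_pos.2 (norm_pos_iff.2 hz0)
  have hc : 0 < Real.cos (z.arg / 2) := Real.cos_pos_of_mem_Ioo ⟨by linarith, by linarith⟩
  simpa [← Complex.ofReal_sin, ← Complex.ofReal_cos, -Complex.ofReal_sin, -Complex.ofReal_cos] using mul_pos hs hc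

/-- The sign of `Im z` is that of the imaginary part of the square root of `z`. -/
theorem im_cpow_half (z : ℂ) : 2 * (z ^ (1 / 2 : ℂ)).re * (z ^ (1 / 2 : ℂ)).im = z.im := by
  conv_rhs => rw [← cpow_half_sq z]
  rw [sq, Complex.mul_im]; ring

theorem slitPlane_of_im_ne_zero {z : ℂ} (h : z.im ≠ 0) : z ∈ Complex.slitPlane := Or.inr h

/-- The two sides have equal squares, so only a sign is at stake. All three roots have positive real
part, and the signs of their imaginary parts exclude the minus sign. -/
theorem cpow_half_mul_of_im_pos {x y : ℂ} (hx : 0 < x.im) (hy : y ∈ Complex.slitPlane)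
    (hxy : x * y ∈ Complex.slitPlane) (h : y.im ≤ 0 ∨ 0 ≤ (x * y).im) :
    (x * y) ^ (1 / 2 : ℂ) = x ^ (1 / 2 : ℂ) * y ^ (1 / 2 : ℂ) := by
  have hsq : ((x * y) ^ (1 / 2 : ℂ)) ^ 2 = (x ^ (1 / 2 : ℂ) * y ^ (1 / 2 : ℂ)) ^ 2 := by
    rw [mul_pow, cpow_half_sq, cpow_half_sq, cpow_half_sq]
  rcases sq_eq_sq_iff_eq_or_eq_neg.1 hsq with h1 | h1
  · exact h1
  exfalso
  have px := re_cpow_half_pos (slitPlane_of_im_ne_zero hx.ne')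
  have py := re_cpow_half_pos hy
  have pxy := re_cpow_half_pos hxy
  have ix := im_cpow_half x
  have iy := im_cpow_half y
  have ixy := im_cpow_half (x * y)
  have hxi : 0 < (x ^ (1 / 2 : ℂ)).im := by
    by_contra hcon
    nlinarith
  have hre := congrArg Complex.re h1
  have him := congrArg Complex.im h1
  rw [Complex.neg_re, Complex.mul_re] at hre
  rw [Complex.neg_im, Complex.mul_im] at him
  rcases le_or_gt (y ^ (1 / 2 : ℂ)).im 0 with hyi | hyi
  · nlinarith [mul_pos px py, mul_nonneg hxi.le (neg_nonneg.2 hyi)]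
  · rcases h with h | h
    · nlinarith [mul_pos py hyi]
    · have : 0 ≤ ((x * y) ^ (1 / 2 : ℂ)).im := by
        by_contra hcon
        nlinarith [mul_pos pxy (neg_pos.2 (not_le.1 hcon))]
      nlinarith [mul_pos px hyi, mul_pos hxi py]

theorem conj_cpow_half {z : ℂ} (hz : z ∈ Complex.slitPlane) :
    conj (z ^ (1 / 2 : ℂ)) = (conj z) ^ (1 / 2 : ℂ) := by
  have := Complex.conj_cpow z (1 / 2 : ℂ) (Complex.mem_slitPlane_iff_arg.1 hz).1
  rw [this, map_div₀, map_one, map_ofNat]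

theorem conj_mem_slitPlane {z : ℂ} (hz : z ∈ Complex.slitPlane) : conj z ∈ Complex.slitPlane := by
  rw [Complex.mem_slitPlane_iff] at hz ⊢
  simpa using hz

theorem cpow_half_mul_of_im_neg {x y : ℂ} (hx : x.im < 0) (hy : y ∈ Complex.slitPlane)
    (hxy : x * y ∈ Complex.slitPlane) (h : 0 ≤ y.im ∨ (x * y).im ≤ 0) :
    (x * y) ^ (1 / 2 : ℂ) = x ^ (1 / 2 : ℂ) * y ^ (1 / 2 : ℂ) := by
  have hx' : x ∈ Complex.slitPlane := slitPlane_of_im_ne_zero hx.ne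
  have := cpow_half_mul_of_im_pos (x := conj x) (y := conj y) (by simpa using hx)
    (conj_mem_slitPlane hy) (by rw [← map_mul]; exact conj_mem_slitPlane hxy)
    (by rw [← map_mul, Complex.conj_im, Complex.conj_im]; simpa [-Complex.mul_im] using h)
  rw [← map_mul, ← conj_cpow_half hxy, ← conj_cpow_half hx', ← conj_cpow_half hy, ← map_mul] at this
  exact (starRingEnd ℂ).injective this

theorem cpow_half_eq_of_sq {p z : ℂ} (h : p ^ 2 = z) (hp : 0 < p.re) : z ^ (1 / 2 : ℂ) = p := by
  rw [← h, one_div]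
  exact Complex.sq_cpow_two_inv hp

theorem im_cpow_half_pos {z : ℂ} (hz : 0 < z.im) : 0 < (z ^ (1 / 2 : ℂ)).im := by
  have h1 := re_cpow_half_pos (slitPlane_of_im_ne_zero hz.ne')
  have h2 := im_cpow_half z
  by_contra hcon
  nlinarith

theorem im_cpow_half_neg {z : ℂ} (hz : z.im < 0) : (z ^ (1 / 2 : ℂ)).im < 0 := by
  have h1 := re_cpow_half_pos (slitPlane_of_im_ne_zero hz.ne)
  have h2 := im_cpow_half z
  by_contra hcon
  nlinarith

theorem neg_cpow_half_of_im_pos {z : ℂ} (hz : 0 < z.im) :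
    (-z) ^ (1 / 2 : ℂ) = -Complex.I * z ^ (1 / 2 : ℂ) := by
  refine cpow_half_eq_of_sq ?_ (by simpa using im_cpow_half_pos hz)
  rw [mul_pow, cpow_half_sq]; simp

theorem neg_cpow_half_of_im_neg {z : ℂ} (hz : z.im < 0) :
    (-z) ^ (1 / 2 : ℂ) = Complex.I * z ^ (1 / 2 : ℂ) := by
  refine cpow_half_eq_of_sq ?_ (by simpa using im_cpow_half_neg hz)
  rw [mul_pow, cpow_half_sq]; simp

theorem abs_im_cpow_half_lt {z : ℂ} (hz : 0 < z.re) :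
    |(z ^ (1 / 2 : ℂ)).im| < (z ^ (1 / 2 : ℂ)).re := by
  have h1 := re_cpow_half_pos (Or.inl hz)
  have h2 := congrArg Complex.re (cpow_half_sq z)
  rw [sq, Complex.mul_re] at h2
  exact abs_lt_of_sq_lt_sq (by nlinarith) h1.le

/-- The roots of y and xy both have argument of modulus below π/4, so their quotient has positive
real part and must be the principal root of x. -/
theorem cpow_half_mul_of_re_pos {x y : ℂ} (hy : 0 < y.re) (hxy : 0 < (x * y).re) :
    (x * y) ^ (1 / 2 : ℂ) = x ^ (1 / 2 : ℂ) * y ^ (1 / 2 : ℂ) := by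
  have hy0 : y ≠ 0 := by rintro rfl; simp at hy
  have hr0 : y ^ (1 / 2 : ℂ) ≠ 0 := fun h => by
    have := re_cpow_half_pos (Or.inl hy); rw [h] at this; simp at this
  have : x ^ (1 / 2 : ℂ) = (x * y) ^ (1 / 2 : ℂ) / y ^ (1 / 2 : ℂ) := by
    refine cpow_half_eq_of_sq ?_ ?_
    · rw [div_pow, cpow_half_sq, cpow_half_sq, mul_div_cancel_right₀ _ hy0]
    · rw [Complex.div_re, ← add_div]
      refine div_pos ?_ (Complex.normSq_pos.2 hr0)
      have a1 := abs_im_cpow_half_lt hy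
      have a2 := abs_im_cpow_half_lt hxy
      have := mul_lt_mul'' a2 a1 (abs_nonneg _) (abs_nonneg _)
      rw [← abs_mul] at this
      linarith [neg_abs_le (((x * y) ^ (1 / 2 : ℂ)).im * (y ^ (1 / 2 : ℂ)).im)]
  rw [this, div_mul_cancel₀ _ hr0]

/-! ### The theta transformation law on generators, and its propagation. -/

/-- The transformation law of the two-variable Jacobi theta function under the matrix with entries
`a, b, c, d`, with multiplier `v`. -/
def ThetaLaw (a b c d : ℤ) (v : ℂ) : Prop :=
  ∀ τ : ℂ, 0 < τ.im → ∀ w : ℂ,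
    jacobiTheta₂ (w / (c * τ + d)) ((a * τ + b) / (c * τ + d)) =
      v * (c * τ + d) ^ (1 / 2 : ℂ) *
        Complex.exp (Real.pi * Complex.I * c * w ^ 2 / (c * τ + d)) * jacobiTheta₂ w τ

theorem jacobiTheta₂_add_even (w τ : ℂ) (k : ℤ) :
    jacobiTheta₂ w (τ + 2 * k) = jacobiTheta₂ w τ := by
  have h : Function.Periodic (jacobiTheta₂ w) 2 := jacobiTheta₂_add_right w
  rw [mul_comm]
  exact h.int_mul k τ

theorem denom_ne_zero_of_im_pos {c d : ℤ} (hcd : c ≠ 0 ∨ d ≠ 0) {τ : ℂ} (hτ : τ.im ≠ 0) :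
    (c * τ + d : ℂ) ≠ 0 := by
  intro h
  have him : (c : ℝ) * τ.im = 0 := by simpa using congrArg Complex.im h
  have hc : c = 0 := by
    rcases mul_eq_zero.1 him with h' | h'
    · exact_mod_cast h'
    · exact absurd h' hτ
  subst hc
  simp at h
  tauto

theorem im_moebius (a b c d : ℤ) (τ : ℂ) :
    ((a * τ + b) / (c * τ + d) : ℂ).im =
      ((a * d - b * c : ℤ) : ℝ) * τ.im / Complex.normSq (c * τ + d) := by
  rw [Complex.div_im]
  simp
  ring

theorem im_moebius_pos {a b c d : ℤ} (hdet : a * d - b * c = 1) {τ : ℂ} (hτ : 0 < τ.im) :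
    0 < ((a * τ + b) / (c * τ + d) : ℂ).im := by
  rw [im_moebius, hdet]
  have : (c * τ + d : ℂ) ≠ 0 := denom_ne_zero_of_im_pos
    (by by_contra! h; rw [h.1, h.2] at hdet; simp at hdet) hτ.ne'
  have := Complex.normSq_pos.2 this
  positivity

theorem thetaLaw_translate (k : ℤ) : ThetaLaw 1 (2 * k) 0 1 1 := by
  intro τ hτ w
  have := jacobiTheta₂_add_even w τ k
  simpa using this

/-- Precompose with τ ↦ τ + 2k: theta has period 2 in τ and the denominator is unchanged, so the
multiplier is too. -/
theorem thetaLaw_of_translate {a b c d : ℤ} {v : ℂ} (k : ℤ)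
    (h : ThetaLaw a (b - 2 * k * a) c (d - 2 * k * c) v) : ThetaLaw a b c d v := by
  intro τ hτ w
  have := h (τ + 2 * k) (by simpa using hτ) w
  rw [jacobiTheta₂_add_even] at this
  push_cast at this
  rw [show (c * (τ + 2 * k) + (d - 2 * k * c) : ℂ) = c * τ + d by ring,
    show (a * (τ + 2 * k) + (b - 2 * k * a) : ℂ) = a * τ + b by ring] at this
  exact this

/-- A matrix and its negative act alike on τ, and theta is even in w; only the principal root of the
denominator sees the sign. -/
theorem thetaLaw_neg {a b c d : ℤ} {v : ℂ} (hc : c ≠ 0)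
    (h : ThetaLaw (-a) (-b) (-c) (-d) v) :
    ThetaLaw a b c d ((if 0 < c then -Complex.I else Complex.I) * v) := by
  intro τ hτ w
  have key := h τ hτ (-w)
  have h0 : (c * τ + d : ℂ) ≠ 0 := denom_ne_zero_of_im_pos (Or.inl hc) hτ.ne'
  push_cast at key
  rw [show (-c * τ + -d : ℂ) = -(c * τ + d) by ring, show (-a * τ + -b : ℂ) = -(a * τ + b) by ring,
    neg_div_neg_eq, neg_div_neg_eq, jacobiTheta₂_neg_left] at key
  rw [key]
  have hr : (-(c * τ + d) : ℂ) ^ (1 / 2 : ℂ) =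
      (if 0 < c then -Complex.I else Complex.I) * (c * τ + d : ℂ) ^ (1 / 2 : ℂ) := by
    have him : (c * τ + d : ℂ).im = c * τ.im := by simp
    split_ifs with hc0
    · refine neg_cpow_half_of_im_pos ?_
      rw [him]
      exact mul_pos (by exact_mod_cast hc0) hτ
    · refine neg_cpow_half_of_im_neg ?_
      rw [him]
      exact mul_neg_of_neg_of_pos (by exact_mod_cast lt_of_le_of_ne (not_lt.1 hc0) hc) hτ
  rw [hr]
  rw [show (Real.pi * Complex.I * -c * (-w) ^ 2 / -(c * τ + d) : ℂ) =
    Real.pi * Complex.I * c * w ^ 2 / (c * τ + d) by field_simp]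
  ring

/-- The inversion τ ↦ -1/τ conjugates this matrix to the translation by -2s, so the functional
equation at τ and at τ/(2sτ+1) suffices. The two roots have arguments of positive real part, which
makes them multiply correctly. -/
theorem thetaLaw_unipotent (s : ℤ) : ThetaLaw 1 0 (2 * s) 1 1 := by
  intro τ hτ w
  have hτ0 : τ ≠ 0 := by rintro rfl; simp at hτ
  have hj : (((2 * s : ℤ) : ℂ) * τ + (1 : ℤ)) ≠ 0 :=
    denom_ne_zero_of_im_pos (Or.inr one_ne_zero) hτ.ne'
  have him := im_moebius_pos (a := 1) (b := 0) (c := 2 * s) (d := 1) (by ring) hτ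
  push_cast at hj him ⊢
  rw [one_mul, add_zero] at him ⊢
  set τ' : ℂ := τ / (2 * s * τ + 1) with hτ'
  have hτ'0 : τ' ≠ 0 := div_ne_zero hτ0 hj
  have e1 := jacobiTheta₂_functional_equation (w / (2 * s * τ + 1)) τ'
  have e2 := jacobiTheta₂_functional_equation w τ
  have h1 : w / (2 * s * τ + 1) / τ' = w / τ := by rw [hτ']; field_simp
  have h2 : -1 / τ' = -1 / τ + 2 * ((-s : ℤ) : ℂ) := by
    rw [neg_div, hτ', one_div_div, neg_div, add_div, mul_div_assoc, div_self hτ0]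
    push_cast
    ring
  rw [h1, h2, jacobiTheta₂_add_even] at e1
  have hA : (-Complex.I * τ) = (2 * s * τ + 1) * (-Complex.I * τ') := by
    rw [mul_left_comm, hτ', mul_comm (2 * s * τ + 1 : ℂ), div_mul_cancel₀ _ hj]
  have s1 : -Complex.I * τ ∈ Complex.slitPlane := Or.inl (by simpa using hτ)
  have s2 : -Complex.I * τ' ∈ Complex.slitPlane := Or.inl (by simpa using him)
  have n1 : (-Complex.I * τ) ^ (1 / 2 : ℂ) ≠ 0 := fun h => by
    have := re_cpow_half_pos s1; rw [h] at this; simp at this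
  have n2 : (-Complex.I * τ') ^ (1 / 2 : ℂ) ≠ 0 := fun h => by
    have := re_cpow_half_pos s2; rw [h] at this; simp at this
  have hsq : (-Complex.I * τ) ^ (1 / 2 : ℂ) =
      (2 * s * τ + 1) ^ (1 / 2 : ℂ) * (-Complex.I * τ') ^ (1 / 2 : ℂ) := by
    rw [hA]
    refine cpow_half_mul_of_re_pos (by simpa using him) ?_
    rw [← hA]
    simpa using hτ
  rw [e1, e2, hsq]
  rw [hsq] at n1
  have n3 := left_ne_zero_of_mul n1
  have he : Complex.exp (-Real.pi * Complex.I * (w / (2 * s * τ + 1)) ^ 2 / τ') =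
      Complex.exp (Real.pi * Complex.I * (2 * s) * w ^ 2 / (2 * s * τ + 1)) *
        Complex.exp (-Real.pi * Complex.I * w ^ 2 / τ) := by
    rw [← Complex.exp_add, hτ']
    congr 1
    field_simp
    ring
  rw [he]
  field_simp

/-- Precompose with the lower unipotent matrix. Choosing s as the sign of c puts 2sτ + 1 and cτ + d
in the same half-plane, which is what splits the root of cτ + d without a sign. -/
theorem thetaLaw_of_unipotent {a b c d : ℤ} {v : ℂ} {s : ℤ}
    (hd : 0 < d) (hs : s = 1 ∧ 0 < c ∨ s = -1 ∧ c < 0)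
    (h : ThetaLaw (a - 2 * s * b) b (c - 2 * s * d) d v) : ThetaLaw a b c d v := by
  intro τ hτ w
  have hX : (((2 * s : ℤ) : ℂ) * τ + (1 : ℤ)) ≠ 0 :=
    denom_ne_zero_of_im_pos (Or.inr one_ne_zero) hτ.ne'
  have hj : (c * τ + d : ℂ) ≠ 0 := denom_ne_zero_of_im_pos (Or.inr hd.ne') hτ.ne'
  have him := im_moebius_pos (a := 1) (b := 0) (c := 2 * s) (d := 1) (by ring) hτ
  have h2 := thetaLaw_unipotent s τ hτ w
  have h1 := h _ him (w / (((2 * s : ℤ) : ℂ) * τ + (1 : ℤ)))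
  rw [h2] at h1
  push_cast at hX him h1 ⊢
  rw [one_mul, add_zero, one_mul] at h1
  rw [one_mul, add_zero] at him
  set X : ℂ := 2 * s * τ + 1 with hXdef
  have hY : ((c - 2 * s * d) * (τ / X) + d : ℂ) = (c * τ + d) / X := by
    rw [hXdef] at hX ⊢; field_simp; ring
  have hN : ((a - 2 * s * b) * (τ / X) + b : ℂ) = (a * τ + b) / X := by
    rw [hXdef] at hX ⊢; field_simp; ring
  rw [hY, hN, div_div_div_cancel_right₀ hX, div_div_div_cancel_right₀ hX] at h1
  rw [h1]
  have hXY : (c * τ + d : ℂ) = X * ((c * τ + d) / X) := by field_simp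
  have hc0 : (c : ℝ) * τ.im ≠ 0 :=
    mul_ne_zero (by rcases hs with ⟨-, h⟩ | ⟨-, h⟩ <;> exact_mod_cast (by omega)) hτ.ne'
  have hslit : (c * τ + d : ℂ) ∈ Complex.slitPlane := slitPlane_of_im_ne_zero (by simpa using hc0)
  have hYslit : (c * τ + d : ℂ) / X ∈ Complex.slitPlane := by
    rw [← hY]
    by_cases hcc : c - 2 * s * d = 0
    · left
      have : (c - 2 * s * d : ℂ) = 0 := by exact_mod_cast hcc
      rw [this]
      simpa using hd
    · refine slitPlane_of_im_ne_zero ?_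
      have : ((c - 2 * s * d : ℤ) : ℝ) * (τ / X).im ≠ 0 :=
        mul_ne_zero (by exact_mod_cast hcc) him.ne'
      simpa using this
  have hsqrt : (c * τ + d : ℂ) ^ (1 / 2 : ℂ) =
      X ^ (1 / 2 : ℂ) * ((c * τ + d) / X) ^ (1 / 2 : ℂ) := by
    conv_lhs => rw [hXY]
    rcases hs with ⟨h, h'⟩ | ⟨h, h'⟩
    · refine cpow_half_mul_of_im_pos ?_ hYslit (by rwa [← hXY]) (Or.inr ?_)
      · rw [hXdef, h]; simpa using hτ
      · rw [← hXY]
        have : (0 : ℝ) < c := by exact_mod_cast h'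
        simpa using (mul_pos this hτ).le
    · refine cpow_half_mul_of_im_neg ?_ hYslit (by rwa [← hXY]) (Or.inr ?_)
      · rw [hXdef, h]; simpa using hτ
      · rw [← hXY]
        have : (c : ℝ) < 0 := by exact_mod_cast h'
        simpa using (mul_neg_of_neg_of_pos this hτ).le
  rw [hsqrt]
  have he : Complex.exp (Real.pi * Complex.I * (c - 2 * s * d) * (w / X) ^ 2 / ((c * τ + d) / X)) *
      Complex.exp (Real.pi * Complex.I * (2 * s) * w ^ 2 / X) =
      Complex.exp (Real.pi * Complex.I * c * w ^ 2 / (c * τ + d)) := by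
    rw [← Complex.exp_add]
    congr 1
    field_simp
    rw [hXdef]
    ring
  rw [← he]
  ring

/-! ### Euclidean descent on the bottom row. -/

theorem thetaMultiplier_add_mul {c d : ℤ} (hd : 0 < d) (k : ℤ) :
    thetaMultiplier (c + k * d) d = thetaMultiplier c d := by
  unfold thetaMultiplier extendedJacobi
  rw [if_neg (by omega), if_neg (by omega)]
  congr 2
  refine jacobiSym.mod_left' ?_
  rw [Int.natAbs_of_nonneg hd.le, show 2 * (c + k * d) = 2 * c + d * (2 * k) by ring,
    Int.add_mul_emod_self_left]

theorem thetaMultiplier_sub_two_mul_natAbs {c d : ℤ} (hc : c ≠ 0) (hce : Even c) (hd : Odd d)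
    (hd0 : 0 < d) : thetaMultiplier c (d - 2 * c.natAbs) = thetaMultiplier c d := by
  obtain ⟨m, rfl⟩ := hce
  have h1 := extendedJacobi_sub_four_mul_natAbs (m := m) (by omega) hd hd0
  have h2 : d - 2 * ((m + m).natAbs : ℤ) = d - 4 * m.natAbs := by omega
  unfold thetaMultiplier
  rw [h2, show 2 * (m + m) = 4 * m by ring, h1, show d - 4 * (m.natAbs : ℤ) =
    d + 4 * (-m.natAbs) by ring, epsilonFactor_add_four_mul]

/-- Induction on |c| + |d|. As c is even and d odd, |c| ≠ |d|, so subtracting twice the smaller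
entry, suitably signed, from the larger one shrinks the sum. The multiplier is invariant under each
move, and the descent ends at c = 0, d = 1. -/
theorem thetaLaw_of_pos (n : ℕ) : ∀ a b c d : ℤ, c.natAbs + d.natAbs ≤ n → a * d - b * c = 1 →
    Even b → Even c → 0 < d → ThetaLaw a b c d (thetaMultiplier c d) := by
  induction n with
  | zero => intro a b c d h _ _ _ hd; omega
  | succ n ih =>
    intro a b c d hn hdet hb hc hd
    have hdo : Odd d := by
      by_contra hcon
      rw [Int.not_odd_iff_even] at hcon
      have : Even (a * d - b * c) := (hcon.mul_left a).sub (hc.mul_left b)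
      rw [hdet] at this
      exact absurd this (by decide)
    have hcd : c.natAbs ≠ d.natAbs := by
      intro h
      rw [Int.odd_iff] at hdo
      rw [Int.even_iff] at hc
      omega
    rcases eq_or_ne c 0 with rfl | hc0
    · have hd1 : d = 1 := by
        have : d ∣ 1 := ⟨a, by linarith⟩
        exact Int.eq_one_of_dvd_one hd.le this
      subst hd1
      obtain rfl : a = 1 := by linarith
      obtain ⟨k, rfl⟩ := hb
      have : thetaMultiplier 0 1 = 1 := by simp [thetaMultiplier, extendedJacobi, epsilonFactor]
      rw [this, ← two_mul]
      exact thetaLaw_translate k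
    rcases lt_or_gt_of_ne hcd with h | h
    · -- reduce `d`
      obtain ⟨k, hk⟩ : ∃ k : ℤ, k * c = c.natAbs := by
        rcases le_total 0 c with h0 | h0
        · exact ⟨1, by omega⟩
        · exact ⟨-1, by omega⟩
      refine thetaLaw_of_translate k ?_
      have hdd : d - 2 * k * c = d - 2 * c.natAbs := by rw [mul_assoc, hk]
      have hdet' : a * (d - 2 * k * c) - (b - 2 * k * a) * c = 1 := by linarith
      rw [← thetaMultiplier_sub_two_mul_natAbs hc0 hc hdo hd, ← hdd]
      have hbe : Even (b - 2 * k * a) := hb.sub ⟨k * a, by ring⟩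
      have hde : Odd (d - 2 * k * c) := hdo.sub_even ⟨k * c, by ring⟩
      rcases lt_or_ge 0 (d - 2 * k * c) with h1 | h1
      · exact ih _ _ _ _ (by rw [hdd] at h1 ⊢; omega) hdet' hbe hc h1
      -- When d crosses zero, negating the whole matrix restores positivity before the induction
      -- hypothesis is applied; zero itself is excluded by parity.
      · have h2 : d - 2 * k * c < 0 := lt_of_le_of_ne h1 (by rintro h3; rw [h3] at hde; simp at hde)
        rw [thetaMultiplier_of_neg hc0 hde h2]
        refine thetaLaw_neg hc0 ?_
        exact ih _ _ _ _ (by rw [hdd] at h2 ⊢; omega) (by linarith) hbe.neg hc.neg (by linarith)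
    · -- reduce `c`
      obtain ⟨s, hs⟩ : ∃ s : ℤ, s = 1 ∧ 0 < c ∨ s = -1 ∧ c < 0 := by
        rcases lt_or_gt_of_ne hc0 with h0 | h0
        · exact ⟨-1, Or.inr ⟨rfl, h0⟩⟩
        · exact ⟨1, Or.inl ⟨rfl, h0⟩⟩
      refine thetaLaw_of_unipotent hd hs ?_
      have : thetaMultiplier c d = thetaMultiplier (c - 2 * s * d) d := by
        rw [show c - 2 * s * d = c + (-2 * s) * d by ring, thetaMultiplier_add_mul hd]
      rw [this]
      refine ih _ _ _ _ ?_ (by linarith) hb (hc.sub ⟨s * d, by ring⟩) hd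
      rcases hs with ⟨rfl, h0⟩ | ⟨rfl, h0⟩ <;> omega

/-- The transformation law of the two-variable Jacobi theta function. -/
theorem thetaLaw {a b c d : ℤ} (hdet : a * d - b * c = 1) (hb : Even b) (hc : Even c)
    (hc0 : c ≠ 0 ∨ 0 < d) : ThetaLaw a b c d (thetaMultiplier c d) := by
  have hd : Odd d := by
    by_contra hcon
    rw [Int.not_odd_iff_even] at hcon
    have : Even (a * d - b * c) := (hcon.mul_left a).sub (hc.mul_left b)
    rw [hdet] at this
    exact absurd this (by decide)
  rcases lt_or_ge 0 d with h | h
  · exact thetaLaw_of_pos _ a b c d le_rfl hdet hb hc h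
  · have h2 : d < 0 := lt_of_le_of_ne h (by rintro rfl; simp at hd)
    have hc1 : c ≠ 0 := by omega
    rw [thetaMultiplier_of_neg hc1 hd h2]
    exact thetaLaw_neg hc1
      (thetaLaw_of_pos _ _ _ _ _ le_rfl (by linarith) hb.neg hc.neg (by linarith))

end

noncomputable section

/-! ### Theta series of residue classes -/

theorem jacobiTheta₂_add_int (w τ : ℂ) (k : ℤ) : jacobiTheta₂ (w + k) τ = jacobiTheta₂ w τ := by
  have h : Function.Periodic (fun w => jacobiTheta₂ w τ) 1 := fun w => jacobiTheta₂_add_left w τ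
  simpa using h.int_mul k w

/-- Complete the square, shifting the summation index by N. -/
theorem jacobiTheta₂_add_int_mul (w τ : ℂ) (N : ℤ) : jacobiTheta₂ (w + N * τ) τ =
    Complex.exp (-(Real.pi * Complex.I * (N ^ 2 * τ + 2 * N * w))) * jacobiTheta₂ w τ := by
  conv_rhs => rw [jacobiTheta₂, ← tsum_mul_left, ← (Equiv.addRight N).tsum_eq]
  refine tsum_congr fun n => ?_
  simp_rw [jacobiTheta₂_term, ← Complex.exp_add, Equiv.coe_addRight, Int.cast_add]
  ring_nf

/-- The theta series `∑ exp (π i (n² z / M + 2 n u))` over `n ≡ h (mod M)`. -/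
def residueTheta (M : ℕ) (h : ℤ) (z u : ℂ) : ℂ :=
  Complex.exp (Real.pi * Complex.I * (h ^ 2 * z / M + 2 * h * u)) *
    jacobiTheta₂ (h * z + M * u) (M * z)

/-- The derivative of `residueTheta M h z` at `0`. -/
def residueThetaDeriv (M : ℕ) (h : ℤ) (z : ℂ) : ℂ :=
  Complex.exp (Real.pi * Complex.I * (h ^ 2 * z / M)) *
    (2 * Real.pi * Complex.I * h * jacobiTheta₂ (h * z) (M * z) +
      M * jacobiTheta₂' (h * z) (M * z))

variable {M : ℕ} {h : ℤ} {z : ℂ}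

theorem im_natCast_mul_pos (hM : 0 < M) (hz : 0 < z.im) : 0 < ((M : ℂ) * z).im := by
  have : (0 : ℝ) < M := by exact_mod_cast hM
  simpa using mul_pos this hz

theorem hasDerivAt_residueTheta (hM : 0 < M) (hz : 0 < z.im) :
    HasDerivAt (residueTheta M h z) (residueThetaDeriv M h z) 0 := by
  have h1 : HasDerivAt (fun u : ℂ => h * z + M * u) (M : ℂ) 0 := by
    simpa using ((hasDerivAt_id (0 : ℂ)).const_mul (M : ℂ)).const_add (h * z)
  have h2 : HasDerivAt (fun u : ℂ => jacobiTheta₂ (h * z + M * u) (M * z))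
      (jacobiTheta₂' (h * z) (M * z) * M) 0 := by
    have := hasDerivAt_jacobiTheta₂_fst (h * z + M * 0) (im_natCast_mul_pos hM hz)
    have := this.comp (0 : ℂ) h1
    simpa [Function.comp_def] using this
  have h3 : HasDerivAt (fun u : ℂ => Real.pi * Complex.I * (h ^ 2 * z / M + 2 * h * u))
      (Real.pi * Complex.I * (2 * h)) 0 := by
    simpa using (((hasDerivAt_id (0 : ℂ)).const_mul (2 * h : ℂ)).const_add
      (h ^ 2 * z / M : ℂ)).const_mul (Real.pi * Complex.I)
  have h4 := h3.cexp.mul h2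
  refine h4.congr_deriv ?_
  simp only [mul_zero, add_zero, residueThetaDeriv]
  ring

theorem hasSum_residueTheta (hM : 0 < M) (hz : 0 < z.im) :
    HasSum (fun m : ℤ => Complex.exp (Real.pi * Complex.I * (((m * M + h : ℤ) : ℂ) ^ 2 * z / M)))
      (residueTheta M h z 0) := by
  have hM0 : (M : ℂ) ≠ 0 := by exact_mod_cast hM.ne'
  have := (hasSum_jacobiTheta₂_term (h * z) (im_natCast_mul_pos hM hz)).mul_left
    (Complex.exp (Real.pi * Complex.I * (h ^ 2 * z / M)))
  simp only [residueTheta, mul_zero, add_zero]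
  refine this.congr_fun ?_
  intro m
  rw [jacobiTheta₂_term, ← Complex.exp_add]
  congr 1
  push_cast
  field_simp
  ring

theorem hasSum_residueThetaDeriv (hM : 0 < M) (hz : 0 < z.im) :
    HasSum (fun m : ℤ => 2 * Real.pi * Complex.I * ((m * M + h : ℤ) : ℂ) *
      Complex.exp (Real.pi * Complex.I * (((m * M + h : ℤ) : ℂ) ^ 2 * z / M)))
      (residueThetaDeriv M h z) := by
  have hM0 : (M : ℂ) ≠ 0 := by exact_mod_cast hM.ne'
  have hz' := im_natCast_mul_pos hM hz
  have := (((hasSum_jacobiTheta₂_term (h * z) hz').mul_left (2 * Real.pi * Complex.I * h)).add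
    ((hasSum_jacobiTheta₂'_term (h * z) hz').mul_left (M : ℂ))).mul_left
    (Complex.exp (Real.pi * Complex.I * (h ^ 2 * z / M)))
  refine this.congr_fun ?_
  intro m
  have he : Complex.exp (Real.pi * Complex.I * (((m * M + h : ℤ) : ℂ) ^ 2 * z / M)) =
      Complex.exp (Real.pi * Complex.I * (h ^ 2 * z / M)) * jacobiTheta₂_term m (h * z) (M * z) := by
    rw [jacobiTheta₂_term, ← Complex.exp_add]
    congr 1
    push_cast
    field_simp
    ring
  rw [he, jacobiTheta₂'_term]
  push_cast
  ring

/-- The theta law is applied at Mz, to the matrix conjugated by z ↦ Mz, whose off-diagonal entries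
bM and c' are even. The congruence a ≡ 1 mod 2M brings the elliptic variable back to its original
value modulo the period lattice. -/
theorem residueTheta_moebius (hM : 0 < M) {a b c' d l : ℤ} (hdet : a * d - b * (M * c') = 1)
    (ha : a = 1 + 2 * M * l) (hb : Even (b * M)) (hc : Even c') (hc0 : c' ≠ 0 ∨ 0 < d)
    (hz : 0 < z.im) (u : ℂ) :
    residueTheta M h ((a * z + b) / (M * c' * z + d)) (u / (M * c' * z + d)) =
      Complex.exp (Real.pi * Complex.I * a * b * h ^ 2 / M) * thetaMultiplier c' d *
        (M * c' * z + d) ^ (1 / 2 : ℂ) *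
        Complex.exp (Real.pi * Complex.I * M * (M * c') * u ^ 2 / (M * c' * z + d)) *
        residueTheta M h z u := by
  have hM0 : (M : ℂ) ≠ 0 := by exact_mod_cast hM.ne'
  have law := thetaLaw (a := a) (b := b * M) (c := c') (d := d)
    (by linear_combination hdet) hb hc hc0 (M * z) (im_natCast_mul_pos hM hz)
    (h * (a * z + b) + M * u)
  have hj : (M * c' * z + d : ℂ) ≠ 0 := by
    have hcd : (M : ℤ) * c' ≠ 0 ∨ d ≠ 0 := by
      rcases hc0 with h | h
      · exact Or.inl (mul_ne_zero (by exact_mod_cast hM.ne') h)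
      · exact Or.inr h.ne'
    have := denom_ne_zero_of_im_pos hcd hz.ne'
    push_cast at this
    exact this
  have hj' : (c' * (M * z) + d : ℂ) = M * c' * z + d := by ring
  have hdetC : (a * d - b * (M * c') : ℂ) = 1 := by exact_mod_cast hdet
  have haC : (a : ℂ) = 1 + 2 * M * l := by exact_mod_cast ha
  rw [hj'] at law
  set j : ℂ := M * c' * z + d with hjdef
  unfold residueTheta
  have e1 : (h * ((a * z + b) / j) + M * (u / j) : ℂ) = (h * (a * z + b) + M * u) / j := by ring
  have e2 : (M * ((a * z + b) / j) : ℂ) = (a * (M * z) + (b * M : ℤ)) / j := by push_cast; ring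
  have e3 : (h * (a * z + b) + M * u : ℂ) =
      (h * z + M * u) + ((2 * h * l : ℤ) : ℂ) * (M * z) + ((h * b : ℤ) : ℂ) := by
    rw [haC]; push_cast; ring
  rw [e1, e2, law]
  rw [e3, jacobiTheta₂_add_int, jacobiTheta₂_add_int_mul, ← e3]
  -- The denominator j disappears from the h-dependent exponents because the determinant gives 1 +
  -- Mc'(az + b) = a j.
  have key : Complex.exp (Real.pi * Complex.I * (h ^ 2 * ((a * z + b) / j) / M + 2 * h * (u / j))) *
      Complex.exp (Real.pi * Complex.I * c' * (h * (a * z + b) + M * u) ^ 2 / j) *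
      Complex.exp (-(Real.pi * Complex.I * (((2 * h * l : ℤ) : ℂ) ^ 2 * (M * z) +
        2 * ((2 * h * l : ℤ) : ℂ) * (h * z + M * u)))) =
      Complex.exp (Real.pi * Complex.I * a * b * h ^ 2 / M) *
      Complex.exp (Real.pi * Complex.I * M * (M * c') * u ^ 2 / j) *
      Complex.exp (Real.pi * Complex.I * (h ^ 2 * z / M + 2 * h * u)) := by
    rw [← Complex.exp_add, ← Complex.exp_add, ← Complex.exp_add, ← Complex.exp_add]
    congr 1
    have hx : (1 + M * c' * (a * z + b) : ℂ) = a * j := by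
      rw [hjdef]; linear_combination (-1 : ℂ) * hdetC
    have hl : (2 * M * l : ℂ) = a - 1 := by rw [haC]; ring
    have t1 : (h ^ 2 * ((a * z + b) / j) / M + 2 * h * (u / j) +
        c' * (h * (a * z + b) + M * u) ^ 2 / j : ℂ) =
        h ^ 2 * (a * z + b) * (1 + M * c' * (a * z + b)) / (j * M) +
          2 * h * u * (1 + M * c' * (a * z + b)) / j + M * (M * c') * u ^ 2 / j := by
      field_simp
      ring
    rw [hx] at t1
    have t2 : (h ^ 2 * (a * z + b) * (a * j) / (j * M) + 2 * h * u * (a * j) / j : ℂ) =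
        h ^ 2 * (a * z + b) * a / M + 2 * h * u * a := by
      field_simp
    have t3 : (((2 * h * l : ℤ) : ℂ) ^ 2 * (M * z) + 2 * ((2 * h * l : ℤ) : ℂ) * (h * z + M * u)) =
        h ^ 2 * (a ^ 2 - 1) * z / M + 2 * h * u * (a - 1) := by
      rw [haC]
      push_cast
      field_simp
      ring
    linear_combination (Real.pi * Complex.I) * (t1 + t2 - t3)
  linear_combination (thetaMultiplier c' d * j ^ (1 / 2 : ℂ) *
    jacobiTheta₂ (h * z + M * u) (M * z)) * key

/-- Differentiate the preceding law at u = 0. The Gaussian factor is stationary there, and the chain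
rule for u/j raises the weight from 1/2 to 3/2. -/
theorem residueThetaDeriv_moebius (hM : 0 < M) {a b c' d l : ℤ} (hdet : a * d - b * (M * c') = 1)
    (ha : a = 1 + 2 * M * l) (hb : Even (b * M)) (hc : Even c') (hc0 : c' ≠ 0 ∨ 0 < d)
    (hz : 0 < z.im) :
    residueThetaDeriv M h ((a * z + b) / (M * c' * z + d)) =
      Complex.exp (Real.pi * Complex.I * a * b * h ^ 2 / M) * thetaMultiplier c' d *
        ((M * c' * z + d) ^ (1 / 2 : ℂ)) ^ 3 * residueThetaDeriv M h z := by
  have hj : (M * c' * z + d : ℂ) ≠ 0 := by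
    have hcd : (M : ℤ) * c' ≠ 0 ∨ d ≠ 0 := by
      rcases hc0 with h | h
      · exact Or.inl (mul_ne_zero (by exact_mod_cast hM.ne') h)
      · exact Or.inr h.ne'
    have := denom_ne_zero_of_im_pos hcd hz.ne'
    push_cast at this
    exact this
  have him : 0 < ((a * z + b) / (M * c' * z + d) : ℂ).im := by
    have := im_moebius_pos hdet hz
    push_cast at this
    exact this
  set j : ℂ := M * c' * z + d with hjdef
  have d1 : HasDerivAt (fun u : ℂ => residueTheta M h ((a * z + b) / j) (u / j))
      (residueThetaDeriv M h ((a * z + b) / j) * (1 / j)) 0 := by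
    have h0 := hasDerivAt_residueTheta (h := h) hM him
    have h1 : HasDerivAt (fun u : ℂ => u / j) (1 / j) 0 := (hasDerivAt_id (0 : ℂ)).div_const j
    exact HasDerivAt.comp (0 : ℂ) (h₂ := residueTheta M h ((a * z + b) / j))
      (by simpa using h0) h1
  have d2 : HasDerivAt (fun u : ℂ => Complex.exp (Real.pi * Complex.I * a * b * h ^ 2 / M) *
      thetaMultiplier c' d * j ^ (1 / 2 : ℂ) *
        Complex.exp (Real.pi * Complex.I * M * (M * c') * u ^ 2 / j) * residueTheta M h z u)
      (Complex.exp (Real.pi * Complex.I * a * b * h ^ 2 / M) *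
      thetaMultiplier c' d * j ^ (1 / 2 : ℂ) * residueThetaDeriv M h z) 0 := by
    have h0 := hasDerivAt_residueTheta (h := h) hM hz
    have h1 : HasDerivAt (fun u : ℂ => Real.pi * Complex.I * M * (M * c') * u ^ 2 / j) 0 0 := by
      simpa using ((hasDerivAt_pow 2 (0 : ℂ)).const_mul
        (Real.pi * Complex.I * M * (M * c') : ℂ)).div_const j
    have h2 := (h1.cexp.const_mul (Complex.exp (Real.pi * Complex.I * a * b * h ^ 2 / M) *
      thetaMultiplier c' d * j ^ (1 / 2 : ℂ))).mul h0
    refine h2.congr_deriv ?_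
    simp
  have h3 := d1.unique (d2.congr_of_eventuallyEq (Filter.Eventually.of_forall fun u => 
    residueTheta_moebius hM hdet ha hb hc hc0 hz u))
  have h4 : (j ^ (1 / 2 : ℂ)) ^ 3 = j * j ^ (1 / 2 : ℂ) := by
    rw [pow_succ, cpow_half_sq]
  rw [h4]
  have h5 := congrArg (· * j) h3
  simp only [mul_assoc, one_div, inv_mul_cancel₀ hj, mul_one] at h5
  rw [h5]
  ring_nf

/-! ### Partial theta series as combinations of residue-class theta series. -/

theorem hasSum_int_of_residues (hM : 0 < M) {f g : ℤ → ℂ} {S : ℤ → ℂ}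
    (hf : Function.Periodic f (M : ℤ)) (hS : ∀ h, HasSum (fun m : ℤ => g (m * M + h)) (S h)) :
    HasSum (fun n => f n * g n) (∑ h ∈ Finset.range M, f h * S h) := by
  have hM' : (0 : ℤ) < M := by exact_mod_cast hM
  have h1 : ∀ h ∈ Finset.range M, HasSum (fun n : ℤ => if n % M = h then f n * g n else 0)
      (f h * S h) := by
    intro h hh
    have hinj : Function.Injective (fun m : ℤ => m * M + (h : ℤ)) := fun x y hxy => by
      simpa [hM.ne'] using hxy
    refine (hinj.hasSum_iff ?_).1 ?_
    · intro n hn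
      rw [if_neg]
      intro hcon
      refine hn ⟨n / M, ?_⟩
      have := Int.ediv_mul_add_emod n M
      rw [hcon] at this
      exact this
    · refine ((hS h).mul_left (f h)).congr_fun fun m => ?_
      have hmod : (m * M + (h : ℤ)) % M = h := by
        rw [add_comm, Int.add_mul_emod_self_right]
        exact Int.emod_eq_of_lt (by positivity) (by exact_mod_cast Finset.mem_range.1 hh)
      have hfm : f (m * M + h) = f h := by
        rw [add_comm]; exact hf.int_mul m h
      simp only [Function.comp_apply]
      rw [if_pos hmod, hfm]
  refine (hasSum_sum h1).congr_fun fun n => ?_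
  have hn : (n % M).toNat ∈ Finset.range M := by
    have := Int.emod_lt_of_pos n hM'
    have := Int.emod_nonneg n hM'.ne'
    rw [Finset.mem_range]
    omega
  rw [Finset.sum_eq_single_of_mem _ hn, if_pos]
  · rw [Int.toNat_of_nonneg (Int.emod_nonneg n hM'.ne')]
  · intro b _ hb
    rw [if_neg]
    intro h
    exact hb (by omega)

/-- By evenness the terms n and -n coincide; the term n = 0, counted once in the sum over ℤ, is
removed by f(0) = 0. -/
theorem partialTheta_eq_sum (hM : 0 < M) {f : ℤ → ℂ} (hf : Function.Periodic f (M : ℤ))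
    (heven : Function.Even f) (h0 : f 0 = 0) (hz : 0 < z.im) :
    partialTheta f M z = 2⁻¹ * ∑ h ∈ Finset.range M, f h * residueTheta M h z 0 := by
  have h1 := (hasSum_int_of_residues hM hf (fun h => hasSum_residueTheta (h := h) hM hz)
    (g := fun n : ℤ => Complex.exp (Real.pi * Complex.I * ((n : ℂ) ^ 2 * z / M)))).nat_add_neg
  have h2 := h1.mul_left (2⁻¹ : ℂ)
  rw [h0, zero_mul, add_zero] at h2
  rw [← h2.tsum_eq, partialTheta]
  refine tsum_congr fun n => ?_
  rw [heven]
  push_cast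
  rw [neg_sq, ← two_mul, inv_mul_cancel_left₀ two_ne_zero]
  congr 2
  ring

/-- For odd `f` the coefficient n f(n) is even. The constant is 1/2 from folding ℤ, times 1/(2πi)
from differentiating in u. -/
theorem partialThetaDeriv_eq_sum (hM : 0 < M) {f : ℤ → ℂ} (hf : Function.Periodic f (M : ℤ))
    (hodd : Function.Odd f) (hz : 0 < z.im) :
    partialThetaDeriv f M z =
      (4 * Real.pi * Complex.I)⁻¹ * ∑ h ∈ Finset.range M, f h * residueThetaDeriv M h z := by
  have h1 := (hasSum_int_of_residues hM hf (fun h => hasSum_residueThetaDeriv (h := h) hM hz)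
    (g := fun n : ℤ => 2 * Real.pi * Complex.I * n *
      Complex.exp (Real.pi * Complex.I * ((n : ℂ) ^ 2 * z / M)))).nat_add_neg
  have h2 := h1.mul_left ((4 * Real.pi * Complex.I)⁻¹ : ℂ)
  simp only [Int.cast_zero, mul_zero, zero_mul, add_zero] at h2
  rw [← h2.tsum_eq, partialThetaDeriv]
  refine tsum_congr fun n => ?_
  rw [hodd]
  push_cast
  rw [neg_sq]
  have : (2 * Real.pi * Complex.I * z * ((n : ℂ) ^ 2 / (2 * (M : ℂ))) : ℂ) =
    Real.pi * Complex.I * ((n : ℂ) ^ 2 * z / M) := by ring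
  rw [this]
  have hpi : (Real.pi : ℂ) ≠ 0 := by exact_mod_cast Real.pi_ne_zero
  field_simp
  ring

/-! ### Modularity of the theta functions -/

/-- Collects the arithmetic of Γ_M needed later. For c = 0 the possibility a = -1 would force 2M to
divide 2, which M ≥ 2 forbids; so the stabiliser of i∞ consists of translations only. -/
theorem GammaM_entries {γ : SL(2, ℤ)} (hM : 2 ≤ M) (hγ : γ ∈ GammaM M) :
    ∃ c' l : ℤ, γ 1 0 = M * c' ∧ γ 0 0 = 1 + 2 * M * l ∧ Even c' ∧ Even (γ 0 1 * M) ∧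
      (Odd M → Even (γ 0 1)) ∧ IsCoprime (γ 1 1) M ∧ (c' = 0 → γ 0 0 = 1 ∧ γ 1 1 = 1) ∧
      Odd (γ 1 1) := by
  obtain ⟨h1, h2⟩ := hγ
  rw [CongruenceSubgroup.Gamma1_mem] at h1
  obtain ⟨ha, hd, hc⟩ := h1
  replace ha : ((γ 0 0 : ℤ) : ZMod (2 * M)) = ((1 : ℤ) : ZMod (2 * M)) := by rw [ha, Int.cast_one]
  replace hd : ((γ 1 1 : ℤ) : ZMod (2 * M)) = ((1 : ℤ) : ZMod (2 * M)) := by rw [hd, Int.cast_one]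
  rw [ZMod.intCast_eq_intCast_iff_dvd_sub] at ha hd
  rw [ZMod.intCast_zmod_eq_zero_iff_dvd] at hc
  obtain ⟨l, hl⟩ := ha
  obtain ⟨l', hl'⟩ := hd
  obtain ⟨k, hk⟩ := hc
  push_cast at hl hl' hk
  have hdet : γ 0 0 * γ 1 1 - γ 0 1 * γ 1 0 = 1 := by
    have := γ.det_coe
    rwa [Matrix.det_fin_two] at this
  refine ⟨2 * k, -l, by rw [hk]; ring, by linarith, even_two_mul k, ?_, fun h => ?_, ?_, fun h => ?_, ?_⟩
  · rcases Nat.even_or_odd M with h | h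
    · exact (Int.even_coe_nat M |>.2 h).mul_left _
    · exact (even_iff_two_dvd.2 (h2 h)).mul_right _
  · exact even_iff_two_dvd.2 (h2 h)
  · exact ⟨1, 2 * l', by linarith⟩
  · have hk0 : k = 0 := by omega
    rw [hk0] at hk
    rw [hk] at hdet
    have hu : IsUnit (γ 0 0) := IsUnit.of_mul_eq_one (γ 1 1) (by linarith)
    rcases Int.isUnit_iff.1 hu with h3 | h3
    · refine ⟨h3, ?_⟩
      rw [h3] at hdet; linarith
    · exfalso
      rw [h3] at hl
      have hM' : (2 : ℤ) ≤ M := by exact_mod_cast hM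
      have : (M : ℤ) * l = 1 := by linarith
      have := Int.eq_one_or_neg_one_of_mul_eq_one this
      omega
  · refine ⟨-(M * l'), by linarith⟩

/-- Reconciles the entry 2cM = 2c'M² of the stated multiplier with the 2c' of the conjugated theta
law. -/
theorem extendedJacobi_mul_sq {c d n : ℤ} (hn : n ≠ 0) (hd : IsCoprime d n) :
    extendedJacobi (c * n ^ 2) d = extendedJacobi c d := by
  have h1 : c * n ^ 2 < 0 ↔ c < 0 := by
    have : 0 < n ^ 2 := by positivity
    constructor
    · intro h; by_contra hcon; nlinarith
    · intro h; nlinarith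
  have h2 : jacobiSym (c * n ^ 2) d.natAbs = jacobiSym c d.natAbs := by
    rw [jacobiSym.mul_left, jacobiSym.sq_one', mul_one]
    have := (Int.isCoprime_iff_gcd_eq_one.1 hd.symm)
    rw [Int.gcd_def] at this ⊢
    rwa [Int.natAbs_natCast]
  unfold extendedJacobi
  rw [h2]
  simp only [h1]

/-- For odd M the congruence is known only modulo M; the evenness of b built into Γ_M supplies the
missing factor 2. -/
theorem exp_mul_sq_of_modEq {k₀ : ℕ} {γ : SL(2, ℤ)} (hM : 2 ≤ M) (hγ : γ ∈ GammaM M)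
    (hh : (h ^ 2 ≡ k₀ [ZMOD (2 * M)] ∨ Odd M ∧ h ^ 2 ≡ k₀ [ZMOD M])) :
    Complex.exp (Real.pi * Complex.I * (γ 0 0) * (γ 0 1) * h ^ 2 / M) =
      Complex.exp (Real.pi * Complex.I * (γ 0 0) * (γ 0 1) * k₀ / M) := by
  obtain ⟨c', l, hc, ha, hce, hb, hb', -⟩ := GammaM_entries hM hγ
  have hM0 : (M : ℂ) ≠ 0 := by
    have : M ≠ 0 := by omega
    exact_mod_cast this
  rw [Complex.exp_eq_exp_iff_exists_int]
  rcases hh with hh | ⟨ho, hh⟩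
  · obtain ⟨t, ht⟩ := hh.symm.dvd
    refine ⟨γ 0 0 * γ 0 1 * t, ?_⟩
    have : (h ^ 2 : ℂ) = k₀ + 2 * M * t := by
      have : h ^ 2 = k₀ + 2 * M * t := by linarith
      exact_mod_cast this
    rw [this]
    push_cast
    field_simp
  · obtain ⟨t, ht⟩ := hh.symm.dvd
    obtain ⟨s, hs⟩ := hb' ho
    refine ⟨γ 0 0 * s * t, ?_⟩
    have : (h ^ 2 : ℂ) = k₀ + M * t := by
      have : h ^ 2 = k₀ + M * t := by linarith
      exact_mod_cast this
    rw [this, hs]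
    push_cast
    field_simp
    ring

/-- The action of `γ` on complex numbers. -/
def moebius (γ : SL(2, ℤ)) (z : ℂ) : ℂ :=
  ((γ 0 0 : ℂ) * z + (γ 0 1 : ℂ)) / ((γ 1 0 : ℂ) * z + (γ 1 1 : ℂ))

theorem det_eq (γ : SL(2, ℤ)) : γ 0 0 * γ 1 1 - γ 0 1 * γ 1 0 = 1 := by
  have := γ.det_coe
  rwa [Matrix.det_fin_two] at this

section Modularity

variable {k₀ : ℕ} {f : ℤ → ℂ} {𝓜 : Finset ℕ}

/-- If h = ±k + Mt, then h² - k² = ±2Mkt + M²t², and 2M divides M² exactly when M is even. -/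
theorem sq_modEq_of_ne_zero (hsub : 𝓜 ⊆ squareClass M k₀) (hsupp : IsSupportedOn f M 𝓜)
    (hh : f h ≠ 0) : h ^ 2 ≡ k₀ [ZMOD (2 * M)] ∨ Odd M ∧ h ^ 2 ≡ k₀ [ZMOD M] := by
  have : ∃ k ∈ 𝓜, h ≡ (k : ℤ) [ZMOD (M : ℤ)] ∨ h ≡ -(k : ℤ) [ZMOD (M : ℤ)] := by
    by_contra! hcon
    exact hh (hsupp h hcon)
  obtain ⟨k, hk, hhk⟩ := this
  have hkk := (Finset.mem_filter.1 (hsub hk)).2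
  have hkk' : (k : ℤ) ^ 2 ≡ k₀ [ZMOD (2 * M)] := by exact_mod_cast (Int.natCast_modEq_iff.2 hkk)
  rcases Nat.even_or_odd M with he | ho
  · left
    refine Int.ModEq.trans ?_ hkk'
    obtain ⟨s, hs⟩ := he
    obtain ⟨κ, hκ, hhκ⟩ : ∃ κ : ℤ, κ ^ 2 = (k : ℤ) ^ 2 ∧ h ≡ κ [ZMOD M] := by
      rcases hhk with h1 | h1
      · exact ⟨k, rfl, h1⟩
      · exact ⟨-k, by ring, h1⟩
    rw [← hκ]
    obtain ⟨t, ht⟩ := hhκ.symm.dvd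
    refine Int.ModEq.symm ((Int.modEq_iff_dvd).2 ⟨κ * t + s * t ^ 2, ?_⟩)
    have : h = κ + M * t := by linarith
    rw [this]
    have hs' : (M : ℤ) = s + s := by exact_mod_cast hs
    rw [hs']; ring
  · right
    refine ⟨ho, ?_⟩
    have h2 : (k : ℤ) ^ 2 ≡ k₀ [ZMOD M] := hkk'.of_mul_left _
    refine Int.ModEq.trans ?_ h2
    rcases hhk with h1 | h1
    · exact h1.pow 2
    · simpa using h1.pow 2

theorem apply_zero_of_supported (hsub : 𝓜 ⊆ squareClass M k₀)
    (hsupp : IsSupportedOn f M 𝓜) : f 0 = 0 := by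
  refine hsupp 0 fun k hk => ?_
  have h1 := Finset.mem_Icc.1 (Finset.mem_filter.1 (hsub hk)).1
  have : ¬ (M : ℤ) ∣ k := by
    intro h
    have := Nat.le_of_dvd (by omega) (Int.natCast_dvd_natCast.1 h)
    omega
  constructor
  · intro h
    have := h.dvd
    simp at this
    exact ‹¬ (M : ℤ) ∣ k› (by exact_mod_cast this)
  · intro h
    have := h.dvd
    simp at this
    exact ‹¬ (M : ℤ) ∣ k› (by exact_mod_cast this)

theorem multiplier_eq {γ : SL(2, ℤ)} (hM : 0 < M) {c' : ℤ} (hc : γ 1 0 = M * c')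
    (hcop : IsCoprime (γ 1 1) M) : multiplier M k₀ γ =
      Complex.exp (Real.pi * Complex.I * (γ 0 0) * (γ 0 1) * k₀ / M) *
        thetaMultiplier c' (γ 1 1) := by
  unfold multiplier thetaMultiplier
  rw [hc, show 2 * (M * c') * (M : ℤ) = 2 * c' * (M : ℤ) ^ 2 by ring,
    extendedJacobi_mul_sq (by omega) hcop, mul_assoc]

/-- Every residue class that meets the support of `f` transforms with the same multiplier, so the
combination does as well. -/
theorem partialTheta_moebius (hM : 2 ≤ M) (hf : Function.Periodic f (M : ℤ))
    (hsub : 𝓜 ⊆ squareClass M k₀) (hsupp : IsSupportedOn f M 𝓜) (heven : Function.Even f)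
    {γ : SL(2, ℤ)} (hγ : γ ∈ GammaM M) (hz : 0 < z.im) :
    partialTheta f M (moebius γ z) = multiplier M k₀ γ *
      ((γ 1 0 : ℂ) * z + (γ 1 1 : ℂ)) ^ (1 / 2 : ℂ) * partialTheta f M z := by
  obtain ⟨c', l, hc, ha, hce, hb, hb', hcop, hc0, -⟩ := GammaM_entries hM hγ
  have h0 := apply_zero_of_supported hsub hsupp
  have hM0 : 0 < M := by omega
  have hdet := det_eq γ
  have him : 0 < (moebius γ z).im := im_moebius_pos hdet hz
  have hcC : (γ 1 0 : ℂ) = M * c' := by exact_mod_cast hc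
  have hc0' : c' ≠ 0 ∨ 0 < γ 1 1 := by
    by_cases h : c' = 0
    · right; rw [(hc0 h).2]; exact one_pos
    · exact Or.inl h
  rw [hc] at hdet
  rw [partialTheta_eq_sum hM0 hf heven h0 him, partialTheta_eq_sum hM0 hf heven h0 hz,
    mul_left_comm, multiplier_eq hM0 hc hcop]
  congr 1
  rw [Finset.mul_sum]
  refine Finset.sum_congr rfl fun h _ => ?_
  by_cases hfh : f h = 0
  · simp [hfh]
  have key := residueTheta_moebius (h := h) hM0 hdet ha hb hce hc0' hz 0
  rw [zero_div, exp_mul_sq_of_modEq hM hγ (sq_modEq_of_ne_zero hsub hsupp hfh)] at key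
  unfold moebius
  rw [hcC, key]
  simp only [ne_eq, OfNat.ofNat_ne_zero, not_false_eq_true, zero_pow, mul_zero, zero_div,
    Complex.exp_zero, mul_one]
  ring

theorem partialThetaDeriv_moebius (hM : 2 ≤ M) (hf : Function.Periodic f (M : ℤ))
    (hsub : 𝓜 ⊆ squareClass M k₀) (hsupp : IsSupportedOn f M 𝓜) (hodd : Function.Odd f)
    {γ : SL(2, ℤ)} (hγ : γ ∈ GammaM M) (hz : 0 < z.im) :
    partialThetaDeriv f M (moebius γ z) = multiplier M k₀ γ *
      (((γ 1 0 : ℂ) * z + (γ 1 1 : ℂ)) ^ (1 / 2 : ℂ)) ^ 3 * partialThetaDeriv f M z := by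
  obtain ⟨c', l, hc, ha, hce, hb, hb', hcop, hc0, -⟩ := GammaM_entries hM hγ
  have hM0 : 0 < M := by omega
  have hdet := det_eq γ
  have him : 0 < (moebius γ z).im := im_moebius_pos hdet hz
  have hcC : (γ 1 0 : ℂ) = M * c' := by exact_mod_cast hc
  have hc0' : c' ≠ 0 ∨ 0 < γ 1 1 := by
    by_cases h : c' = 0
    · right; rw [(hc0 h).2]; exact one_pos
    · exact Or.inl h
  rw [hc] at hdet
  rw [partialThetaDeriv_eq_sum hM0 hf hodd him, partialThetaDeriv_eq_sum hM0 hf hodd hz,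
    mul_left_comm, multiplier_eq hM0 hc hcop]
  congr 1
  rw [Finset.mul_sum]
  refine Finset.sum_congr rfl fun h _ => ?_
  by_cases hfh : f h = 0
  · simp [hfh]
  have key := residueThetaDeriv_moebius (h := h) hM0 hdet ha hb hce hc0' hz
  rw [exp_mul_sq_of_modEq hM hγ (sq_modEq_of_ne_zero hsub hsupp hfh)] at key
  unfold moebius
  rw [hcC, key]
  ring

end Modularity

end

noncomputable section

open Filter MeasureTheory Set

/-! ### Functions with exponential decay at `i∞` -/

/-- `F` is holomorphic on the upper half-plane and decays exponentially at `i∞`, uniformly in the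
real part. -/
def IsCuspidal (F : ℂ → ℂ) : Prop :=
  DifferentiableOn ℂ F {z : ℂ | 0 < z.im} ∧
    ∃ c : ℝ, 0 < c ∧ ∀ ε : ℝ, 0 < ε → ∃ K : ℝ, ∀ z : ℂ, ε ≤ z.im →
      ‖F z‖ ≤ K * Real.exp (-c * z.im)

theorem isOpen_im_pos : IsOpen {z : ℂ | 0 < z.im} := isOpen_lt continuous_const Complex.continuous_im

/-- Cauchy's estimate on discs of the fixed radius ε/2. -/
theorem IsCuspidal.deriv {F : ℂ → ℂ} (hF : IsCuspidal F) : IsCuspidal (deriv F) := by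
  obtain ⟨hd, c, hc, hb⟩ := hF
  refine ⟨hd.deriv isOpen_im_pos, c, hc, fun ε hε => ?_⟩
  obtain ⟨K, hK⟩ := hb (ε / 2) (by positivity)
  refine ⟨K * Real.exp (c * (ε / 2)) / (ε / 2), fun z hz => ?_⟩
  have hball : ∀ w ∈ Metric.closedBall z (ε / 2), z.im - ε / 2 ≤ w.im := by
    intro w hw
    have h1 : |(w - z).im| ≤ ‖w - z‖ := Complex.abs_im_le_norm _
    rw [Metric.mem_closedBall, dist_eq_norm] at hw
    have := (abs_le.1 (h1.trans hw)).1
    rw [Complex.sub_im] at this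
    linarith
  have h0 : 0 ≤ K := by
    have := (norm_nonneg _).trans (hK z (by linarith))
    exact nonneg_of_mul_nonneg_left this (Real.exp_pos _)
  have hdc : DiffContOnCl ℂ F (Metric.ball z (ε / 2)) := by
    refine DifferentiableOn.diffContOnCl fun w hw => ?_
    have hw' := hball w (Metric.closure_ball_subset_closedBall hw)
    have : (0 : ℝ) < w.im := by linarith
    exact (hd.differentiableAt (isOpen_im_pos.mem_nhds this)).differentiableWithinAt
  have := Complex.norm_deriv_le_of_forall_mem_sphere_norm_le (C := K * Real.exp (c * (ε / 2)) *
    Real.exp (-c * z.im)) (by positivity) hdc fun w hw => by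
      have hw' := hball w (Metric.sphere_subset_closedBall hw)
      refine (hK w (by linarith)).trans ?_
      rw [mul_assoc, ← Real.exp_add]
      refine mul_le_mul_of_nonneg_left (Real.exp_le_exp.2 ?_) h0
      nlinarith
  refine this.trans (le_of_eq ?_)
  ring

/-! ### Series in `q ^ (n ^ 2 / 2 M)` -/

/-- `∑ c(n) q ^ (n ^ 2 / 2 M)`. -/
def qSeries (c : ℕ → ℂ) (M : ℕ) (z : ℂ) : ℂ :=
  ∑' n : ℕ, c n * Complex.exp (2 * Real.pi * Complex.I * z * ((n : ℂ) ^ 2 / (2 * (M : ℂ))))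

/-- `c(0) = 0` and `c` has polynomial growth. -/
def PolyGrowth (c : ℕ → ℂ) : Prop := c 0 = 0 ∧ ∃ (B : ℝ) (p : ℕ), ∀ n, ‖c n‖ ≤ B * (n : ℝ) ^ p

theorem norm_qSeries_term (a z : ℂ) (M n : ℕ) :
    ‖a * Complex.exp (2 * Real.pi * Complex.I * z * ((n : ℂ) ^ 2 / (2 * (M : ℂ))))‖ =
      ‖a‖ * Real.exp (-(Real.pi / M * n ^ 2 * z.im)) := by
  rw [norm_mul, Complex.norm_exp]
  congr 2
  have : (2 * Real.pi * Complex.I * z * ((n : ℂ) ^ 2 / (2 * (M : ℂ)))) =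
      ((Real.pi / M * n ^ 2 : ℝ) : ℂ) * (Complex.I * z) := by
    push_cast; ring
  rw [this, Complex.re_ofReal_mul]
  simp

/-- For n ≥ 1, n²y ≥ y + (n - 1)ε when y ≥ ε: one copy of y gives the decay at i∞, the rest gives
summability. The vanishing of c(0) is essential. -/
theorem exists_qSeries_term_bound {c : ℕ → ℂ} (hc : PolyGrowth c) {M : ℕ} (hM : 0 < M) {ε : ℝ}
    (hε : 0 < ε) : ∃ u : ℕ → ℝ, Summable u ∧ ∀ (n : ℕ) (z : ℂ), ε ≤ z.im →
      ‖c n * Complex.exp (2 * Real.pi * Complex.I * z * ((n : ℂ) ^ 2 / (2 * (M : ℂ))))‖ ≤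
        u n * Real.exp (-(Real.pi / M) * z.im) := by
  obtain ⟨h0, B, p, hB⟩ := hc
  have hMr : (0 : ℝ) < M := by exact_mod_cast hM
  have hκ : 0 < Real.pi / M := div_pos Real.pi_pos hMr
  have hB0 : 0 ≤ B := by simpa using (norm_nonneg _).trans (hB 1)
  refine ⟨fun n => B * Real.exp (Real.pi / M * ε) *
    ((n : ℝ) ^ p * Real.exp (-(Real.pi / M * ε) * n)), ?_, ?_⟩
  · exact (Real.summable_pow_mul_exp_neg_nat_mul p (by positivity)).mul_left _
  · intro n z hz
    rw [norm_qSeries_term]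
    rcases Nat.eq_zero_or_pos n with rfl | hn
    · rw [h0, norm_zero, zero_mul]; positivity
    have hn1 : (1 : ℝ) ≤ n := by exact_mod_cast hn
    have he : Real.exp (-(Real.pi / M * n ^ 2 * z.im)) ≤ Real.exp (Real.pi / M * ε) *
        Real.exp (-(Real.pi / M * ε) * n) * Real.exp (-(Real.pi / M) * z.im) := by
      rw [← Real.exp_add, ← Real.exp_add, Real.exp_le_exp]
      have h1 : (n : ℝ) - 1 ≤ n ^ 2 - 1 := by nlinarith
      have h2 : ε * (n - 1) ≤ z.im * (n ^ 2 - 1) :=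
        mul_le_mul hz h1 (by linarith) (by linarith)
      nlinarith
    calc ‖c n‖ * Real.exp (-(Real.pi / M * n ^ 2 * z.im))
        ≤ (B * (n : ℝ) ^ p) * (Real.exp (Real.pi / M * ε) *
        Real.exp (-(Real.pi / M * ε) * n) * Real.exp (-(Real.pi / M) * z.im)) :=
          mul_le_mul (hB n) he (Real.exp_pos _).le (by positivity)
      _ = _ := by ring

theorem summable_qSeries {c : ℕ → ℂ} (hc : PolyGrowth c) {M : ℕ} (hM : 0 < M) {z : ℂ}
    (hz : 0 < z.im) : Summable fun n : ℕ =>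
      c n * Complex.exp (2 * Real.pi * Complex.I * z * ((n : ℂ) ^ 2 / (2 * (M : ℂ)))) := by
  obtain ⟨u, hu, hb⟩ := exists_qSeries_term_bound hc hM hz
  exact Summable.of_norm_bounded (hu.mul_right _) fun n => hb n z le_rfl

theorem norm_qSeries_le {c : ℕ → ℂ} (hc : PolyGrowth c) {M : ℕ} (hM : 0 < M) {ε : ℝ}
    (hε : 0 < ε) : ∃ K : ℝ, ∀ z : ℂ, ε ≤ z.im →
      ‖qSeries c M z‖ ≤ K * Real.exp (-(Real.pi / M) * z.im) := by
  obtain ⟨u, hu, hb⟩ := exists_qSeries_term_bound hc hM hε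
  refine ⟨∑' n, u n, fun z hz => ?_⟩
  rw [← tsum_mul_right]
  exact tsum_of_norm_bounded (hu.mul_right _).hasSum fun n => hb n z hz

theorem differentiable_qSeries_term (a : ℂ) (M n : ℕ) : Differentiable ℂ fun z : ℂ =>
    a * Complex.exp (2 * Real.pi * Complex.I * z * ((n : ℂ) ^ 2 / (2 * (M : ℂ)))) := by
  fun_prop

theorem exists_qSeries_term_unif_bound {c : ℕ → ℂ} (hc : PolyGrowth c) {M : ℕ} (hM : 0 < M) {ε : ℝ}
    (hε : 0 < ε) : ∃ u : ℕ → ℝ, Summable u ∧ ∀ (n : ℕ) (z : ℂ), z ∈ {z : ℂ | ε < z.im} →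
      ‖c n * Complex.exp (2 * Real.pi * Complex.I * z * ((n : ℂ) ^ 2 / (2 * (M : ℂ))))‖ ≤ u n := by
  obtain ⟨u, hu, hb⟩ := exists_qSeries_term_bound hc hM hε
  have hMr : (0 : ℝ) < M := by exact_mod_cast hM
  have hκ : 0 < Real.pi / M := div_pos Real.pi_pos hMr
  refine ⟨u, hu, fun n z hz => (hb n z (le_of_lt hz)).trans ?_⟩
  have hu0 : 0 ≤ u n := by
    have := (norm_nonneg _).trans (hb n z (le_of_lt hz))
    exact nonneg_of_mul_nonneg_left this (Real.exp_pos _)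
  refine mul_le_of_le_one_right hu0 (Real.exp_le_one_iff.2 ?_)
  have : 0 < z.im := hε.trans hz
  nlinarith

theorem differentiableOn_qSeries {c : ℕ → ℂ} (hc : PolyGrowth c) {M : ℕ} (hM : 0 < M) :
    DifferentiableOn ℂ (qSeries c M) {z : ℂ | 0 < z.im} := by
  intro z hz
  have hz' : 0 < z.im := hz
  obtain ⟨u, hu, hb⟩ := exists_qSeries_term_unif_bound hc hM (half_pos hz')
  have hopen : IsOpen {w : ℂ | z.im / 2 < w.im} :=
    isOpen_lt continuous_const Complex.continuous_im
  have := Complex.differentiableOn_tsum_of_summable_norm hu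
    (fun n => (differentiable_qSeries_term (c n) M n).differentiableOn) hopen hb
  exact (this.differentiableAt (hopen.mem_nhds (half_lt_self hz'))).differentiableWithinAt

theorem isCuspidal_qSeries {c : ℕ → ℂ} (hc : PolyGrowth c) {M : ℕ} (hM : 0 < M) :
    IsCuspidal (qSeries c M) :=
  ⟨differentiableOn_qSeries hc hM, Real.pi / M,
    div_pos Real.pi_pos (by exact_mod_cast hM), fun _ hε => norm_qSeries_le hc hM hε⟩

theorem deriv_qSeries {c : ℕ → ℂ} (hc : PolyGrowth c) {M : ℕ} (hM : 0 < M) {z : ℂ}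
    (hz : 0 < z.im) : deriv (qSeries c M) z =
      qSeries (fun n => 2 * Real.pi * Complex.I * ((n : ℂ) ^ 2 / (2 * (M : ℂ))) * c n) M z := by
  obtain ⟨u, hu, hb⟩ := exists_qSeries_term_unif_bound hc hM (half_pos hz)
  have hopen : IsOpen {w : ℂ | z.im / 2 < w.im} :=
    isOpen_lt continuous_const Complex.continuous_im
  have := Complex.hasSum_deriv_of_summable_norm hu
    (fun n => (differentiable_qSeries_term (c n) M n).differentiableOn) hopen hb
    (show z ∈ {w : ℂ | z.im / 2 < w.im} from half_lt_self hz)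
  unfold qSeries
  rw [← this.tsum_eq]
  refine tsum_congr fun n => ?_
  have h1 : HasDerivAt (fun z : ℂ => 2 * Real.pi * Complex.I * z * ((n : ℂ) ^ 2 / (2 * (M : ℂ))))
      (2 * Real.pi * Complex.I * ((n : ℂ) ^ 2 / (2 * (M : ℂ)))) z := by
    simpa using ((hasDerivAt_id z).const_mul (2 * Real.pi * Complex.I : ℂ)).mul_const
      ((n : ℂ) ^ 2 / (2 * (M : ℂ)))
  rw [(h1.cexp.const_mul (c n)).deriv]
  ring

/-! ### Vertical integrals as primitives -/

variable {F : ℂ → ℂ}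

theorem im_add_mul_I (z : ℂ) (s : ℝ) : (z + s * Complex.I).im = z.im + s := by simp

theorem continuousOn_vertical (hF : DifferentiableOn ℂ F {z : ℂ | 0 < z.im}) {z : ℂ}
    {A : Set ℝ} (hA : ∀ s ∈ A, 0 < z.im + s) :
    ContinuousOn (fun s : ℝ => F (z + s * Complex.I) * Complex.I) A := by
  refine ContinuousOn.mul (hF.continuousOn.comp (by fun_prop) fun s hs => ?_) continuousOn_const
  simpa using hA s hs

theorem IsCuspidal.exists_vertical_bound (hF : IsCuspidal F) {ε : ℝ} (hε : 0 < ε) :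
    ∃ K c : ℝ, 0 < c ∧ 0 ≤ K ∧ ∀ z : ℂ, ε ≤ z.im → ∀ s : ℝ, 0 ≤ s →
      ‖F (z + s * Complex.I) * Complex.I‖ ≤ K * Real.exp (-c * z.im) * Real.exp (-c * s) := by
  obtain ⟨hd, c, hc, hb⟩ := hF
  obtain ⟨K, hK⟩ := hb ε hε
  have h0 : 0 ≤ K := by
    have := (norm_nonneg _).trans (hK (ε * Complex.I) (by simp))
    exact nonneg_of_mul_nonneg_left this (Real.exp_pos _)
  refine ⟨K, c, hc, h0, fun z hz s hs => ?_⟩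
  have := hK (z + s * Complex.I) (by rw [im_add_mul_I]; linarith)
  rw [im_add_mul_I, mul_add, Real.exp_add, ← mul_assoc] at this
  simpa using this

theorem IsCuspidal.verticalIntegrable (hF : IsCuspidal F) {z : ℂ} (hz : 0 < z.im) :
    VerticalIntegrable F z := by
  obtain ⟨K, c, hc, hK, hb⟩ := hF.exists_vertical_bound hz
  refine Integrable.mono' ((exp_neg_integrableOn_Ioi 0 hc).const_mul (K * Real.exp (-c * z.im))) ?_ ?_
  · exact (continuousOn_vertical hF.1 fun s hs => add_pos hz hs).aestronglyMeasurable
      measurableSet_Ioi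
  · exact (ae_restrict_iff' measurableSet_Ioi).2 (ae_of_all _ fun s hs =>
      hb z le_rfl s (le_of_lt hs))

theorem IsCuspidal.norm_verticalIntegral_le (hF : IsCuspidal F) {ε : ℝ} (hε : 0 < ε) :
    ∃ K c : ℝ, 0 < c ∧ ∀ z : ℂ, ε ≤ z.im →
      ‖verticalIntegral F z‖ ≤ K * Real.exp (-c * z.im) := by
  obtain ⟨K, c, hc, hK, hb⟩ := hF.exists_vertical_bound hε
  refine ⟨K * ∫ s in Ioi (0 : ℝ), Real.exp (-c * s), c, hc, fun z hz => ?_⟩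
  have := norm_integral_le_of_norm_le
    ((exp_neg_integrableOn_Ioi 0 hc).const_mul (K * Real.exp (-c * z.im)))
    ((ae_restrict_iff' measurableSet_Ioi).2 (ae_of_all volume fun s hs => hb z hz s (le_of_lt hs)))
  rw [integral_const_mul] at this
  refine this.trans (le_of_eq ?_)
  ring

/-- After differentiating under the integral, the integrand i F'(z + is) is the s-derivative of F(z
+ is), so it integrates to -F(z). This replaces Cauchy's theorem throughout. -/
theorem IsCuspidal.hasDerivAt_verticalIntegral (hF : IsCuspidal F) {z : ℂ} (hz : 0 < z.im) :
    HasDerivAt (verticalIntegral F) (-F z) z := by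
  obtain ⟨K, c, hc, hK, hb⟩ := hF.deriv.exists_vertical_bound (half_pos hz)
  have hopen : IsOpen {w : ℂ | z.im / 2 < w.im} :=
    isOpen_lt continuous_const Complex.continuous_im
  have hderiv : ∀ w : ℂ, 0 < w.im → HasDerivAt F (_root_.deriv F w) w := fun w hw =>
    (hF.1.differentiableAt (isOpen_im_pos.mem_nhds hw)).hasDerivAt
  have key := hasDerivAt_integral_of_dominated_loc_of_deriv_le (μ := volume.restrict (Ioi 0))
    (F := fun (w : ℂ) (s : ℝ) => F (w + s * Complex.I) * Complex.I)
    (F' := fun (w : ℂ) (s : ℝ) => _root_.deriv F (w + s * Complex.I) * Complex.I) (x₀ := z)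
    (bound := fun s => K * Real.exp (-c * s)) (hopen.mem_nhds (half_lt_self hz)) ?_
    (hF.verticalIntegrable hz) ?_ ?_ ((exp_neg_integrableOn_Ioi 0 hc).const_mul _) ?_
  · refine key.2.congr_deriv ?_
    have hd : ∀ s ∈ Ici (0 : ℝ), HasDerivAt (fun s : ℝ => F (z + s * Complex.I))
        (_root_.deriv F (z + s * Complex.I) * Complex.I) s := by
      intro s hs
      have h1 : HasDerivAt (fun s : ℝ => z + s * Complex.I) Complex.I s := by
        simpa using ((Complex.ofRealCLM.hasDerivAt (x := s)).mul_const Complex.I).const_add z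
      exact (hderiv _ (by rw [im_add_mul_I]; exact add_pos_of_pos_of_nonneg hz hs)).comp s h1
    have hlim : Tendsto (fun s : ℝ => F (z + s * Complex.I)) atTop (𝓝 0) := by
      obtain ⟨K', c', hc', -, hb'⟩ := hF.exists_vertical_bound hz
      refine squeeze_zero_norm' (a := fun s => K' * Real.exp (-c' * z.im) * Real.exp (-c' * s)) ?_ ?_
      · filter_upwards [eventually_ge_atTop 0] with s hs
        simpa using hb' z le_rfl s hs
      · have : Tendsto (fun s : ℝ => Real.exp (-c' * s)) atTop (𝓝 0) := by
          refine Real.tendsto_exp_atBot.comp ?_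
          exact tendsto_id.const_mul_atTop_of_neg (by linarith)
        simpa using this.const_mul (K' * Real.exp (-c' * z.im))
    have := integral_Ioi_of_hasDerivAt_of_tendsto' hd key.1 hlim
    simpa using this
  · filter_upwards [hopen.mem_nhds (half_lt_self hz)] with w hw
    exact (continuousOn_vertical hF.1 fun s hs => add_pos ((half_pos hz).trans hw)
      hs).aestronglyMeasurable measurableSet_Ioi
  · exact (continuousOn_vertical hF.deriv.1 fun s hs => add_pos hz hs).aestronglyMeasurable
      measurableSet_Ioi
  · refine (ae_restrict_iff' measurableSet_Ioi).2 (ae_of_all _ fun s hs w hw => ?_)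
    refine (hb w (le_of_lt hw) s (le_of_lt hs)).trans ?_
    refine mul_le_mul_of_nonneg_right (mul_le_of_le_one_right hK (Real.exp_le_one_iff.2 ?_))
      (Real.exp_pos _).le
    have : 0 < w.im := (half_pos hz).trans hw
    nlinarith
  · refine (ae_restrict_iff' measurableSet_Ioi).2 (ae_of_all _ fun s hs w hw => ?_)
    have h1 : HasDerivAt (fun w : ℂ => w + s * Complex.I) 1 w := (hasDerivAt_id w).add_const _
    have hw0 : 0 < w.im := (half_pos hz).trans hw
    have h2 := HasDerivAt.comp w (hderiv (w + s * Complex.I)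
      (by rw [im_add_mul_I]; exact add_pos hw0 hs)) h1
    rw [mul_one] at h2
    exact h2.mul_const Complex.I

end

noncomputable section

open Filter MeasureTheory Set

/-! ### Rapid decay at real points -/

variable {F : ℂ → ℂ} {p : ℝ}

/-- The vertical cone of aperture `K` with apex at the real point `p`. -/
def cone (p K : ℝ) : Set ℂ := {z : ℂ | 0 < z.im ∧ |z.re - p| ≤ K * z.im}

/-- `F` decays faster than any power of `Im z` in all vertical cones at `p`. -/
def RapidDecay (F : ℂ → ℂ) (p : ℝ) : Prop :=
  ∀ K : ℝ, ∀ N : ℕ, F =O[𝓝[cone p K] (p : ℂ)] fun z => z.im ^ N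

theorem tendsto_im_cone (p K : ℝ) :
    Tendsto Complex.im (𝓝[cone p K] (p : ℂ)) (𝓝[>] (0 : ℝ)) := by
  refine tendsto_nhdsWithin_iff.2 ⟨?_, ?_⟩
  · have := (Complex.continuous_im.tendsto (p : ℂ)).mono_left
      (nhdsWithin_le_nhds (s := cone p K))
    simpa using this
  · filter_upwards [self_mem_nhdsWithin] with z hz using hz.1

theorem tendsto_vertical_cone (p : ℝ) {K : ℝ} (hK : 0 ≤ K) :
    Tendsto (fun y : ℝ => (p : ℂ) + y * Complex.I) (𝓝[>] (0 : ℝ)) (𝓝[cone p K] (p : ℂ)) := by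
  refine tendsto_nhdsWithin_iff.2 ⟨?_, ?_⟩
  · have h : Continuous fun y : ℝ => (p : ℂ) + y * Complex.I := by fun_prop
    have := (h.tendsto 0).mono_left (nhdsWithin_le_nhds (s := Ioi 0))
    simpa using this
  · filter_upwards [self_mem_nhdsWithin] with y hy
    have hy' : 0 < y := hy
    refine ⟨by simpa using hy, ?_⟩
    simp
    positivity

theorem RapidDecay.vertical (hF : RapidDecay F p) (N : ℕ) :
    (fun y : ℝ => F (p + y * Complex.I)) =O[𝓝[>] (0 : ℝ)] fun y => y ^ N := by
  have := (hF 0 N).comp_tendsto (tendsto_vertical_cone p le_rfl)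
  refine this.congr (fun _ => rfl) fun y => ?_
  simp

theorem RapidDecay.vertical_rpow (hF : RapidDecay F p) (r : ℝ) :
    (fun y : ℝ => F (p + y * Complex.I)) =O[𝓝[>] (0 : ℝ)] fun y => y ^ r := by
  obtain ⟨N, hN⟩ := exists_nat_ge r
  refine (hF.vertical N).trans (Asymptotics.IsBigO.of_bound 1 ?_)
  filter_upwards [Ioo_mem_nhdsGT (zero_lt_one (α := ℝ))] with y hy
  rw [one_mul, Real.norm_of_nonneg (pow_nonneg hy.1.le _),
    Real.norm_of_nonneg (Real.rpow_nonneg hy.1.le _), ← Real.rpow_natCast]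
  exact Real.rpow_le_rpow_of_exponent_ge hy.1 hy.2.le hN

/-- All moments of `g` on the positive half-line are absolutely convergent, and `g` vanishes to
infinite order at `0`. -/
structure IsFlat (g : ℝ → ℂ) : Prop where
  continuousOn : ContinuousOn g (Ioi 0)
  isBigO : ∀ r : ℝ, g =O[𝓝[>] (0 : ℝ)] fun y => y ^ r
  integrable : ∀ r : ℝ, IntegrableOn (fun t : ℝ => ((t ^ r : ℝ) : ℂ) * g t) (Ioi 0)

/-- Exponential decay at i∞ and rapid decay at p are the growth hypotheses for Mellin convergence at
every real exponent. -/
theorem IsCuspidal.isFlat (hF : IsCuspidal F) (hp : RapidDecay F p) :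
    IsFlat fun t : ℝ => F (p + t * Complex.I) := by
  have hcont : ContinuousOn (fun t : ℝ => F (p + t * Complex.I)) (Ioi 0) :=
    hF.1.continuousOn.comp (by fun_prop) fun t ht => by simpa using ht
  refine ⟨hcont, hp.vertical_rpow, fun r => ?_⟩
  obtain ⟨K, c, hc, hK, hb⟩ := hF.exists_vertical_bound one_pos
  have htop : (fun t : ℝ => F (p + t * Complex.I)) =O[atTop] fun t => Real.exp (-c * t) := by
    refine Asymptotics.IsBigO.of_bound K ?_
    filter_upwards [eventually_ge_atTop 1] with t ht
    have := hb (p + Complex.I) (by simp) (t - 1) (by linarith)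
    rw [norm_mul, Complex.norm_I, mul_one, mul_assoc, ← Real.exp_add] at this
    rw [Real.norm_of_nonneg (Real.exp_pos _).le]
    convert this using 3
    · push_cast; ring
    · simp; ring
  have := mellinConvergent_of_isBigO_rpow_exp (s := ((r + 1 : ℝ) : ℂ)) hc
    (hcont.locallyIntegrableOn measurableSet_Ioi) htop (hp.vertical_rpow (-r))
    (by simp)
  refine this.congr_fun (fun t ht => ?_) measurableSet_Ioi
  have ht' : 0 < t := ht
  simp only [smul_eq_mul]
  rw [Complex.ofReal_cpow ht'.le]
  push_cast
  rw [add_sub_cancel_right]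

theorem integral_Ioi_shift (g : ℝ → ℂ) (y : ℝ) :
    ∫ s in Ioi (0 : ℝ), g (y + s) = ∫ t in Ioi y, g t := by
  have := (measurePreserving_add_left volume y).setIntegral_preimage_emb
    (Homeomorph.addLeft y).measurableEmbedding g (Ioi y)
  simpa using this

theorem tendsto_integral_Ioi_zero {g : ℝ → ℂ} (hg : IntegrableOn g (Ioi 0)) :
    Tendsto (fun y : ℝ => ∫ t in Ioi y, g t) (𝓝[>] (0 : ℝ)) (𝓝 (∫ t in Ioi (0 : ℝ), g t)) := by
  have hc : AECover (volume.restrict (Ioi (0 : ℝ))) (𝓝[>] (0 : ℝ)) fun y : ℝ => Ioi y :=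
    aecover_Ioi_of_Ioi (tendsto_id.mono_left nhdsWithin_le_nhds)
  have := hc.integral_tendsto_of_countably_generated hg
  refine this.congr' ?_
  filter_upwards [self_mem_nhdsWithin] with y hy
  rw [Measure.restrict_restrict measurableSet_Ioi, inter_eq_left.2 (Ioi_subset_Ioi (le_of_lt hy))]

theorem IsFlat.integrableOn {g : ℝ → ℂ} (hg : IsFlat g) : IntegrableOn g (Ioi 0) := by
  refine (hg.integrable 0).congr_fun (fun t _ => ?_) measurableSet_Ioi
  simp

theorem IsCuspidal.verticalIntegrable_of_rapidDecay (hF : IsCuspidal F) (hp : RapidDecay F p) :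
    VerticalIntegrable F (p : ℂ) := (hF.isFlat hp).integrableOn.mul_const _

theorem IsCuspidal.tendsto_verticalIntegral_vertical (hF : IsCuspidal F) (hp : RapidDecay F p) :
    Tendsto (fun y : ℝ => verticalIntegral F (p + y * Complex.I)) (𝓝[>] (0 : ℝ))
      (𝓝 (verticalIntegral F (p : ℂ))) := by
  have h := tendsto_integral_Ioi_zero (hF.verticalIntegrable_of_rapidDecay hp)
  refine h.congr fun y => ?_
  rw [← integral_Ioi_shift (fun s : ℝ => F (p + s * Complex.I) * Complex.I), verticalIntegral]
  congr 1
  funext s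
  push_cast
  rw [add_mul, add_assoc]

/-- Convexity is what permits the mean value inequality near the apex. -/
theorem convex_cone_inter (p K : ℝ) (δ : ℝ) : Convex ℝ (cone p K ∩ Metric.ball (p : ℂ) δ) := by
  refine Convex.inter ?_ (convex_ball _ _)
  have : cone p K = {z : ℂ | 0 < Complex.imLm z} ∩ ({z : ℂ | (Complex.reLm - K • Complex.imLm) z ≤ p} ∩
      {z : ℂ | p ≤ (Complex.reLm + K • Complex.imLm) z}) := by
    ext z
    simp only [cone, mem_ofPred_eq, abs_le, mem_inter_iff, LinearMap.sub_apply, LinearMap.add_apply,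
      LinearMap.smul_apply, Complex.reLm_coe, Complex.imLm_coe, smul_eq_mul]
    constructor
    · rintro ⟨h1, h2, h3⟩; exact ⟨h1, by linarith, by linarith⟩
    · rintro ⟨h1, h2, h3⟩; exact ⟨h1, by linarith, by linarith⟩
  rw [this]
  exact (convex_halfSpace_gt (LinearMap.isLinear _) _).inter
    ((convex_halfSpace_le (LinearMap.isLinear _) _).inter
      (convex_halfSpace_ge (LinearMap.isLinear _) _))

/-- Compare z with the point of equal height above p. The horizontal distance is at most K Im z and
F, minus the derivative of the primitive, is bounded on the cone near p. -/
theorem IsCuspidal.tendsto_verticalIntegral (hF : IsCuspidal F) (hp : RapidDecay F p) {K : ℝ}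
    (hK : 0 ≤ K) : Tendsto (verticalIntegral F) (𝓝[cone p K] (p : ℂ))
      (𝓝 (verticalIntegral F (p : ℂ))) := by
  have h1 := (hF.tendsto_verticalIntegral_vertical hp).comp (tendsto_im_cone p K)
  obtain ⟨C, hC⟩ := (hp K 0).bound
  obtain ⟨δ, hδ, hb⟩ := Metric.mem_nhdsWithin_iff.1 hC
  have hle : ∀ᶠ z in 𝓝[cone p K] (p : ℂ),
      ‖verticalIntegral F z - verticalIntegral F (p + z.im * Complex.I)‖ ≤ C * (K * z.im) := by
    filter_upwards [self_mem_nhdsWithin, mem_nhdsWithin_of_mem_nhds (Metric.ball_mem_nhds _ hδ)]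
      with z hz hzδ
    have hconv := convex_cone_inter p K δ
    have hz1 : z ∈ cone p K ∩ Metric.ball (p : ℂ) δ := ⟨hz, hzδ⟩
    have him : ‖((p : ℂ) + z.im * Complex.I) - p‖ = |z.im| := by simp
    have hz2 : (p + z.im * Complex.I) ∈ cone p K ∩ Metric.ball (p : ℂ) δ := by
      refine ⟨⟨by simpa using hz.1, by simpa using mul_nonneg hK hz.1.le⟩, ?_⟩
      rw [Metric.mem_ball, dist_eq_norm, him]
      have : |(z - p).im| ≤ ‖z - p‖ := Complex.abs_im_le_norm _
      rw [Metric.mem_ball, dist_eq_norm] at hzδ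
      simp at this
      linarith
    have hC0 : 0 ≤ C := by
      have := hb ⟨hzδ, hz⟩
      simp only [mem_ofPred_eq, pow_zero, norm_one, mul_one] at this
      exact (norm_nonneg _).trans this
    have := hconv.norm_image_sub_le_of_norm_hasDerivWithin_le (f := verticalIntegral F)
      (f' := fun w => -F w) (C := C)
      (fun w hw => (hF.hasDerivAt_verticalIntegral hw.1.1).hasDerivWithinAt)
      (fun w hw => by
        have := hb ⟨hw.2, hw.1⟩
        simpa using this) hz2 hz1
    refine this.trans (mul_le_mul_of_nonneg_left ?_ hC0)
    have he : z - (p + z.im * Complex.I) = ((z.re - p : ℝ) : ℂ) := by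
      apply Complex.ext <;> simp
    rw [he, Complex.norm_real]
    exact hz.2
  have h2 : Tendsto (fun z : ℂ => C * (K * z.im)) (𝓝[cone p K] (p : ℂ)) (𝓝 0) := by
    have := (((tendsto_im_cone p K).mono_right nhdsWithin_le_nhds).const_mul K).const_mul C
    simpa using this
  have h3 := (squeeze_zero_norm' hle h2).add h1
  rw [zero_add] at h3
  refine h3.congr fun z => ?_
  simp

theorem norm_sub_le_of_mem_cone {K : ℝ} {z : ℂ} (hz : z ∈ cone p K) :
    ‖z - p‖ ≤ (K + 1) * z.im := by
  have := Complex.norm_le_abs_re_add_abs_im (z - p)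
  simp only [Complex.sub_re, Complex.ofReal_re, Complex.sub_im, Complex.ofReal_im, sub_zero] at this
  rw [abs_of_pos hz.1] at this
  linarith [hz.2]

/-! ### Möbius maps, cones, and the transport of rapid decay. -/

theorem moebius_sub_moebius (γ : SL(2, ℤ)) {z w : ℂ} (hz : (γ 1 0 * z + γ 1 1 : ℂ) ≠ 0)
    (hw : (γ 1 0 * w + γ 1 1 : ℂ) ≠ 0) :
    moebius γ z - moebius γ w = (z - w) / ((γ 1 0 * z + γ 1 1) * (γ 1 0 * w + γ 1 1)) := by
  have hdet : (γ 0 0 * γ 1 1 - γ 0 1 * γ 1 0 : ℂ) = 1 := by exact_mod_cast det_eq γ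
  unfold moebius
  rw [div_sub_div _ _ hz hw]
  congr 1
  linear_combination (z - w) * hdet

theorem im_moebius' (γ : SL(2, ℤ)) (z : ℂ) :
    (moebius γ z).im = z.im / Complex.normSq (γ 1 0 * z + γ 1 1) := by
  have := im_moebius (γ 0 0) (γ 0 1) (γ 1 0) (γ 1 1) z
  rw [det_eq] at this
  rw [moebius, this]
  simp

theorem moebius_im_pos (γ : SL(2, ℤ)) {z : ℂ} (hz : 0 < z.im) : 0 < (moebius γ z).im :=
  im_moebius_pos (det_eq γ) hz

theorem bottom_row_ne_zero (γ : SL(2, ℤ)) : γ 1 0 ≠ 0 ∨ γ 1 1 ≠ 0 := by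
  by_contra! h
  have := det_eq γ
  rw [h.1, h.2] at this
  simp at this

theorem denom_ne_zero (γ : SL(2, ℤ)) {z : ℂ} (hz : z.im ≠ 0) : (γ 1 0 * z + γ 1 1 : ℂ) ≠ 0 :=
  denom_ne_zero_of_im_pos (bottom_row_ne_zero γ) hz

/-- The action of `γ` on real numbers. -/
def moebiusReal (γ : SL(2, ℤ)) (x : ℝ) : ℝ :=
  ((γ 0 0 : ℝ) * x + γ 0 1) / ((γ 1 0 : ℝ) * x + γ 1 1)

theorem ofReal_moebiusReal (γ : SL(2, ℤ)) (x : ℝ) : (moebiusReal γ x : ℂ) = moebius γ x := by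
  simp [moebiusReal, moebius]

/-- The vertical direction and the apex are preserved by Möbius transformations, up to a small
change of the aperture. -/
theorem tendsto_moebius_cone (γ : SL(2, ℤ)) (p : ℝ) (hp : (γ 1 0 : ℝ) * p + (γ 1 1 : ℝ) ≠ 0)
    (K : ℝ) :
    Tendsto (moebius γ) (𝓝[cone p K] (p : ℂ))
      (𝓝[cone (moebiusReal γ p) (K + 1)] (moebiusReal γ p : ℂ)) := by
  set e : ℝ := γ 1 0 * p + γ 1 1 with he
  have heC : (γ 1 0 * p + γ 1 1 : ℂ) = e := by rw [he]; push_cast; rfl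
  have he0 : (e : ℂ) ≠ 0 := by exact_mod_cast hp
  have hjc : Continuous fun z : ℂ => (γ 1 0 * z + γ 1 1 : ℂ) := by fun_prop
  have hj : Tendsto (fun z : ℂ => (γ 1 0 * z + γ 1 1 : ℂ)) (𝓝 (p : ℂ)) (𝓝 e) := by
    have := hjc.tendsto (p : ℂ)
    rwa [heC] at this
  have hnum : Continuous fun z : ℂ => (γ 0 0 * z + γ 0 1 : ℂ) := by fun_prop
  refine tendsto_nhdsWithin_iff.2 ⟨?_, ?_⟩
  · rw [ofReal_moebiusReal]
    refine Tendsto.mono_left ?_ nhdsWithin_le_nhds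
    exact (hnum.tendsto _).div (hjc.tendsto _) (by rw [heC]; exact he0)
  · have hu : Tendsto (fun z : ℂ => (e : ℂ) / (γ 1 0 * z + γ 1 1)) (𝓝 (p : ℂ)) (𝓝 1) := by
      have := (tendsto_const_nhds (x := (e : ℂ))).div hj he0
      rwa [div_self he0] at this
    -- Up to the scale 1/e², the map multiplies z - p by a factor u tending to 1. The inequality
    -- that the cone condition requires is strict at u = 1, hence holds nearby; the extra 1 in the
    -- aperture gives this room.
    have hev : ∀ᶠ u : ℂ in 𝓝 1, K * |u.re| + |u.im| < (K + 1) * Complex.normSq u := by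
      have h1 : Continuous fun u : ℂ => K * |u.re| + |u.im| := by fun_prop
      have h2 : Continuous fun u : ℂ => (K + 1) * Complex.normSq u :=
        continuous_const.mul Complex.continuous_normSq
      exact h1.continuousAt.eventually_lt h2.continuousAt (by simp)
    filter_upwards [self_mem_nhdsWithin, mem_nhdsWithin_of_mem_nhds (hu.eventually hev)] with z hz hzu
    refine ⟨moebius_im_pos γ hz.1, ?_⟩
    have hjz := denom_ne_zero γ hz.1.ne'
    set u : ℂ := (e : ℂ) / (γ 1 0 * z + γ 1 1) with hudef
    have hsub : moebius γ z - moebius γ p = ((1 / e ^ 2 : ℝ) : ℂ) * ((z - p) * u) := by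
      rw [moebius_sub_moebius γ hjz (by rw [heC]; exact he0), heC, hudef]
      push_cast
      field_simp
    have hre : (moebius γ z).re - moebiusReal γ p = (1 / e ^ 2) * ((z - p) * u).re := by
      have := congrArg Complex.re hsub
      rw [Complex.re_ofReal_mul, ← ofReal_moebiusReal, Complex.sub_re, Complex.ofReal_re] at this
      exact this
    have him : (moebius γ z).im = (1 / e ^ 2) * (z.im * Complex.normSq u) := by
      have : Complex.normSq (γ 1 0 * z + γ 1 1) ≠ 0 := (Complex.normSq_pos.2 hjz).ne'
      rw [im_moebius', hudef, Complex.normSq_div, Complex.normSq_ofReal]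
      have hp' : e ≠ 0 := hp
      field_simp
    have hpos : 0 < 1 / e ^ 2 := by positivity
    rw [hre, him, abs_mul, abs_of_pos hpos, mul_left_comm]
    refine mul_le_mul_of_nonneg_left ?_ hpos.le
    rw [Complex.mul_re]
    simp only [Complex.sub_re, Complex.ofReal_re, Complex.sub_im, Complex.ofReal_im, sub_zero]
    have h1 := abs_sub ((z.re - p) * u.re) (z.im * u.im)
    rw [abs_mul, abs_mul, abs_of_pos hz.1] at h1
    have h2 : |z.re - p| * |u.re| ≤ K * z.im * |u.re| :=
      mul_le_mul_of_nonneg_right hz.2 (abs_nonneg _)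
    have h3 := mul_le_mul_of_nonneg_left hzu.le hz.1.le
    linarith

/-- `F` transforms like a modular form of weight `m / 2` under `γ`, with multiplier `v`. -/
def TransformsUnder (F : ℂ → ℂ) (m : ℕ) (v : ℂ) (γ : SL(2, ℤ)) : Prop :=
  ∀ z : ℂ, 0 < z.im →
    F (moebius γ z) = v * (((γ 1 0 : ℂ) * z + (γ 1 1 : ℂ)) ^ (1 / 2 : ℂ)) ^ m * F z

theorem inv_entries (γ : SL(2, ℤ)) : γ⁻¹ 0 0 = γ 1 1 ∧ γ⁻¹ 0 1 = -γ 0 1 ∧ γ⁻¹ 1 0 = -γ 1 0 ∧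
    γ⁻¹ 1 1 = γ 0 0 := by
  rw [Matrix.SpecialLinearGroup.SL2_inv_expl]
  simp

/-- Stated over a general field so as to serve both real points and points of the upper half-plane.
-/
theorem moebius_denom_aux {𝕜 : Type*} [Field 𝕜] {a b c d z : 𝕜} (hdet : a * d - b * c = 1)
    (hz : -c * z + a ≠ 0) : c * ((d * z + -b) / (-c * z + a)) + d = 1 / (-c * z + a) := by
  obtain ⟨D, hD⟩ : ∃ D, D = -c * z + a := ⟨_, rfl⟩
  rw [← hD] at hz ⊢
  field_simp
  linear_combination hdet + d * hD

theorem moebius_num_aux {𝕜 : Type*} [Field 𝕜] {a b c d z : 𝕜} (hdet : a * d - b * c = 1)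
    (hz : -c * z + a ≠ 0) : a * ((d * z + -b) / (-c * z + a)) + b = z / (-c * z + a) := by
  obtain ⟨D, hD⟩ : ∃ D, D = -c * z + a := ⟨_, rfl⟩
  rw [← hD] at hz ⊢
  field_simp
  linear_combination z * hdet + b * hD

theorem moebius_moebius_inv (γ : SL(2, ℤ)) {z : ℂ} (hz : (-γ 1 0 * z + γ 0 0 : ℂ) ≠ 0) :
    moebius γ (moebius γ⁻¹ z) = z := by
  have hdet : (γ 0 0 * γ 1 1 - γ 0 1 * γ 1 0 : ℂ) = 1 := by exact_mod_cast det_eq γ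
  obtain ⟨h1, h2, h3, h4⟩ := inv_entries γ
  unfold moebius
  rw [h1, h2, h3, h4]
  push_cast
  rw [moebius_denom_aux hdet hz, moebius_num_aux hdet hz, div_div_div_cancel_right₀ hz, div_one]

theorem denom_inv (γ : SL(2, ℤ)) {z : ℂ} (hz : (-γ 1 0 * z + γ 0 0 : ℂ) ≠ 0) :
    (γ 1 0 * moebius γ⁻¹ z + γ 1 1 : ℂ) = 1 / (-γ 1 0 * z + γ 0 0) := by
  have hdet : (γ 0 0 * γ 1 1 - γ 0 1 * γ 1 0 : ℂ) = 1 := by exact_mod_cast det_eq γ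
  obtain ⟨h1, h2, h3, h4⟩ := inv_entries γ
  unfold moebius
  rw [h1, h2, h3, h4]
  push_cast
  exact moebius_denom_aux hdet hz

theorem norm_cpow_half (z : ℂ) : ‖z ^ (1 / 2 : ℂ)‖ = ‖z‖ ^ (1 / 2 : ℝ) := by
  have := Complex.norm_cpow_real z (1 / 2)
  push_cast at this
  exact this

/-- Pull a cone at γp back by γ⁻¹ into a wider cone at p. There the automorphy factor is bounded,
and the heights before and after are comparable. -/
theorem RapidDecay.moebius {m : ℕ} {v : ℂ} {γ : SL(2, ℤ)} (hF : RapidDecay F p)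
    (ht : TransformsUnder F m v γ) (hp : (γ 1 0 : ℝ) * p + (γ 1 1 : ℝ) ≠ 0) :
    RapidDecay F (moebiusReal γ p) := by
  intro K N
  have hdet : (γ 0 0 * γ 1 1 - γ 0 1 * γ 1 0 : ℝ) = 1 := by exact_mod_cast det_eq γ
  obtain ⟨h1, h2, h3, h4⟩ := inv_entries γ
  set q := moebiusReal γ p with hq
  have hdet' : (γ 1 1 * γ 0 0 - -γ 0 1 * -γ 1 0 : ℝ) = 1 := by linarith
  have hp' : - -(γ 1 0 : ℝ) * p + γ 1 1 ≠ 0 := by rwa [neg_neg]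
  have hden : (γ⁻¹ 1 0 : ℝ) * q + (γ⁻¹ 1 1 : ℝ) = 1 / (γ 1 0 * p + γ 1 1) := by
    have := moebius_denom_aux hdet' hp'
    rw [neg_neg, neg_neg] at this
    rw [h3, h4, hq, moebiusReal]
    push_cast
    exact this
  have hden0 : (γ⁻¹ 1 0 : ℝ) * q + (γ⁻¹ 1 1 : ℝ) ≠ 0 := by
    rw [hden]; exact one_div_ne_zero hp
  have hback : moebiusReal γ⁻¹ q = p := by
    have := moebius_num_aux hdet' hp'
    rw [neg_neg, neg_neg] at this
    rw [moebiusReal, hden, h1, h2, hq, moebiusReal]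
    push_cast
    rw [this, div_div_div_cancel_right₀ hp, div_one]
  have htend := tendsto_moebius_cone γ⁻¹ q hden0 K
  rw [hback] at htend
  have hO := (hF (K + 1) N).comp_tendsto htend
  have hjc : Continuous fun z : ℂ => ((γ⁻¹ 1 0 : ℤ) * z + (γ⁻¹ 1 1 : ℤ) : ℂ) := by fun_prop
  have hj := (hjc.tendsto (q : ℂ)).mono_left (nhdsWithin_le_nhds (s := cone q K))
  have hl0 : ((γ⁻¹ 1 0 : ℤ) * (q : ℂ) + (γ⁻¹ 1 1 : ℤ) : ℂ) ≠ 0 := by exact_mod_cast hden0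
  have hjO : (fun z : ℂ => (((γ⁻¹ 1 0 : ℤ) * z + (γ⁻¹ 1 1 : ℤ) : ℂ))⁻¹) =O[𝓝[cone q K] (q : ℂ)]
      fun _ => (1 : ℝ) := (hj.inv₀ hl0).isBigO_one ℝ
  have hA : (fun z : ℂ => v * (((γ 1 0 : ℂ) * _root_.moebius γ⁻¹ z + (γ 1 1 : ℂ)) ^ (1 / 2 : ℂ)) ^ m)
      =O[𝓝[cone q K] (q : ℂ)] fun _ => (1 : ℝ) := by
    have hr : Tendsto (fun z : ℂ => ‖v‖ * (‖((γ⁻¹ 1 0 : ℤ) * z + (γ⁻¹ 1 1 : ℤ) : ℂ)⁻¹‖ ^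
        (1 / 2 : ℝ)) ^ m) (𝓝[cone q K] (q : ℂ)) (𝓝 (‖v‖ *
        (‖((γ⁻¹ 1 0 : ℤ) * (q : ℂ) + (γ⁻¹ 1 1 : ℤ) : ℂ)⁻¹‖ ^ (1 / 2 : ℝ)) ^ m)) :=
      (((hj.inv₀ hl0).norm.rpow_const (Or.inr (by norm_num))).pow m).const_mul _
    refine (Asymptotics.IsBigO.of_bound 1 ?_).trans (hr.isBigO_one ℝ)
    filter_upwards [self_mem_nhdsWithin] with z hz
    have hz0 := denom_ne_zero γ⁻¹ hz.1.ne'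
    rw [h3, h4] at hz0 ⊢
    push_cast at hz0 ⊢
    rw [denom_inv γ hz0, one_mul, norm_mul, norm_pow, norm_cpow_half, one_div, norm_mul, norm_norm,
      Real.norm_of_nonneg (by positivity)]
  have hB : (fun z : ℂ => (_root_.moebius γ⁻¹ z).im ^ N) =O[𝓝[cone q K] (q : ℂ)]
      fun z => z.im ^ N := by
    refine Asymptotics.IsBigO.pow ?_ N
    have : (fun z : ℂ => (_root_.moebius γ⁻¹ z).im) = fun z => z.im *
        (Complex.normSq ((γ⁻¹ 1 0 : ℤ) * z + (γ⁻¹ 1 1 : ℤ) : ℂ))⁻¹ := by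
      funext z; rw [im_moebius', div_eq_mul_inv]
    rw [this]
    have hns := ((Complex.continuous_normSq.tendsto _).comp hj).inv₀ (Complex.normSq_pos.2 hl0).ne'
    have := (Asymptotics.isBigO_refl (fun z : ℂ => z.im) (𝓝[cone q K] (q : ℂ))).mul
      (hns.isBigO_one ℝ)
    simpa using this
  refine ((hA.mul (hO.trans hB)).congr' ?_ ?_)
  · filter_upwards [self_mem_nhdsWithin] with z hz
    have hz0 := denom_ne_zero γ⁻¹ hz.1.ne'
    rw [h3, h4] at hz0
    push_cast at hz0
    rw [Function.comp_apply, ← ht _ (moebius_im_pos γ⁻¹ hz.1), moebius_moebius_inv γ hz0]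
  · exact Eventually.of_forall fun z => one_mul _

theorem exp_neg_div_isBigO {κ : ℝ} (hκ : 0 < κ) (r : ℝ) :
    (fun y : ℝ => Real.exp (-κ / y)) =O[𝓝[>] (0 : ℝ)] fun y => y ^ r := by
  have := (isLittleO_exp_neg_mul_rpow_atTop hκ (-r)).isBigO.comp_tendsto tendsto_inv_nhdsGT_zero
  refine this.congr' (Eventually.of_forall fun y => by simp [div_eq_mul_inv]) ?_
  filter_upwards [self_mem_nhdsWithin] with y hy
  have : (0 : ℝ) < y := hy
  simp only [Function.comp_apply]
  rw [Real.inv_rpow this.le, Real.rpow_neg this.le, inv_inv]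

theorem rapidDecay_of_bound (h : ∀ K : ℝ, ∃ C κ r : ℝ, 0 < κ ∧ ∀ᶠ z in 𝓝[cone p K] (p : ℂ),
    ‖F z‖ ≤ C * (z.im ^ (-r) * Real.exp (-κ / z.im))) : RapidDecay F p := by
  intro K N
  obtain ⟨C, κ, r, hκ, hb⟩ := h K
  have h1 : (fun y : ℝ => y ^ (-r) * Real.exp (-κ / y)) =O[𝓝[>] (0 : ℝ)] fun y => y ^ N := by
    have := (Asymptotics.isBigO_refl (fun y : ℝ => y ^ (-r)) (𝓝[>] (0 : ℝ))).mul
      (exp_neg_div_isBigO hκ (N + r))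
    refine this.congr' EventuallyEq.rfl ?_
    filter_upwards [self_mem_nhdsWithin] with y hy
    rw [← Real.rpow_add hy, ← Real.rpow_natCast]
    congr 1
    ring
  refine (Asymptotics.IsBigO.of_bound C ?_).trans (h1.comp_tendsto (tendsto_im_cone p K))
  filter_upwards [hb, self_mem_nhdsWithin] with z hz hz1
  have : (0 : ℝ) < z.im := hz1.1
  rw [Function.comp_apply, Real.norm_of_nonneg (by positivity)]
  exact hz

/-- The inverse of γ sends a cone at a/c to points of height at least A / Im z, where F is
exponentially small; the automorphy factor costs only a power of Im z. -/
theorem IsCuspidal.rapidDecay_of_transformsUnder {m : ℕ} {v : ℂ} {γ : SL(2, ℤ)}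
    (hF : IsCuspidal F) (ht : TransformsUnder F m v γ) (hc : γ 1 0 ≠ 0) :
    RapidDecay F ((γ 0 0 : ℝ) / (γ 1 0 : ℝ)) := by
  have hcR : (γ 1 0 : ℝ) ≠ 0 := by exact_mod_cast hc
  have hcC : (γ 1 0 : ℂ) ≠ 0 := by exact_mod_cast hc
  obtain ⟨-, κ, hκ, hb⟩ := hF
  obtain ⟨B, hB⟩ := hb 1 one_pos
  have hB0 : 0 ≤ B := by
    have := (norm_nonneg _).trans (hB Complex.I (by simp))
    exact nonneg_of_mul_nonneg_left this (Real.exp_pos _)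
  refine rapidDecay_of_bound fun K => ?_
  -- A negative aperture gives an empty cone.
  by_cases hK : K < 0
  · refine ⟨0, 1, 0, one_pos, ?_⟩
    filter_upwards [self_mem_nhdsWithin] with z hz
    have := (abs_nonneg _).trans hz.2
    nlinarith [hz.1]
  rw [not_lt] at hK
  -- In the cone |-cz + a| ≤ |c|(K + 1) Im z, and the height of γ⁻¹z is Im z divided by the square
  -- of this modulus.
  set A : ℝ := ((γ 1 0 : ℝ) ^ 2 * (K + 1) ^ 2)⁻¹ with hA
  have hA0 : 0 < A := by positivity
  refine ⟨‖v‖ * (|(γ 1 0 : ℝ)| ^ (-(1 / 2 : ℝ) * m)) * B, κ * A, 1 / 2 * m, by positivity, ?_⟩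
  have him := (tendsto_im_cone ((γ 0 0 : ℝ) / (γ 1 0 : ℝ)) K).mono_right nhdsWithin_le_nhds
  filter_upwards [self_mem_nhdsWithin, him.eventually (gt_mem_nhds hA0)] with z hz hzA
  have hz0 : (-γ 1 0 * z + γ 0 0 : ℂ) ≠ 0 := by
    have := denom_ne_zero γ⁻¹ hz.1.ne'
    rw [(inv_entries γ).2.2.1, (inv_entries γ).2.2.2] at this
    push_cast at this
    exact this
  have hnum : (-γ 1 0 * z + γ 0 0 : ℂ) = -γ 1 0 * (z - ((γ 0 0 : ℝ) / (γ 1 0 : ℝ) : ℝ)) := by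
    push_cast; field_simp; ring
  have hup : ‖(-γ 1 0 * z + γ 0 0 : ℂ)‖ ≤ |(γ 1 0 : ℝ)| * ((K + 1) * z.im) := by
    rw [hnum, norm_mul, norm_neg, Complex.norm_intCast]
    exact mul_le_mul_of_nonneg_left (norm_sub_le_of_mem_cone hz) (abs_nonneg _)
  have hlow : |(γ 1 0 : ℝ)| * z.im ≤ ‖(-γ 1 0 * z + γ 0 0 : ℂ)‖ := by
    have := Complex.abs_im_le_norm (-γ 1 0 * z + γ 0 0 : ℂ)
    simpa [abs_mul, abs_of_pos hz.1] using this
  have himz : A / z.im ≤ (moebius γ⁻¹ z).im := by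
    rw [im_moebius', (inv_entries γ).2.2.1, (inv_entries γ).2.2.2, Complex.normSq_eq_norm_sq]
    push_cast
    have h1 : ‖(-γ 1 0 * z + γ 0 0 : ℂ)‖ ^ 2 ≤ A⁻¹ * z.im ^ 2 := by
      refine (pow_le_pow_left₀ (norm_nonneg _) hup 2).trans (le_of_eq ?_)
      rw [hA, inv_inv, mul_pow, sq_abs]
      ring
    have h2 : 0 < ‖(-γ 1 0 * z + γ 0 0 : ℂ)‖ ^ 2 := by positivity
    have hzi := hz.1
    rw [div_le_div_iff₀ hzi h2]
    have := mul_le_mul_of_nonneg_left h1 hA0.le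
    rw [← mul_assoc, mul_inv_cancel₀ hA0.ne', one_mul] at this
    linarith
  have hone : 1 ≤ (moebius γ⁻¹ z).im := ((one_le_div hz.1).2 hzA.le).trans himz
  have hval := ht _ (moebius_im_pos γ⁻¹ hz.1)
  rw [moebius_moebius_inv γ hz0, denom_inv γ hz0] at hval
  rw [hval, norm_mul, norm_mul, norm_pow, norm_cpow_half, one_div, norm_inv,
    Real.inv_rpow (norm_nonneg _), ← Real.rpow_neg (norm_nonneg _), ← Real.rpow_mul_natCast (norm_nonneg _)]
  have hzi := hz.1
  have hcp : 0 < |(γ 1 0 : ℝ)| := abs_pos.2 hcR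
  have e1 : ‖(-γ 1 0 * z + γ 0 0 : ℂ)‖ ^ (-(1 / 2 : ℝ) * m) ≤
      |(γ 1 0 : ℝ)| ^ (-(1 / 2 : ℝ) * m) * z.im ^ (-(1 / 2 * m) : ℝ) := by
    rw [← neg_mul, ← Real.mul_rpow hcp.le hzi.le]
    refine Real.rpow_le_rpow_of_nonpos (mul_pos hcp hzi) hlow ?_
    have : (0 : ℝ) ≤ m := Nat.cast_nonneg m
    linarith
  have e2 : ‖F (moebius γ⁻¹ z)‖ ≤ B * Real.exp (-(κ * A) / z.im) := by
    refine (hB _ hone).trans (mul_le_mul_of_nonneg_left (Real.exp_le_exp.2 ?_) hB0)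
    have := mul_le_mul_of_nonneg_left himz hκ.le
    rw [neg_div, mul_div_assoc]
    linarith
  calc _ ≤ ‖v‖ * (|(γ 1 0 : ℝ)| ^ (-(1 / 2 : ℝ) * m) * z.im ^ (-(1 / 2 * m) : ℝ)) *
        (B * Real.exp (-(κ * A) / z.im)) := by gcongr
    _ = _ := by ring

end

noncomputable section

open Filter MeasureTheory Set

/-! ### Decay of the theta functions at rational points -/

theorem norm_exp_real_mul_I_eq_one (n : ℤ) (x : ℝ) :
    ‖Complex.exp (2 * Real.pi * Complex.I * n * x)‖ = 1 := by
  rw [show (2 * Real.pi * Complex.I * n * x : ℂ) = ((2 * Real.pi * n * x : ℝ) : ℂ) * Complex.I by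
    push_cast; ring]
  exact Complex.norm_exp_ofReal_mul_I _

theorem jacobiTheta₂_term_eq (n : ℤ) (x : ℝ) (τ : ℂ) : jacobiTheta₂_term n x τ =
    Complex.exp (2 * Real.pi * Complex.I * n * x) *
      Complex.exp (2 * Real.pi * Complex.I * τ * ((n : ℂ) ^ 2 / (2 * ((1 : ℕ) : ℂ)))) := by
  rw [jacobiTheta₂_term, ← Complex.exp_add]
  congr 1
  push_cast
  ring

theorem exists_norm_jacobiTheta₂_sub_one_le (x : ℝ) : ∃ K : ℝ, ∀ τ : ℂ, 1 ≤ τ.im →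
    ‖jacobiTheta₂ x τ - 1‖ ≤ K * Real.exp (-Real.pi * τ.im) := by
  set c : ℕ → ℂ := fun n => if n = 0 then 0 else
    Complex.exp (2 * Real.pi * Complex.I * (n : ℤ) * x) +
      Complex.exp (2 * Real.pi * Complex.I * (-n : ℤ) * x) with hc
  have hcg : PolyGrowth c := by
    refine ⟨by simp [hc], 2, 0, fun n => ?_⟩
    rw [pow_zero, mul_one]
    simp only [hc]
    split_ifs
    · simp
    · refine (norm_add_le _ _).trans ?_
      rw [norm_exp_real_mul_I_eq_one, norm_exp_real_mul_I_eq_one]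
      norm_num
  obtain ⟨K, hK⟩ := norm_qSeries_le hcg one_pos one_pos
  refine ⟨K, fun τ hτ => ?_⟩
  have hs := (hasSum_jacobiTheta₂_term x (zero_lt_one.trans_le hτ)).nat_add_neg
  -- Folding ℤ onto ℕ counts the term n = 0, which equals 1, twice; removing 2 leaves a series
  -- without constant term.
  have hs2 := hs.sub (hasSum_ite_eq (0 : ℕ) (2 : ℂ))
  have h0 : jacobiTheta₂_term 0 x τ = 1 := by simp [jacobiTheta₂_term]
  have heq : jacobiTheta₂ x τ - 1 = qSeries c 1 τ := by
    rw [h0] at hs2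
    rw [show jacobiTheta₂ x τ - 1 = jacobiTheta₂ x τ + 1 - 2 by ring, ← hs2.tsum_eq, qSeries]
    refine tsum_congr fun n => ?_
    rcases Nat.eq_zero_or_pos n with rfl | hn
    · simp [hc, jacobiTheta₂_term]
      norm_num
    · rw [jacobiTheta₂_term_eq, jacobiTheta₂_term_eq, if_neg hn.ne']
      simp only [hc]
      rw [if_neg hn.ne']
      push_cast
      rw [neg_sq]
      ring
  rw [heq]
  have := hK τ hτ
  rwa [Nat.cast_one, div_one] at this

/-- Differentiation in the elliptic variable kills the constant term, so nothing has to be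
subtracted here; this is why the odd case needs no condition on a sum of `f`. -/
theorem exists_norm_jacobiTheta₂'_le (x : ℝ) : ∃ K : ℝ, ∀ τ : ℂ, 1 ≤ τ.im →
    ‖jacobiTheta₂' x τ‖ ≤ K * Real.exp (-Real.pi * τ.im) := by
  set c : ℕ → ℂ := fun n => 2 * Real.pi * Complex.I * n *
    (Complex.exp (2 * Real.pi * Complex.I * (n : ℤ) * x) -
      Complex.exp (2 * Real.pi * Complex.I * (-n : ℤ) * x)) with hc
  have hcg : PolyGrowth c := by
    refine ⟨by simp [hc], 2 * Real.pi * 2, 1, fun n => ?_⟩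
    simp only [hc, norm_mul]
    have := norm_sub_le (Complex.exp (2 * Real.pi * Complex.I * (n : ℤ) * x))
      (Complex.exp (2 * Real.pi * Complex.I * (-n : ℤ) * x))
    rw [norm_exp_real_mul_I_eq_one, norm_exp_real_mul_I_eq_one] at this
    rw [Complex.norm_I, Complex.norm_real, Real.norm_of_nonneg Real.pi_pos.le, Complex.norm_natCast,
      Complex.norm_ofNat, pow_one]
    have h2 : 0 ≤ 2 * Real.pi * n := by positivity
    calc _ ≤ 2 * Real.pi * 1 * n * (1 + 1) := by gcongr
      _ = _ := by ring
  obtain ⟨K, hK⟩ := norm_qSeries_le hcg one_pos one_pos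
  refine ⟨K, fun τ hτ => ?_⟩
  have hs := (hasSum_jacobiTheta₂'_term x (zero_lt_one.trans_le hτ)).nat_add_neg
  have h0 : jacobiTheta₂'_term 0 x τ = 0 := by simp [jacobiTheta₂'_term]
  have heq : jacobiTheta₂' x τ = qSeries c 1 τ := by
    rw [h0, add_zero] at hs
    rw [← hs.tsum_eq, qSeries]
    refine tsum_congr fun n => ?_
    rw [jacobiTheta₂'_term, jacobiTheta₂'_term, jacobiTheta₂_term_eq, jacobiTheta₂_term_eq]
    simp only [hc]
    push_cast
    rw [neg_sq]
    ring
  rw [heq]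
  have := hK τ hτ
  rwa [Nat.cast_one, div_one] at this

variable {L : ℕ} {h : ℤ} {w : ℂ}

theorem residueTheta_inversion (hL : 0 < L) (hw : 0 < w.im) (u : ℂ) :
    residueTheta L h w u = 1 / (-Complex.I * (L * w)) ^ (1 / 2 : ℂ) *
      Complex.exp (-(Real.pi * Complex.I * L * u ^ 2 / w)) *
      jacobiTheta₂ (((h / L : ℝ) : ℂ) + u / w) (-1 / (L * w)) := by
  have hL0 : (L : ℂ) ≠ 0 := by exact_mod_cast hL.ne'
  have hw0 : w ≠ 0 := by rintro rfl; simp at hw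
  have e1 : (h * w + L * u) / (L * w) = ((h / L : ℝ) : ℂ) + u / w := by
    push_cast; field_simp
  rw [residueTheta, jacobiTheta₂_functional_equation, e1, mul_left_comm, ← mul_assoc, ← mul_assoc]
  congr 1
  rw [mul_assoc, mul_comm (Complex.exp _), mul_assoc, ← Complex.exp_add]
  congr 2
  field_simp
  ring

/-- The u-derivative at 0 of the previous inversion formula; the Gaussian is again stationary. -/
theorem residueThetaDeriv_inversion (hL : 0 < L) (hw : 0 < w.im) :
    residueThetaDeriv L h w = 1 / (-Complex.I * (L * w)) ^ (1 / 2 : ℂ) *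
      jacobiTheta₂' ((h / L : ℝ) : ℂ) (-1 / (L * w)) / w := by
  have hτ : 0 < (-1 / (L * w) : ℂ).im := by
    have := im_natCast_mul_pos hL hw
    rw [neg_div, one_div, Complex.neg_im, Complex.inv_im]
    have h2 : (L * w : ℂ) ≠ 0 := by
      intro h; rw [h] at this; simp at this
    have h3 := Complex.normSq_pos.2 h2
    rw [neg_div, neg_neg]
    positivity
  have h0 := hasDerivAt_residueTheta (h := h) hL hw
  have h1 : HasDerivAt (fun u : ℂ => ((h / L : ℝ) : ℂ) + u / w) (1 / w) 0 :=
    ((hasDerivAt_id (0 : ℂ)).div_const w).const_add _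
  have h2 := HasDerivAt.comp (0 : ℂ) (h₂ := fun x => jacobiTheta₂ x (-1 / (L * w)))
    (h₂' := jacobiTheta₂' ((h / L : ℝ) : ℂ) (-1 / (L * w)))
    (by simpa using hasDerivAt_jacobiTheta₂_fst ((h / L : ℝ) : ℂ) hτ) h1
  have h3 : HasDerivAt (fun u : ℂ => -(Real.pi * Complex.I * L * u ^ 2 / w)) 0 0 := by
    have := (((hasDerivAt_pow 2 (0 : ℂ)).const_mul
      (Real.pi * Complex.I * L : ℂ)).div_const w).fun_neg
    simpa using this
  have h4 := (h3.cexp.const_mul (1 / (-Complex.I * (L * w)) ^ (1 / 2 : ℂ))).mul h2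
  have h5 := h0.unique (h4.congr_of_eventuallyEq (Eventually.of_forall fun u =>
    residueTheta_inversion hL hw u))
  rw [h5]
  simp
  ring

theorem inversion_bound_aux {K : ℝ} (hK : 0 ≤ K) (hL : 0 < L) (hw : w ∈ cone 0 K) :
    1 / (L * (K + 1) ^ 2) / w.im ≤ (-1 / (L * w) : ℂ).im := by
  have hLr : (0 : ℝ) < L := by exact_mod_cast hL
  have hn := norm_sub_le_of_mem_cone hw
  rw [Complex.ofReal_zero, sub_zero] at hn
  have hwi := hw.1
  have hw0 : w ≠ 0 := by rintro rfl; simp at hwi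
  have hwn : 0 < ‖w‖ := norm_pos_iff.2 hw0
  have him : (-1 / (L * w) : ℂ).im = w.im / (L * ‖w‖ ^ 2) := by
    rw [neg_div, one_div, Complex.neg_im, Complex.inv_im, Complex.normSq_eq_norm_sq, norm_mul,
      Complex.norm_natCast, neg_div, neg_neg]
    have : ((L : ℂ) * w).im = L * w.im := by simp
    rw [this]
    field_simp
  rw [him, div_div, div_le_div_iff₀ (by positivity) (by positivity), one_mul]
  have := pow_le_pow_left₀ hwn.le hn 2
  have := mul_le_mul_of_nonneg_left this hLr.le
  nlinarith

theorem norm_inv_sqrt_le (hL : 0 < L) {K : ℝ} (hw : w ∈ cone 0 K) :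
    ‖1 / (-Complex.I * (L * w)) ^ (1 / 2 : ℂ)‖ ≤ (L : ℝ) ^ (-(1 / 2) : ℝ) * w.im ^ (-(1 / 2) : ℝ) := by
  have hLr : (0 : ℝ) < L := by exact_mod_cast hL
  have hwi := hw.1
  have him : w.im ≤ ‖w‖ := (le_abs_self _).trans (Complex.abs_im_le_norm w)
  rw [norm_div, norm_one, norm_cpow_half, norm_mul, norm_neg, Complex.norm_I, one_mul, norm_mul,
    Complex.norm_natCast, one_div, ← Real.rpow_neg (by positivity), ← Real.mul_rpow hLr.le hwi.le]
  refine Real.rpow_le_rpow_of_nonpos (by positivity) ?_ (by norm_num)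
  gcongr

/-- A combination of Jacobi theta values at `-1 / (L w)` with exponential decay gives rapid decay
at `0`. -/
theorem rapidDecay_zero_of_inversion {F G : ℂ → ℂ} (hL : 0 < L) {C : ℝ} (r : ℝ)
    (hG : ∀ τ : ℂ, 1 ≤ τ.im → ‖G τ‖ ≤ C * Real.exp (-Real.pi * τ.im))
    (hF : ∀ K : ℝ, ∀ w ∈ cone 0 K, ‖F w‖ ≤ w.im ^ (-r) * ‖G (-1 / (L * w))‖) :
    RapidDecay F 0 := by
  have hLr : (0 : ℝ) < L := by exact_mod_cast hL
  have hC : 0 ≤ C := by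
    have := (norm_nonneg _).trans (hG Complex.I (by simp))
    exact nonneg_of_mul_nonneg_left this (Real.exp_pos _)
  refine rapidDecay_of_bound fun K => ?_
  by_cases hK : K < 0
  · refine ⟨0, 1, 0, one_pos, ?_⟩
    filter_upwards [self_mem_nhdsWithin] with z hz
    have := (abs_nonneg _).trans hz.2
    nlinarith [hz.1]
  rw [not_lt] at hK
  set A : ℝ := 1 / (L * (K + 1) ^ 2) with hA
  have hA0 : 0 < A := by positivity
  refine ⟨C, Real.pi * A, r, mul_pos Real.pi_pos hA0, ?_⟩
  have him := (tendsto_im_cone 0 K).mono_right nhdsWithin_le_nhds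
  filter_upwards [self_mem_nhdsWithin, him.eventually (gt_mem_nhds hA0)] with z hz hzA
  have hb := inversion_bound_aux hK hL hz
  have hone : 1 ≤ (-1 / (L * z) : ℂ).im := ((one_le_div hz.1).2 hzA.le).trans hb
  have hzi := hz.1
  refine (hF K z hz).trans ?_
  rw [mul_left_comm]
  refine mul_le_mul_of_nonneg_left ((hG _ hone).trans ?_) (by positivity)
  refine mul_le_mul_of_nonneg_left (Real.exp_le_exp.2 ?_) hC
  have := mul_le_mul_of_nonneg_left hb Real.pi_pos.le
  rw [neg_div _ (Real.pi * A), mul_div_assoc]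
  linarith

/-! ### Rapid decay of partial theta series at 0 and at rational points. -/

variable {f : ℤ → ℂ}

theorem rapidDecay_partialTheta_zero (hL : 0 < L) (hf : Function.Periodic f (L : ℤ))
    (heven : Function.Even f) (h0 : f 0 = 0) (hsum : ∑ h ∈ Finset.range L, f h = 0) :
    RapidDecay (partialTheta f L) 0 := by
  choose K hK using exists_norm_jacobiTheta₂_sub_one_le
  refine rapidDecay_zero_of_inversion (G := fun τ => 2⁻¹ * (((L : ℝ) ^ (-(1 / 2) : ℝ) : ℝ) : ℂ) *
    ∑ h ∈ Finset.range L, f h * (jacobiTheta₂ ((h / L : ℝ) : ℂ) τ - 1)) hL (1 / 2)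
    (C := 2⁻¹ * (L : ℝ) ^ (-(1 / 2) : ℝ) * ∑ h ∈ Finset.range L, ‖f h‖ * K (h / L)) ?_ ?_
  · intro τ hτ
    rw [norm_mul, norm_mul, Complex.norm_real, Real.norm_of_nonneg (by positivity), norm_inv,
      Complex.norm_ofNat, mul_assoc _ (∑ h ∈ Finset.range L, ‖f h‖ * K (h / L)), Finset.sum_mul]
    refine mul_le_mul_of_nonneg_left ((norm_sum_le _ _).trans (Finset.sum_le_sum fun h _ => ?_))
      (by positivity)
    rw [norm_mul, mul_assoc]
    exact mul_le_mul_of_nonneg_left (hK _ τ hτ) (norm_nonneg _)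
  · intro B w hw
    have hwi := hw.1
    rw [partialTheta_eq_sum hL hf heven h0 hwi]
    have : ∑ h ∈ Finset.range L, f h * residueTheta L h w 0 =
        1 / (-Complex.I * (L * w)) ^ (1 / 2 : ℂ) *
        ∑ h ∈ Finset.range L, f h * (jacobiTheta₂ ((h / L : ℝ) : ℂ) (-1 / (L * w)) - 1) := by
      simp only [mul_sub, mul_one]
      -- The constant terms of the inverted theta values add up to Σ f = 0, so 1 may be subtracted
      -- from each of them.
      rw [Finset.sum_sub_distrib, hsum, sub_zero, Finset.mul_sum]
      refine Finset.sum_congr rfl fun h _ => ?_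
      rw [residueTheta_inversion hL hwi]
      simp
      ring
    rw [this]
    simp only [norm_mul, Complex.norm_real]
    rw [Real.norm_of_nonneg (by positivity)]
    have h1 := norm_inv_sqrt_le hL hw
    calc _ ≤ ‖(2⁻¹ : ℂ)‖ * (((L : ℝ) ^ (-(1 / 2) : ℝ) * w.im ^ (-(1 / 2) : ℝ)) *
          ‖∑ h ∈ Finset.range L, f h * (jacobiTheta₂ ((h / L : ℝ) : ℂ) (-1 / (L * w)) - 1)‖) := by
            gcongr
      _ = _ := by ring

theorem rapidDecay_partialThetaDeriv_zero (hL : 0 < L) (hf : Function.Periodic f (L : ℤ))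
    (hodd : Function.Odd f) : RapidDecay (partialThetaDeriv f L) 0 := by
  choose K hK using exists_norm_jacobiTheta₂'_le
  refine rapidDecay_zero_of_inversion (G := fun τ => (4 * Real.pi * Complex.I)⁻¹ *
    (((L : ℝ) ^ (-(1 / 2) : ℝ) : ℝ) : ℂ) *
    ∑ h ∈ Finset.range L, f h * jacobiTheta₂' ((h / L : ℝ) : ℂ) τ) hL (3 / 2)
    (C := ‖(4 * Real.pi * Complex.I : ℂ)⁻¹‖ * (L : ℝ) ^ (-(1 / 2) : ℝ) *
      ∑ h ∈ Finset.range L, ‖f h‖ * K (h / L)) ?_ ?_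
  · intro τ hτ
    rw [norm_mul, norm_mul, Complex.norm_real, Real.norm_of_nonneg (by positivity),
      mul_assoc _ (∑ h ∈ Finset.range L, ‖f h‖ * K (h / L)), Finset.sum_mul]
    refine mul_le_mul_of_nonneg_left ((norm_sum_le _ _).trans (Finset.sum_le_sum fun h _ => ?_))
      (by positivity)
    rw [norm_mul, mul_assoc]
    exact mul_le_mul_of_nonneg_left (hK _ τ hτ) (norm_nonneg _)
  · intro B w hw
    have hwi := hw.1
    have him : w.im ≤ ‖w‖ := (le_abs_self _).trans (Complex.abs_im_le_norm w)
    rw [partialThetaDeriv_eq_sum hL hf hodd hwi]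
    have : ∑ h ∈ Finset.range L, f h * residueThetaDeriv L h w =
        1 / (-Complex.I * (L * w)) ^ (1 / 2 : ℂ) * w⁻¹ *
        ∑ h ∈ Finset.range L, f h * jacobiTheta₂' ((h / L : ℝ) : ℂ) (-1 / (L * w)) := by
      rw [Finset.mul_sum]
      refine Finset.sum_congr rfl fun h _ => ?_
      rw [residueThetaDeriv_inversion hL hwi]
      push_cast
      ring
    rw [this]
    simp only [norm_mul, Complex.norm_real]
    rw [Real.norm_of_nonneg (by positivity), norm_inv w]
    have h1 := norm_inv_sqrt_le hL hw
    have h2 : ‖w‖⁻¹ ≤ w.im⁻¹ := inv_anti₀ hwi him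
    have h3 : w.im ^ (-(3 / 2) : ℝ) = w.im ^ (-(1 / 2) : ℝ) * w.im⁻¹ := by
      rw [← Real.rpow_neg_one w.im, ← Real.rpow_add hwi]; norm_num
    rw [h3]
    have h4 : ‖1 / (-Complex.I * (L * w)) ^ (1 / 2 : ℂ)‖ * ‖w‖⁻¹ ≤
        ((L : ℝ) ^ (-(1 / 2) : ℝ) * w.im ^ (-(1 / 2) : ℝ)) * w.im⁻¹ := by gcongr
    have h5 := mul_le_mul_of_nonneg_right (mul_le_mul_of_nonneg_left h4
      (norm_nonneg (4 * Real.pi * Complex.I : ℂ)⁻¹)) (norm_nonneg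
      (∑ h ∈ Finset.range L, f h * jacobiTheta₂' ((h / L : ℝ) : ℂ) (-1 / (L * w))))
    simp only [norm_inv, norm_mul, Complex.norm_real] at h5 ⊢
    refine le_trans (le_of_eq ?_) (h5.trans (le_of_eq ?_)) <;> ring

theorem RapidDecay.comp_translate_scale {F G : ℂ → ℂ} {p s : ℝ} (hs : 0 < s)
    (hG : RapidDecay G 0) (h : ∀ w : ℂ, 0 < w.im → F (p + w) = G (s * w)) : RapidDecay F p := by
  intro K N
  have ht : Tendsto (fun z : ℂ => (s : ℂ) * (z - p)) (𝓝[cone p K] (p : ℂ))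
      (𝓝[cone 0 K] ((0 : ℝ) : ℂ)) := by
    refine tendsto_nhdsWithin_iff.2 ⟨?_, ?_⟩
    · have hc : Continuous fun z : ℂ => (s : ℂ) * (z - p) := by fun_prop
      have := (hc.tendsto (p : ℂ)).mono_left (nhdsWithin_le_nhds (s := cone p K))
      simpa using this
    · filter_upwards [self_mem_nhdsWithin] with z hz
      refine ⟨by simpa using mul_pos hs hz.1, ?_⟩
      simp only [Complex.re_ofReal_mul, Complex.im_ofReal_mul, Complex.sub_re, Complex.sub_im,
        Complex.ofReal_re, Complex.ofReal_im, sub_zero, abs_mul, abs_of_pos hs]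
      rw [mul_left_comm]
      exact mul_le_mul_of_nonneg_left hz.2 hs.le
  have h1 := (hG K N).comp_tendsto ht
  have h2 : (fun z : ℂ => (s * z.im) ^ N) =O[𝓝[cone p K] (p : ℂ)] fun z => z.im ^ N := by
    simp only [mul_pow]
    exact Asymptotics.isBigO_const_mul_self _ _ _
  refine (h1.congr' ?_ ?_).trans h2
  · filter_upwards [self_mem_nhdsWithin] with z hz
    have := h (z - p) (by simpa using hz.1)
    rw [add_sub_cancel] at this
    exact this.symm
  · refine Eventually.of_forall fun z => ?_
    simp

/-- For odd `f`, the theta function `Θ_f` decays rapidly at every rational point. -/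
theorem rapidDecay_partialThetaDeriv {M : ℕ} (hM : 0 < M) (hf : Function.Periodic f (M : ℤ))
    (hodd : Function.Odd f) (α : ℚ) : RapidDecay (partialThetaDeriv f M) (α : ℝ) := by
  -- With this period, αn²/(2M) changes by an integer under n ↦ n + L, so moving α to 0 replaces `f`
  -- by L-periodic odd coefficients. The factor L/M below adjusts the exponent n²/2M to n²/2L.
  set L : ℕ := 2 * M * α.den with hLdef
  have hL : 0 < L := by have := α.den_pos; positivity
  have hM0 : (M : ℂ) ≠ 0 := by exact_mod_cast hM.ne'
  have hL0 : (L : ℂ) ≠ 0 := by exact_mod_cast hL.ne'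
  have hd0 : (α.den : ℂ) ≠ 0 := by exact_mod_cast α.den_ne_zero
  have hα : (α : ℂ) = α.num / α.den := by exact_mod_cast (Rat.num_div_den α).symm
  set C : ℤ → ℂ := fun n => f n * Complex.exp (2 * Real.pi * Complex.I * α * (n ^ 2 / (2 * M)))
    with hC
  have hCper : Function.Periodic C (L : ℤ) := by
    intro n
    simp only [hC]
    have h1 : f (n + L) = f n := by
      have := hf.int_mul (2 * α.den) n
      rw [← this]; congr 1
      rw [hLdef]; push_cast; ring
    rw [h1]
    congr 1
    rw [Complex.exp_eq_exp_iff_exists_int]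
    refine ⟨α.num * (2 * n + L), ?_⟩
    rw [hα]
    have : (L : ℂ) = 2 * M * α.den := by rw [hLdef]; push_cast; ring
    push_cast
    rw [this]
    field_simp
    ring
  have hCodd : Function.Odd C := by
    intro n
    simp only [hC]
    rw [hodd]
    push_cast
    rw [neg_sq, neg_mul]
  have hs : (0 : ℝ) < L / M := by positivity
  refine RapidDecay.comp_translate_scale hs (rapidDecay_partialThetaDeriv_zero hL hCper hCodd) ?_
  intro w _
  unfold partialThetaDeriv
  refine tsum_congr fun n => ?_
  simp only [hC]
  rw [mul_assoc (n : ℂ) (f n * _), mul_assoc (f n), ← Complex.exp_add, ← mul_assoc (n : ℂ)]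
  congr 2
  push_cast
  field_simp

/-- The reflection h ↦ M - h pairs the support. Its fixed point M/2 appears once in the full sum,
which accounts for the weight 1/2. -/
theorem sum_range_eq_two_mul_primedSum {M k₀ : ℕ} {𝓜 : Finset ℕ}
    (hf : Function.Periodic f (M : ℤ)) (heven : Function.Even f) (hsub : 𝓜 ⊆ squareClass M k₀)
    (hsupp : IsSupportedOn f M 𝓜) : ∑ h ∈ Finset.range M, f h = 2 * primedSum f M 𝓜 := by
  have h𝓜 : ∀ k ∈ 𝓜, 1 ≤ k ∧ 2 * k ≤ M := fun k hk => by
    have := Finset.mem_Icc.1 (Finset.mem_filter.1 (hsub hk)).1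
    omega
  have hsymm : ∀ k : ℕ, k ≤ M → f ((M - k : ℕ) : ℤ) = f k := fun k hk => by
    rw [Nat.cast_sub hk, sub_eq_add_neg, add_comm, hf, heven]
  have hzero : ∀ h ∈ Finset.range M, h ∉ 𝓜 → M - h ∉ 𝓜 → f h = 0 := by
    intro h hh h1 h2
    have hhM := Finset.mem_range.1 hh
    refine hsupp h fun k hk => ?_
    have hk' := h𝓜 k hk
    constructor
    · intro hcon
      have := Int.eq_zero_of_abs_lt_dvd hcon.dvd (abs_lt.2 ⟨by omega, by omega⟩)
      exact h1 (by rwa [show h = k by omega])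
    · intro hcon
      have hd : (M : ℤ) ∣ h + k - M := by
        have := hcon.symm.dvd
        rw [sub_neg_eq_add] at this
        exact dvd_sub_self_right.2 this
      have := Int.eq_zero_of_abs_lt_dvd hd (abs_lt.2 ⟨by omega, by omega⟩)
      exact h2 (by rwa [show M - h = k by omega])
  set g : ℕ → ℂ := fun k => if 2 * k = M then f k / 2 else f k with hg
  -- Each k contributes at k and at M - k; when these coincide the two halved contributions add up
  -- to f(k).
  have key : ∀ h ∈ Finset.range M, f h = ∑ k ∈ 𝓜,
      ((if h = k then g k else 0) + (if M - h = k then g k else 0)) := by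
    intro h hh
    have hhM := Finset.mem_range.1 hh
    rw [Finset.sum_add_distrib, Finset.sum_ite_eq, Finset.sum_ite_eq]
    have hs := hsymm h hhM.le
    by_cases h1 : h ∈ 𝓜
    · have := h𝓜 h h1
      by_cases h2 : 2 * h = M
      · have h3 : M - h = h := by omega
        rw [h3, if_pos h1]
        simp only [hg, if_pos h2]
        ring
      · have h3 : M - h ∉ 𝓜 := fun h4 => by have := h𝓜 _ h4; omega
        rw [if_pos h1, if_neg h3]
        simp only [hg, if_neg h2, add_zero]
    · by_cases h2 : M - h ∈ 𝓜
      · have h3 : ¬ 2 * (M - h) = M := fun h4 => h1 (by rwa [show h = M - h by omega])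
        rw [if_neg h1, if_pos h2]
        simp only [hg, if_neg h3, zero_add, hs]
      · rw [if_neg h1, if_neg h2, add_zero]
        exact hzero h hh h1 h2
  rw [Finset.sum_congr rfl key, Finset.sum_comm, primedSum, Finset.mul_sum]
  refine Finset.sum_congr rfl fun k hk => ?_
  have hk' := h𝓜 k hk
  rw [Finset.sum_add_distrib, Finset.sum_ite_eq', if_pos (Finset.mem_range.2 (by omega)),
    Finset.sum_eq_single_of_mem (M - k) (Finset.mem_range.2 (by omega))]
  · rw [if_pos (by omega), two_mul]
  · intro h hh hne
    have := Finset.mem_range.1 hh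
    rw [if_neg (by omega)]

end

noncomputable section

open Filter MeasureTheory Set

/-! ### Eichler kernels and their transformation -/

variable {Φ : ℂ → ℂ} {μ : ℝ} {τ : ℂ} {p : ℝ}

/-- The kernel `Φ(w) (w - τ) ^ μ`. -/
def eichlerKernel (Φ : ℂ → ℂ) (μ : ℝ) (τ w : ℂ) : ℂ := Φ w * (w - τ) ^ (μ : ℂ)

theorem im_le_norm_sub (hτ : τ.im ≤ 0) (w : ℂ) : w.im ≤ ‖w - τ‖ := by
  have := (le_abs_self _).trans (Complex.abs_im_le_norm (w - τ))
  rw [Complex.sub_im] at this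
  linarith

theorem norm_sub_cpow_le (hμ : μ ≤ 0) (hτ : τ.im ≤ 0) {w : ℂ} (hw : 0 < w.im) :
    ‖(w - τ) ^ (μ : ℂ)‖ ≤ w.im ^ μ := by
  rw [Complex.norm_cpow_real]
  exact Real.rpow_le_rpow_of_nonpos hw (im_le_norm_sub hτ w) hμ

theorem isCuspidal_eichlerKernel (hΦ : IsCuspidal Φ) (hμ : μ ≤ 0) (hτ : τ.im ≤ 0) :
    IsCuspidal (eichlerKernel Φ μ τ) := by
  obtain ⟨hd, c, hc, hb⟩ := hΦ
  refine ⟨hd.mul fun w hw => ?_, c, hc, fun ε hε => ?_⟩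
  · have hw' : 0 < w.im := hw
    have hs : w - τ ∈ Complex.slitPlane :=
      slitPlane_of_im_ne_zero (by rw [Complex.sub_im]; linarith)
    exact (((differentiableAt_id.sub_const τ).cpow_const hs)).differentiableWithinAt
  · obtain ⟨K, hK⟩ := hb ε hε
    refine ⟨K * ε ^ μ, fun z hz => ?_⟩
    rw [eichlerKernel, norm_mul]
    have h1 : ‖(z - τ) ^ (μ : ℂ)‖ ≤ ε ^ μ := (norm_sub_cpow_le hμ hτ (hε.trans_le hz)).trans
      (Real.rpow_le_rpow_of_nonpos hε hz hμ)
    calc _ ≤ (K * Real.exp (-c * z.im)) * ε ^ μ :=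
          mul_le_mul (hK z hz) h1 (norm_nonneg _) ((norm_nonneg _).trans (hK z hz))
      _ = _ := by ring

theorem rapidDecay_eichlerKernel (hp : RapidDecay Φ p) (hμ : μ ≤ 0) (hτ : τ.im ≤ 0) :
    RapidDecay (eichlerKernel Φ μ τ) p := by
  intro K N
  obtain ⟨n, hn⟩ := exists_nat_ge (-μ)
  refine ((hp K (N + n)).mul (g₂ := fun z => z.im ^ μ) (Asymptotics.IsBigO.of_bound 1 ?_)).trans
    (Asymptotics.IsBigO.of_bound 1 ?_)
  · filter_upwards [self_mem_nhdsWithin] with z hz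
    have hzi : 0 < z.im := hz.1
    rw [one_mul, Real.norm_of_nonneg (Real.rpow_nonneg hzi.le _)]
    exact norm_sub_cpow_le hμ hτ hzi
  · have him := (tendsto_im_cone p K).mono_right nhdsWithin_le_nhds
    filter_upwards [self_mem_nhdsWithin, him.eventually (gt_mem_nhds one_pos)] with z hz hz1
    have hzi : 0 < z.im := hz.1
    rw [one_mul, Real.norm_of_nonneg (by positivity), Real.norm_of_nonneg (by positivity), pow_add,
      mul_assoc]
    refine mul_le_of_le_one_right (by positivity) ?_
    rw [← Real.rpow_natCast z.im n, ← Real.rpow_add hzi]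
    exact Real.rpow_le_one hzi.le hz1.le (by linarith)

/-- The square root of `c τ + d` which is continuous on the closed lower half-plane. -/
theorem autFactor_half_zpow (γ : SL(2, ℤ)) (τ : ℂ) (j : ℤ) :
    autFactor (j / 2) γ τ = autFactor (1 / 2) γ τ ^ j := by
  have h (z : ℂ) : z ^ (((j / 2 : ℝ)) : ℂ) = (z ^ (((1 / 2 : ℝ)) : ℂ)) ^ j := by
    rw [← Complex.cpow_int_mul]
    push_cast
    congr 1
    ring
  unfold autFactor
  split_ifs
  · rw [h, map_zpow₀]
  · rw [h]

theorem cpow_half_int (z : ℂ) (j : ℤ) : z ^ (((j / 2 : ℝ)) : ℂ) = (z ^ (1 / 2 : ℂ)) ^ j := by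
  rw [← Complex.cpow_int_mul]
  push_cast
  congr 1
  ring

theorem autFactor_half_sq (γ : SL(2, ℤ)) (τ : ℂ) :
    autFactor (1 / 2) γ τ ^ 2 = γ 1 0 * τ + γ 1 1 := by
  unfold autFactor
  push_cast
  split_ifs
  · rw [← map_pow, cpow_half_sq]; simp
  · rw [cpow_half_sq]

theorem re_cpow_half_nonneg (z : ℂ) : 0 ≤ (z ^ (1 / 2 : ℂ)).re := by
  rcases eq_or_ne z 0 with rfl | hz
  · simp
  rw [cpow_half_eq z hz]
  have h2 := Complex.arg_le_pi z
  have h3 := Complex.neg_pi_lt_arg z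
  have : 0 ≤ Real.cos (z.arg / 2) := Real.cos_nonneg_of_mem_Icc ⟨by linarith, by linarith⟩
  rw [Complex.re_ofReal_mul, Complex.add_re, Complex.re_ofReal_mul, Complex.I_re, mul_zero,
    add_zero, Complex.ofReal_re]
  positivity

theorem im_cpow_half_nonneg {z : ℂ} (hz : 0 ≤ z.im) : 0 ≤ (z ^ (1 / 2 : ℂ)).im := by
  rcases eq_or_ne z 0 with rfl | h0
  · simp
  rw [cpow_half_eq z h0]
  have h1 := Complex.arg_nonneg_iff.2 hz
  have h2 := Complex.arg_le_pi z
  have : 0 ≤ Real.sin (z.arg / 2) := Real.sin_nonneg_of_nonneg_of_le_pi (by linarith) (by linarith)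
  rw [Complex.im_ofReal_mul, Complex.add_im, Complex.im_ofReal_mul, Complex.I_im, mul_one,
    Complex.ofReal_im, zero_add]
  positivity

/-- The root at z lies in an open quadrant of the right half-plane, and the root at τ, taken as a
limit from below, lies in the closed conjugate quadrant. Hence the argument of the product is less
than π/2 in modulus, even for real τ. -/
theorem re_autFactor_half_mul_pos {γ : SL(2, ℤ)} (hc : γ 1 0 ≠ 0) (hτ : τ.im ≤ 0)
    (he : (γ 1 0 * τ + γ 1 1 : ℂ) ≠ 0) {z : ℂ} (hz : 0 < z.im) :
    0 < (autFactor (1 / 2) γ τ * (γ 1 0 * z + γ 1 1 : ℂ) ^ (1 / 2 : ℂ)).re := by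
  set A := autFactor (1 / 2) γ τ with hA
  have hA0 : A ≠ 0 := by
    intro h
    have := autFactor_half_sq γ τ
    rw [← hA, h] at this
    exact he (by rw [← this]; simp)
  have hj : (γ 1 0 * z + γ 1 1 : ℂ).im = γ 1 0 * z.im := by simp
  have hjim : (γ 1 0 * z + γ 1 1 : ℂ).im ≠ 0 := by
    rw [hj]; exact mul_ne_zero (by exact_mod_cast hc) hz.ne'
  have hsre := re_cpow_half_pos (slitPlane_of_im_ne_zero hjim)
  have hAim : A.re ≠ 0 ∨ A.im ≠ 0 := by
    by_contra! h; exact hA0 (Complex.ext h.1 h.2)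
  rw [Complex.mul_re]
  rcases lt_or_gt_of_ne hc with h | h
  · have hcR : (γ 1 0 : ℝ) < 0 := by exact_mod_cast h
    have hsim := im_cpow_half_neg (z := (γ 1 0 * z + γ 1 1 : ℂ)) (by rw [hj]; nlinarith)
    have hAe : A = (γ 1 0 * τ + γ 1 1 : ℂ) ^ (1 / 2 : ℂ) := by
      rw [hA, autFactor, if_neg (by omega)]; push_cast; rfl
    have a1 : 0 ≤ A.re := by rw [hAe]; exact re_cpow_half_nonneg _
    have a2 : 0 ≤ A.im := by
      rw [hAe]
      refine im_cpow_half_nonneg ?_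
      simp
      nlinarith
    rcases hAim with h' | h'
    · have := mul_pos (lt_of_le_of_ne a1 h'.symm) hsre
      nlinarith
    · have := mul_neg_of_pos_of_neg (lt_of_le_of_ne a2 h'.symm) hsim
      nlinarith
  · have hcR : (0 : ℝ) < γ 1 0 := by exact_mod_cast h
    have hsim := im_cpow_half_pos (z := (γ 1 0 * z + γ 1 1 : ℂ)) (by rw [hj]; nlinarith)
    have hAe : A = conj ((γ 1 0 * conj τ + γ 1 1 : ℂ) ^ (1 / 2 : ℂ)) := by
      rw [hA, autFactor, if_pos (by omega)]; push_cast; rfl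
    have a1 : 0 ≤ A.re := by rw [hAe, Complex.conj_re]; exact re_cpow_half_nonneg _
    have a2 : A.im ≤ 0 := by
      rw [hAe, Complex.conj_im, neg_nonpos]
      refine im_cpow_half_nonneg ?_
      simp
      nlinarith
    rcases hAim with h' | h'
    · have := mul_pos (lt_of_le_of_ne a1 h'.symm) hsre
      nlinarith
    · have := mul_neg_of_neg_of_pos (lt_of_le_of_ne a2 h') hsim
      nlinarith

/-- Squares agree by the difference formula for Möbius maps. The roots of z - τ and γz - γτ are both
in the open first quadrant, so their quotient has positive real part, as does the automorphy
product: the sign is plus. -/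
theorem cpow_half_moebius_sub {γ : SL(2, ℤ)} (hc : γ 1 0 ≠ 0) (hτ : τ.im ≤ 0)
    (he : (γ 1 0 * τ + γ 1 1 : ℂ) ≠ 0) {z : ℂ} (hz : 0 < z.im) :
    (moebius γ z - moebius γ τ) ^ (1 / 2 : ℂ) *
      (autFactor (1 / 2) γ τ * (γ 1 0 * z + γ 1 1 : ℂ) ^ (1 / 2 : ℂ)) = (z - τ) ^ (1 / 2 : ℂ) := by
  have hP := re_autFactor_half_mul_pos hc hτ he hz
  set P := autFactor (1 / 2) γ τ * (γ 1 0 * z + γ 1 1 : ℂ) ^ (1 / 2 : ℂ) with hPdef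
  have hj := denom_ne_zero γ hz.ne'
  have hP2 : P ^ 2 = (γ 1 0 * τ + γ 1 1) * (γ 1 0 * z + γ 1 1) := by
    rw [hPdef, mul_pow, autFactor_half_sq, cpow_half_sq]
  have hXim : 0 < (z - τ).im := by rw [Complex.sub_im]; linarith
  have hYim : 0 < (moebius γ z - moebius γ τ).im := by
    rw [Complex.sub_im]
    have h1 := moebius_im_pos γ hz
    have h2 : (moebius γ τ).im ≤ 0 := by
      rw [im_moebius']
      exact div_nonpos_of_nonpos_of_nonneg hτ (Complex.normSq_nonneg _)
    linarith
  have hsq : ((moebius γ z - moebius γ τ) ^ (1 / 2 : ℂ) * P) ^ 2 = ((z - τ) ^ (1 / 2 : ℂ)) ^ 2 := by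
    rw [mul_pow, cpow_half_sq, cpow_half_sq, hP2, moebius_sub_moebius γ hj he, mul_comm (γ 1 0 * τ + γ 1 1 : ℂ),
      div_mul_cancel₀ _ (mul_ne_zero hj he)]
  rcases sq_eq_sq_iff_eq_or_eq_neg.1 hsq with h | h
  · exact h
  exfalso
  have x1 := re_cpow_half_pos (slitPlane_of_im_ne_zero hXim.ne')
  have x2 := im_cpow_half_pos hXim
  have y1 := re_cpow_half_pos (slitPlane_of_im_ne_zero hYim.ne')
  have y2 := im_cpow_half_pos hYim
  set y := (moebius γ z - moebius γ τ) ^ (1 / 2 : ℂ)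
  set x := (z - τ) ^ (1 / 2 : ℂ)
  have h1 := congrArg Complex.re h
  have h2 := congrArg Complex.im h
  rw [Complex.neg_re, Complex.mul_re] at h1
  rw [Complex.neg_im, Complex.mul_im] at h2
  have h3 : (y.re ^ 2 + y.im ^ 2) * P.re = -(x.re * y.re + x.im * y.im) := by
    linear_combination y.re * h1 + y.im * h2
  have h4 : 0 < (y.re ^ 2 + y.im ^ 2) * P.re := by positivity
  have h5 : 0 < x.re * y.re + x.im * y.im := by positivity
  linarith

theorem moebius_im_nonpos (γ : SL(2, ℤ)) (hτ : τ.im ≤ 0) : (moebius γ τ).im ≤ 0 := by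
  rw [im_moebius']
  exact div_nonpos_of_nonpos_of_nonneg hτ (Complex.normSq_nonneg _)

theorem hasDerivAt_moebius (γ : SL(2, ℤ)) {z : ℂ} (hz : (γ 1 0 * z + γ 1 1 : ℂ) ≠ 0) :
    HasDerivAt (moebius γ) (1 / (γ 1 0 * z + γ 1 1) ^ 2) z := by
  have hdet : (γ 0 0 * γ 1 1 - γ 0 1 * γ 1 0 : ℂ) = 1 := by exact_mod_cast det_eq γ
  have h1 : HasDerivAt (fun z : ℂ => (γ 0 0 * z + γ 0 1 : ℂ)) (γ 0 0) z := by
    simpa using ((hasDerivAt_id z).const_mul (γ 0 0 : ℂ)).add_const (γ 0 1 : ℂ)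
  have h2 : HasDerivAt (fun z : ℂ => (γ 1 0 * z + γ 1 1 : ℂ)) (γ 1 0) z := by
    simpa using ((hasDerivAt_id z).const_mul (γ 1 0 : ℂ)).add_const (γ 1 1 : ℂ)
  refine (h1.div h2 hz).congr_deriv ?_
  congr 1
  linear_combination hdet

variable {m : ℕ} {v v' : ℂ} {γ : SL(2, ℤ)}

/-- The exponent (m - 4)/2 is chosen so that the powers of cz + d leave exactly its square, which
d(γz) cancels. -/
theorem eichlerKernel_moebius (ht : TransformsUnder Φ m v γ) (hc : γ 1 0 ≠ 0) (hτ : τ.im ≤ 0)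
    (he : (γ 1 0 * τ + γ 1 1 : ℂ) ≠ 0) {z : ℂ} (hz : 0 < z.im) :
    eichlerKernel Φ (((m - 4 : ℤ) : ℝ) / 2) (moebius γ τ) (moebius γ z) =
      v * autFactor (1 / 2) γ τ ^ (4 - m : ℤ) * (γ 1 0 * z + γ 1 1) ^ 2 *
        eichlerKernel Φ (((m - 4 : ℤ) : ℝ) / 2) τ z := by
  have key := cpow_half_moebius_sub hc hτ he hz
  have hj := denom_ne_zero γ hz.ne'
  set s := (γ 1 0 * z + γ 1 1 : ℂ) ^ (1 / 2 : ℂ) with hs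
  set A := autFactor (1 / 2) γ τ with hA
  have hs2 : s ^ 2 = γ 1 0 * z + γ 1 1 := cpow_half_sq _
  have hs0 : s ≠ 0 := by
    intro h; rw [h] at hs2; exact hj (by rw [← hs2]; simp)
  have hA0 : A ≠ 0 := by
    intro h
    have := autFactor_half_sq γ τ
    rw [← hA, h] at this
    exact he (by rw [← this]; simp)
  unfold eichlerKernel
  rw [cpow_half_int, cpow_half_int, ht z hz, ← key, mul_zpow, mul_zpow, ← hs, ← hs2]
  have h1 : A ^ (4 - m : ℤ) * A ^ (m - 4 : ℤ) = 1 := by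
    rw [← zpow_add₀ hA0]; simp
  have h2 : s ^ m = (s ^ 2) ^ 2 * s ^ (m - 4 : ℤ) := by
    rw [← pow_mul, ← zpow_natCast, ← zpow_natCast, ← zpow_add₀ hs0]
    congr 1
    push_cast
    ring
  rw [h2]
  linear_combination (-(v * (s ^ 2) ^ 2 * s ^ (m - 4 : ℤ) * Φ z *
    ((moebius γ z - moebius γ τ) ^ (1 / 2 : ℂ)) ^ (m - 4 : ℤ))) * h1

theorem weight_nonpos (hm : m ≤ 4) : ((m - 4 : ℤ) : ℝ) / 2 ≤ 0 := by
  have : (m : ℝ) ≤ 4 := by exact_mod_cast hm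
  push_cast
  linarith

theorem rapidDecay_cuspPoint (hΦ : IsCuspidal Φ) (ht' : TransformsUnder Φ m v' γ⁻¹)
    (hc : γ 1 0 ≠ 0) : RapidDecay Φ (cuspPoint γ) := by
  have := hΦ.rapidDecay_of_transformsUnder ht' (by rw [(inv_entries γ).2.2.1]; exact neg_ne_zero.2 hc)
  rw [(inv_entries γ).2.2.1, (inv_entries γ).1] at this
  rw [cuspPoint, neg_div, ← div_neg]
  push_cast at this
  exact this

/-- As functions of z the two Eichler integrals are, up to the factor `B`, primitives of the same
form, so `Q` is constant on the half-plane. Its value is found as z descends to γ⁻¹(i∞): then γz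
tends to i∞ and only the integral from the cusp survives. -/
theorem verticalIntegral_moebius_of_ne_zero (hm : m ≤ 4) (hΦ : IsCuspidal Φ)
    (ht : TransformsUnder Φ m v γ) (ht' : TransformsUnder Φ m v' γ⁻¹) (hc : γ 1 0 ≠ 0)
    (hτ : τ.im ≤ 0) (he : (γ 1 0 * τ + γ 1 1 : ℂ) ≠ 0) {z : ℂ} (hz : 0 < z.im) :
    verticalIntegral (eichlerKernel Φ (((m - 4 : ℤ) : ℝ) / 2) (moebius γ τ)) (moebius γ z) =
      v * autFactor (1 / 2) γ τ ^ (4 - m : ℤ) *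
        (verticalIntegral (eichlerKernel Φ (((m - 4 : ℤ) : ℝ) / 2) τ) z -
          verticalIntegral (eichlerKernel Φ (((m - 4 : ℤ) : ℝ) / 2) τ) (cuspPoint γ)) := by
  set μ : ℝ := ((m - 4 : ℤ) : ℝ) / 2 with hμ
  have hμ0 : μ ≤ 0 := weight_nonpos hm
  set B : ℂ := v * autFactor (1 / 2) γ τ ^ (4 - m : ℤ) with hB
  have hcusp := isCuspidal_eichlerKernel hΦ hμ0 hτ
  have hcusp' := isCuspidal_eichlerKernel hΦ hμ0 (moebius_im_nonpos γ hτ)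
  set Q : ℂ → ℂ := fun z => verticalIntegral (eichlerKernel Φ μ (moebius γ τ)) (moebius γ z) -
    B * verticalIntegral (eichlerKernel Φ μ τ) z with hQ
  have hderiv : ∀ w ∈ {w : ℂ | 0 < w.im}, HasDerivWithinAt Q 0 {w : ℂ | 0 < w.im} w := by
    intro w hw
    have hw' : 0 < w.im := hw
    have hj := denom_ne_zero γ hw'.ne'
    have h1 := (hcusp'.hasDerivAt_verticalIntegral (moebius_im_pos γ hw')).comp w
      (hasDerivAt_moebius γ hj)
    have h2 := (hcusp.hasDerivAt_verticalIntegral hw').const_mul B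
    refine ((h1.sub h2).congr_deriv ?_).hasDerivWithinAt
    rw [eichlerKernel_moebius ht hc hτ he hw', ← hB]
    field_simp
    ring
  have hconst : ∀ w : ℂ, 0 < w.im → Q w = Q z := by
    intro w hw
    have hconv : Convex ℝ {w : ℂ | 0 < w.im} := convex_halfSpace_im_gt 0
    have := hconv.norm_image_sub_le_of_norm_hasDerivWithin_le (C := 0) hderiv
      (fun _ _ => by simp) hz hw
    rw [zero_mul, norm_le_zero_iff, sub_eq_zero] at this
    exact this
  have hrd := rapidDecay_eichlerKernel (rapidDecay_cuspPoint hΦ ht' hc) hμ0 hτ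
  have hlim2 := (hcusp.tendsto_verticalIntegral_vertical hrd).const_mul B
  have hcR : (γ 1 0 : ℝ) ≠ 0 := by exact_mod_cast hc
  have himv : ∀ y : ℝ, 0 < y → (moebius γ (cuspPoint γ + y * Complex.I)).im =
      ((γ 1 0 : ℝ) ^ 2)⁻¹ * y⁻¹ := by
    intro y hy
    have : (γ 1 0 * ((cuspPoint γ : ℂ) + y * Complex.I) + γ 1 1 : ℂ) =
        ((γ 1 0 * y : ℝ) : ℂ) * Complex.I := by
      rw [cuspPoint]; push_cast
      have : (γ 1 0 : ℂ) ≠ 0 := by exact_mod_cast hc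
      field_simp
      ring
    rw [im_moebius', this, map_mul, Complex.normSq_ofReal, Complex.normSq_I]
    simp
    field_simp
  have hlim1 : Tendsto (fun y : ℝ => verticalIntegral (eichlerKernel Φ μ (moebius γ τ))
      (moebius γ (cuspPoint γ + y * Complex.I))) (𝓝[>] (0 : ℝ)) (𝓝 0) := by
    obtain ⟨K, c, hc0, hb⟩ := hcusp'.norm_verticalIntegral_le one_pos
    have htop : Tendsto (fun y : ℝ => ((γ 1 0 : ℝ) ^ 2)⁻¹ * y⁻¹) (𝓝[>] (0 : ℝ)) atTop :=
      tendsto_inv_nhdsGT_zero.const_mul_atTop (by positivity)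
    refine squeeze_zero_norm' (a := fun y : ℝ =>
      K * Real.exp (-c * (((γ 1 0 : ℝ) ^ 2)⁻¹ * y⁻¹))) ?_ ?_
    · filter_upwards [self_mem_nhdsWithin, htop.eventually (eventually_ge_atTop 1)] with y hy hy1
      have := hb (moebius γ (cuspPoint γ + y * Complex.I)) (by rw [himv y hy]; exact hy1)
      rwa [himv y hy] at this
    · have h1 : Tendsto (fun x : ℝ => Real.exp (-c * x)) atTop (𝓝 0) :=
        Real.tendsto_exp_atBot.comp (tendsto_id.const_mul_atTop_of_neg (by linarith))
      simpa using (h1.comp htop).const_mul K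
  have hlim := hlim1.sub hlim2
  have hev : Tendsto (fun y : ℝ => Q (cuspPoint γ + y * Complex.I)) (𝓝[>] (0 : ℝ)) (𝓝 (Q z)) := by
    refine tendsto_const_nhds.congr' ?_
    filter_upwards [self_mem_nhdsWithin] with y hy
    exact (hconst _ (by simpa using hy)).symm
  have huniq := tendsto_nhds_unique hev hlim
  simp only [hQ] at huniq
  linear_combination huniq

/-- The integral of the Eichler kernel from `γ⁻¹(i∞)` to `i∞`. -/
def kernelPeriod (Φ : ℂ → ℂ) (μ : ℝ) (γ : SL(2, ℤ)) (τ : ℂ) : ℂ :=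
  if γ 1 0 = 0 then 0 else verticalIntegral (eichlerKernel Φ μ τ) (cuspPoint γ)

theorem verticalIntegral_translate (ht : TransformsUnder Φ m v γ) (hc : γ 1 0 = 0)
    (ha : γ 0 0 = 1) (hd : γ 1 1 = 1) (τ : ℂ) {z : ℂ} (hz : 0 ≤ z.im) :
    verticalIntegral (eichlerKernel Φ μ (moebius γ τ)) (moebius γ z) =
      v * verticalIntegral (eichlerKernel Φ μ τ) z := by
  have hmo : ∀ w : ℂ, moebius γ w = w + γ 0 1 := by
    intro w; simp [moebius, hc, ha, hd]
  unfold verticalIntegral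
  rw [← integral_const_mul]
  refine setIntegral_congr_fun measurableSet_Ioi fun s hs => ?_
  have him : 0 < (z + s * Complex.I).im := by
    rw [im_add_mul_I]; exact add_pos_of_nonneg_of_pos hz hs
  have := ht _ him
  rw [hmo, hc, hd] at this
  simp only [eichlerKernel, hmo]
  rw [show z + γ 0 1 + s * Complex.I = z + s * Complex.I + γ 0 1 by ring, this]
  simp
  ring

theorem autFactor_of_translate (hc : γ 1 0 = 0) (hd : γ 1 1 = 1) (k : ℝ) (τ : ℂ) :
    autFactor k γ τ = 1 := by
  simp [autFactor, hc, hd]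

/-- The transformation law of the non-holomorphic Eichler integral. -/
theorem verticalIntegral_moebius (hm : m ≤ 4) (hΦ : IsCuspidal Φ)
    (ht : TransformsUnder Φ m v γ) (ht' : TransformsUnder Φ m v' γ⁻¹)
    (h0 : γ 1 0 = 0 → γ 0 0 = 1 ∧ γ 1 1 = 1) (hτ : τ.im ≤ 0)
    (he : (γ 1 0 * τ + γ 1 1 : ℂ) ≠ 0) {z : ℂ} (hz : 0 < z.im) :
    verticalIntegral (eichlerKernel Φ (((m - 4 : ℤ) : ℝ) / 2) (moebius γ τ)) (moebius γ z) =
      v * autFactor (1 / 2) γ τ ^ (4 - m : ℤ) *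
        (verticalIntegral (eichlerKernel Φ (((m - 4 : ℤ) : ℝ) / 2) τ) z -
          kernelPeriod Φ (((m - 4 : ℤ) : ℝ) / 2) γ τ) := by
  unfold kernelPeriod
  split_ifs with hc
  · rw [verticalIntegral_translate ht hc (h0 hc).1 (h0 hc).2 τ hz.le,
      autFactor_of_translate hc (h0 hc).2]
    simp
  · exact verticalIntegral_moebius_of_ne_zero hm hΦ ht ht' hc hτ he hz

/-- The transformation law of the Eichler integral at real points where `Φ` decays rapidly. -/
theorem verticalIntegral_moebiusReal (hm : m ≤ 4) (hΦ : IsCuspidal Φ)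
    (ht : TransformsUnder Φ m v γ) (ht' : TransformsUnder Φ m v' γ⁻¹)
    (h0 : γ 1 0 = 0 → γ 0 0 = 1 ∧ γ 1 1 = 1) (hp : RapidDecay Φ p)
    (he : (γ 1 0 : ℝ) * p + (γ 1 1 : ℝ) ≠ 0) :
    verticalIntegral (eichlerKernel Φ (((m - 4 : ℤ) : ℝ) / 2) (moebius γ p)) (moebius γ p) =
      v * autFactor (1 / 2) γ p ^ (4 - m : ℤ) *
        (verticalIntegral (eichlerKernel Φ (((m - 4 : ℤ) : ℝ) / 2) p) p -
          kernelPeriod Φ (((m - 4 : ℤ) : ℝ) / 2) γ p) := by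
  set μ : ℝ := ((m - 4 : ℤ) : ℝ) / 2 with hμ
  have hμ0 : μ ≤ 0 := weight_nonpos hm
  have heC : (γ 1 0 * (p : ℂ) + γ 1 1 : ℂ) ≠ 0 := by exact_mod_cast he
  have him : ((p : ℂ)).im ≤ 0 := by simp
  have hcusp := isCuspidal_eichlerKernel hΦ hμ0 him
  have hcusp' := isCuspidal_eichlerKernel hΦ hμ0 (moebius_im_nonpos γ him)
  have h1 := hcusp.tendsto_verticalIntegral_vertical (rapidDecay_eichlerKernel hp hμ0 him)
  -- A vertical approach to p becomes an approach to γp inside a cone of aperture 0 + 1; this is why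
  -- limits in cones, not just vertical ones, are needed.
  have h2 := hcusp'.tendsto_verticalIntegral (K := 0 + 1)
    (rapidDecay_eichlerKernel (hp.moebius ht he) hμ0 (moebius_im_nonpos γ him)) (by norm_num)
  have h3 := (h2.comp (tendsto_moebius_cone γ p he 0)).comp (tendsto_vertical_cone p le_rfl)
  have h4 := (h1.sub_const (kernelPeriod Φ μ γ p)).const_mul
    (v * autFactor (1 / 2) γ p ^ (4 - m : ℤ))
  rw [ofReal_moebiusReal] at h3
  refine tendsto_nhds_unique h3 (h4.congr' ?_)
  filter_upwards [self_mem_nhdsWithin] with y hy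
  exact (verticalIntegral_moebius hm hΦ ht ht' h0 him heC (by simpa using hy)).symm

end

noncomputable section

open Filter MeasureTheory Set

/-! ### Smoothness of the period functions -/

variable {g : ℝ → ℂ} {p ν : ℝ}

/-- `∫ g(s) (p + i s - τ) ^ ν ds` over the positive half-line. -/
def kernelIntegral (g : ℝ → ℂ) (p ν : ℝ) (τ : ℂ) : ℂ :=
  ∫ s in Ioi (0 : ℝ), g s * (p + s * Complex.I - τ) ^ (ν : ℂ)

/-- The closed lower half-plane. -/
def closedLower : Set ℂ := {τ : ℂ | τ.im ≤ 0}

theorem convex_closedLower : Convex ℝ closedLower := convex_halfSpace_im_le 0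

theorem uniqueDiffOn_closedLower : UniqueDiffOn ℂ closedLower := by
  refine uniqueDiffOn_convex_of_isRCLikeNormedField convex_closedLower ⟨-Complex.I, ?_⟩
  refine mem_interior.2 ⟨{τ : ℂ | τ.im < 0}, fun τ (hτ : τ.im < 0) => hτ.le,
    isOpen_lt Complex.continuous_im continuous_const, by simp⟩

theorem im_kernel (p s : ℝ) (τ : ℂ) : (p + s * Complex.I - τ).im = s - τ.im := by simp

theorem kernel_mem_slitPlane {s : ℝ} (hs : 0 < s) {τ : ℂ} (hτ : τ ∈ closedLower) :
    (p + s * Complex.I - τ) ∈ Complex.slitPlane := by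
  refine slitPlane_of_im_ne_zero ?_
  have : τ.im ≤ 0 := hτ
  rw [im_kernel]
  linarith

theorem norm_kernel_cpow_le (hν : ν ≤ 0) {s : ℝ} (hs : 0 < s) {τ : ℂ} (hτ : τ ∈ closedLower) :
    ‖(p + s * Complex.I - τ) ^ (ν : ℂ)‖ ≤ s ^ ν := by
  have := norm_sub_cpow_le (τ := τ) (w := p + s * Complex.I) hν hτ (by simpa using hs)
  simpa using this

theorem continuousOn_kernel_cpow (ν : ℝ) {τ : ℂ} (hτ : τ ∈ closedLower) :
    ContinuousOn (fun s : ℝ => (p + s * Complex.I - τ) ^ (ν : ℂ)) (Ioi 0) := by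
  intro s hs
  refine ContinuousAt.continuousWithinAt ?_
  exact ContinuousAt.cpow (by fun_prop) continuousAt_const (kernel_mem_slitPlane hs hτ)

theorem IsFlat.integrableOn_norm (hg : IsFlat g) (r : ℝ) :
    IntegrableOn (fun s : ℝ => s ^ r * ‖g s‖) (Ioi 0) := by
  have h : IntegrableOn (fun s : ℝ => ‖((s ^ r : ℝ) : ℂ) * g s‖) (Ioi 0) := (hg.integrable r).norm
  refine h.congr_fun (fun s hs => ?_) measurableSet_Ioi
  have hs' : 0 < s := hs
  simp only [norm_mul, Complex.norm_real]
  rw [Real.norm_of_nonneg (by positivity)]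

theorem IsFlat.integrableOn_kernel (hg : IsFlat g) (hν : ν ≤ 0) {τ : ℂ} (hτ : τ ∈ closedLower) :
    IntegrableOn (fun s : ℝ => g s * (p + s * Complex.I - τ) ^ (ν : ℂ)) (Ioi 0) := by
  refine Integrable.mono' (hg.integrableOn_norm ν) ?_ ?_
  · exact (hg.continuousOn.mul (continuousOn_kernel_cpow ν hτ)).aestronglyMeasurable
      measurableSet_Ioi
  · refine (ae_restrict_iff' measurableSet_Ioi).2 (ae_of_all _ fun s hs => ?_)
    rw [norm_mul, mul_comm]
    exact mul_le_mul_of_nonneg_right (norm_kernel_cpow_le hν hs hτ) (norm_nonneg _)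

theorem hasDerivAt_kernel_cpow (ν : ℝ) {s : ℝ} (hs : 0 < s) {τ : ℂ} (hτ : τ ∈ closedLower) :
    HasDerivAt (fun τ : ℂ => (p + s * Complex.I - τ) ^ (ν : ℂ))
      (-ν * (p + s * Complex.I - τ) ^ ((ν - 1 : ℝ) : ℂ)) τ := by
  have h1 : HasDerivAt (fun τ : ℂ => p + s * Complex.I - τ) (-1) τ :=
    (hasDerivAt_id τ).const_sub _
  refine (h1.cpow_const (kernel_mem_slitPlane hs hτ)).congr_deriv ?_
  push_cast
  ring

/-- By the mean value inequality on the convex closed half-plane, difference quotients are dominated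
by |ν| s^{ν-1}|g(s)|, which is integrable because g is flat. This works on the boundary too,
including τ = p. -/
theorem IsFlat.hasDerivWithinAt_kernelIntegral (hg : IsFlat g) (hν : ν ≤ 0) {τ : ℂ}
    (hτ : τ ∈ closedLower) :
    HasDerivWithinAt (kernelIntegral g p ν) (-ν * kernelIntegral g p (ν - 1) τ) closedLower τ := by
  rw [hasDerivWithinAt_iff_tendsto_slope, kernelIntegral, ← integral_const_mul]
  have hlim := tendsto_integral_filter_of_dominated_convergence (μ := volume.restrict (Ioi 0))
    (l := 𝓝[closedLower \ {τ}] τ)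
    (F := fun (σ : ℂ) (s : ℝ) => slope (fun τ : ℂ => g s * (p + s * Complex.I - τ) ^ (ν : ℂ)) τ σ)
    (f := fun s => -ν * (g s * (p + s * Complex.I - τ) ^ ((ν - 1 : ℝ) : ℂ)))
    (fun s => |ν| * (s ^ (ν - 1) * ‖g s‖)) ?_ ?_ ((hg.integrableOn_norm (ν - 1)).const_mul _) ?_
  · refine hlim.congr' ?_
    filter_upwards [self_mem_nhdsWithin] with σ hσ
    simp only [slope, vsub_eq_sub, smul_eq_mul, kernelIntegral]
    rw [integral_const_mul, integral_sub (hg.integrableOn_kernel hν hσ.1)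
      (hg.integrableOn_kernel hν hτ)]
  · filter_upwards [self_mem_nhdsWithin] with σ hσ
    simp only [slope, vsub_eq_sub, smul_eq_mul]
    exact (((hg.integrableOn_kernel hν hσ.1).sub
      (hg.integrableOn_kernel hν hτ)).const_mul _).aestronglyMeasurable
  · filter_upwards [self_mem_nhdsWithin] with σ hσ
    refine (ae_restrict_iff' measurableSet_Ioi).2 (ae_of_all _ fun s hs => ?_)
    have hs' : 0 < s := hs
    have h1 := convex_closedLower.norm_image_sub_le_of_norm_hasDerivWithin_le
      (C := |ν| * s ^ (ν - 1)) (f := fun τ : ℂ => (p + s * Complex.I - τ) ^ (ν : ℂ))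
      (fun x hx => (hasDerivAt_kernel_cpow (p := p) ν hs hx).hasDerivWithinAt)
      (fun x hx => by
        rw [norm_mul, norm_neg, Complex.norm_real, Real.norm_eq_abs]
        exact mul_le_mul_of_nonneg_left (norm_kernel_cpow_le (by linarith) hs hx) (abs_nonneg _))
      hτ hσ.1
    have h2 : σ - τ ≠ 0 := sub_ne_zero.2 hσ.2
    have h3 : 0 < ‖σ - τ‖ := norm_pos_iff.2 h2
    simp only [slope, vsub_eq_sub, smul_eq_mul]
    rw [← mul_sub, norm_mul, norm_mul, norm_inv, inv_mul_le_iff₀ h3]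
    calc _ ≤ ‖g s‖ * (|ν| * s ^ (ν - 1) * ‖σ - τ‖) := mul_le_mul_of_nonneg_left h1 (norm_nonneg _)
      _ = _ := by ring
  · refine (ae_restrict_iff' measurableSet_Ioi).2 (ae_of_all _ fun s hs => ?_)
    have h1 := ((hasDerivAt_kernel_cpow (p := p) ν hs hτ).const_mul (g s)).hasDerivWithinAt
      (s := closedLower)
    rw [hasDerivWithinAt_iff_tendsto_slope] at h1
    rwa [mul_left_comm] at h1

/-- Each derivative is a kernel integral with exponent lowered by 1, and flatness tolerates any
exponent. -/
theorem IsFlat.contDiffOn_kernelIntegral (hg : IsFlat g) (p : ℝ) (n : ℕ) :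
    ∀ ν : ℝ, ν ≤ 0 → ContDiffOn ℂ n (kernelIntegral g p ν) closedLower := by
  induction n with
  | zero =>
    intro ν hν
    rw [Nat.cast_zero, contDiffOn_zero]
    exact fun τ hτ => (hg.hasDerivWithinAt_kernelIntegral hν hτ).continuousWithinAt
  | succ n ih =>
    intro ν hν
    push_cast
    rw [contDiffOn_succ_iff_derivWithin uniqueDiffOn_closedLower]
    refine ⟨fun τ hτ => (hg.hasDerivWithinAt_kernelIntegral hν hτ).differentiableWithinAt,
      fun h => absurd h (by simp), ?_⟩
    have h1 : ContDiffOn ℂ n (fun τ => -ν * kernelIntegral g p (ν - 1) τ) closedLower :=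
      contDiffOn_const.mul (ih (ν - 1) (by linarith))
    refine h1.congr fun τ hτ => ?_
    exact (hg.hasDerivWithinAt_kernelIntegral hν hτ).derivWithin (uniqueDiffOn_closedLower τ hτ)

theorem IsFlat.contDiffOn_kernelIntegral_infty (hg : IsFlat g) (p : ℝ) (hν : ν ≤ 0) :
    ContDiffOn ℝ ∞ (kernelIntegral g p ν) closedLower := by
  rw [contDiffOn_infty]
  exact fun n => (hg.contDiffOn_kernelIntegral p n ν hν).restrict_scalars ℝ

theorem IsFlat.differentiableOn_kernelIntegral (hg : IsFlat g) (p : ℝ) (hν : ν ≤ 0) :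
    DifferentiableOn ℂ (kernelIntegral g p ν) {τ : ℂ | τ.im < 0} := fun τ hτ =>
  ((hg.hasDerivWithinAt_kernelIntegral hν (show τ.im ≤ 0 from le_of_lt hτ)).differentiableWithinAt).mono
    fun x (h : x.im < 0) => h.le

theorem contDiff_comp_ofReal {J : ℂ → ℂ} (hJ : ContDiffOn ℝ ∞ J closedLower) :
    ContDiff ℝ ∞ fun x : ℝ => J x := by
  rw [← contDiffOn_univ]
  exact hJ.comp Complex.ofRealCLM.contDiff.contDiffOn fun x _ => by simp [closedLower]

/-- For `σ = ± 1`, the integral of `g(s) (σ (p + i s - τ)) ^ ν` is holomorphic where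
`σ (p - Re τ) > 0`. -/
theorem IsFlat.differentiableOn_signed (hg : IsFlat g) (hν : ν ≤ 0) {σ : ℝ} (hσ : |σ| = 1) :
    DifferentiableOn ℂ (fun τ : ℂ => ∫ s in Ioi (0 : ℝ), g s *
      ((σ : ℂ) * (p + s * Complex.I - τ)) ^ (ν : ℂ)) {τ : ℂ | 0 < σ * (p - τ.re)} := by
  intro τ hτ
  set δ : ℝ := σ * (p - τ.re) with hδ
  have hδ0 : 0 < δ := hτ
  have hre : ∀ (s : ℝ) (x : ℂ), ((σ : ℂ) * (p + s * Complex.I - x)).re = σ * (p - x.re) := by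
    intro s x; rw [Complex.re_ofReal_mul]; simp
  set U : Set ℂ := {x : ℂ | δ / 2 < σ * (p - x.re)} with hU
  have hUo : IsOpen U := isOpen_lt continuous_const (by fun_prop)
  have hτU : τ ∈ U := half_lt_self hδ0
  have hslit : ∀ (s : ℝ), ∀ x ∈ U, ((σ : ℂ) * (p + s * Complex.I - x)) ∈ Complex.slitPlane := by
    intro s x hx
    left
    rw [hre]
    have : δ / 2 < σ * (p - x.re) := hx
    linarith
  have hbd : ∀ κ : ℝ, κ ≤ 0 → ∀ (s : ℝ), ∀ x ∈ U,
      ‖((σ : ℂ) * (p + s * Complex.I - x)) ^ (κ : ℂ)‖ ≤ (δ / 2) ^ κ := by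
    intro κ hκ s x hx
    rw [Complex.norm_cpow_real]
    refine Real.rpow_le_rpow_of_nonpos (by positivity) ?_ hκ
    have h1 := (le_abs_self _).trans (Complex.abs_re_le_norm ((σ : ℂ) * (p + s * Complex.I - x)))
    rw [hre] at h1
    have : δ / 2 < σ * (p - x.re) := hx
    linarith
  have hmeas : ∀ κ : ℝ, ∀ x ∈ U, ContinuousOn (fun s : ℝ => g s *
      ((σ : ℂ) * (p + s * Complex.I - x)) ^ (κ : ℂ)) (Ioi 0) := fun κ x hx =>
    hg.continuousOn.mul fun s _ =>
      have h : ContinuousAt (fun s : ℝ => ((σ : ℂ) * (p + s * Complex.I - x)) ^ (κ : ℂ)) s :=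
        ContinuousAt.cpow (by fun_prop) continuousAt_const (hslit s x hx)
      h.continuousWithinAt
  have hint := hg.integrableOn.norm
  have key := hasDerivAt_integral_of_dominated_loc_of_deriv_le (μ := volume.restrict (Ioi 0))
    (F := fun (x : ℂ) (s : ℝ) => g s * ((σ : ℂ) * (p + s * Complex.I - x)) ^ (ν : ℂ))
    (F' := fun (x : ℂ) (s : ℝ) => (-ν * σ) * (g s * ((σ : ℂ) * (p + s * Complex.I - x)) ^
      ((ν - 1 : ℝ) : ℂ)))
    (x₀ := τ) (bound := fun s => |ν| * (δ / 2) ^ (ν - 1) * ‖g s‖) (hUo.mem_nhds hτU) ?_ ?_ ?_ ?_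
    (hint.const_mul _) ?_
  · exact key.2.differentiableAt.differentiableWithinAt
  · filter_upwards [hUo.mem_nhds hτU] with x hx
    exact (hmeas ν x hx).aestronglyMeasurable measurableSet_Ioi
  · refine Integrable.mono' (hint.const_mul ((δ / 2) ^ ν))
      ((hmeas ν τ hτU).aestronglyMeasurable measurableSet_Ioi) ?_
    refine ae_of_all _ fun s => ?_
    rw [norm_mul, mul_comm]
    exact mul_le_mul_of_nonneg_right (hbd ν hν s τ hτU) (norm_nonneg _)
  · exact ((hmeas (ν - 1) τ hτU).const_mul _).aestronglyMeasurable measurableSet_Ioi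
  · refine ae_of_all _ fun s x hx => ?_
    rw [norm_mul, norm_mul, norm_mul, norm_neg, Complex.norm_real, Complex.norm_real,
      Real.norm_eq_abs, Real.norm_eq_abs, hσ, mul_one, mul_assoc, mul_comm ‖g s‖]
    exact mul_le_mul_of_nonneg_left (mul_le_mul_of_nonneg_right (hbd (ν - 1) (by linarith) s x hx)
      (norm_nonneg _)) (abs_nonneg _)
  · refine ae_of_all _ fun s x hx => ?_
    have h1 : HasDerivAt (fun x : ℂ => (σ : ℂ) * (p + s * Complex.I - x)) (σ * (-1)) x :=
      ((hasDerivAt_id x).const_sub _).const_mul _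
    refine ((h1.cpow_const (hslit s x hx)).const_mul (g s)).congr_deriv ?_
    push_cast
    ring

theorem cpow_eq_exp_mul_neg_cpow {z : ℂ} (hz : 0 < z.im) (ν : ℂ) :
    z ^ ν = Complex.exp (Real.pi * Complex.I * ν) * (-z) ^ ν := by
  have h0 : z ≠ 0 := by rintro rfl; simp at hz
  rw [Complex.cpow_def_of_ne_zero h0, Complex.cpow_def_of_ne_zero (neg_ne_zero.2 h0),
    ← Complex.exp_add, Complex.log, Complex.log, Complex.arg_neg_eq_arg_sub_pi_of_im_pos hz, norm_neg]
  congr 1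
  push_cast
  ring

/-- For x < p the base of the power stays in the right half-plane for complex x nearby, so the
integral is holomorphic. For x > p the base is negated first, at the price of the constant e^{πiν}.
-/
theorem IsFlat.analyticAt_kernelIntegral (hg : IsFlat g) (hν : ν ≤ 0) {x : ℝ} (hx : x ≠ p) :
    AnalyticAt ℝ (fun x : ℝ => kernelIntegral g p ν x) x := by
  have main : ∀ σ : ℝ, |σ| = 1 → 0 < σ * (p - x) → AnalyticAt ℝ (fun x : ℝ =>
      ∫ s in Ioi (0 : ℝ), g s * ((σ : ℂ) * (p + s * Complex.I - x)) ^ (ν : ℂ)) x := by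
    intro σ hσ hpos
    have hopen : IsOpen {τ : ℂ | 0 < σ * (p - τ.re)} := isOpen_lt continuous_const (by fun_prop)
    have h1 := (hg.differentiableOn_signed (p := p) hν hσ).analyticAt
      (hopen.mem_nhds (show (x : ℂ) ∈ {τ : ℂ | 0 < σ * (p - τ.re)} by simpa using hpos))
    exact h1.restrictScalars.comp (Complex.ofRealCLM.analyticAt x)
  rcases lt_or_gt_of_ne hx with h | h
  · have := main 1 (by simp) (by linarith)
    simpa [kernelIntegral] using this
  · have h1 := (main (-1) (by simp) (by linarith)).const_smul
      (c := Complex.exp (Real.pi * Complex.I * ν))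
    refine h1.congr (Eventually.of_forall fun y => ?_)
    simp only [kernelIntegral, Pi.smul_apply, smul_eq_mul]
    rw [← integral_const_mul]
    refine setIntegral_congr_fun measurableSet_Ioi fun s hs => ?_
    have hs' : 0 < s := hs
    rw [cpow_eq_exp_mul_neg_cpow (z := p + s * Complex.I - y) (by simpa using hs')]
    push_cast
    ring_nf

theorem verticalIntegral_eichlerKernel (Φ : ℂ → ℂ) (ν p : ℝ) (τ : ℂ) :
    verticalIntegral (eichlerKernel Φ ν τ) p =
      Complex.I * kernelIntegral (fun s : ℝ => Φ (p + s * Complex.I)) p ν τ := by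
  rw [verticalIntegral, kernelIntegral, ← integral_const_mul]
  congr 1
  funext s
  rw [eichlerKernel]
  ring

end

noncomputable section

open Filter MeasureTheory Set

/-! ### Half-integrals and their asymptotic expansions -/

/-- The Taylor coefficients of `(1 + x) ^ (-1/2)` at `0`. -/
def invSqrtCoeff (r : ℕ) : ℝ := (binomialSeries ℝ (-(1 / 2) : ℝ)).coeff r

/-- A Taylor remainder uniform on the whole interval, with the singularity at x = -1 kept as a
weight: the half-integrals use x = ±y/t for all t > y. -/
theorem exists_invSqrt_taylor_bound (N : ℕ) : ∃ C : ℝ, 0 ≤ C ∧ ∀ x : ℝ, |x| < 1 →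
    |(1 + x) ^ (-(1 / 2) : ℝ) - ∑ r ∈ Finset.range N, invSqrtCoeff r * x ^ r| ≤
      C * |x| ^ N * (1 - |x|) ^ (-(1 / 2) : ℝ) := by
  have h := (Real.one_add_rpow_hasFPowerSeriesAt_zero
    (a := -(1 / 2))).isBigO_sub_partialSum_pow N
  obtain ⟨C₁, hC₁0, hC₁⟩ := h.exists_nonneg
  obtain ⟨δ, hδ, hb⟩ := Metric.eventually_nhds_iff.1 hC₁.bound
  set S : ℝ := ∑ r ∈ Finset.range N, |invSqrtCoeff r| with hS
  have hS0 : 0 ≤ S := Finset.sum_nonneg fun _ _ => abs_nonneg _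
  refine ⟨C₁ + (1 + S) / δ ^ N, by positivity, fun x hx => ?_⟩
  have hw : (1 : ℝ) ≤ (1 - |x|) ^ (-(1 / 2) : ℝ) :=
    Real.one_le_rpow_of_pos_of_le_one_of_nonpos (by linarith) (by linarith [abs_nonneg x])
      (by norm_num)
  have hxN : 0 ≤ |x| ^ N := by positivity
  rcases lt_or_ge |x| δ with hlt | hge
  · have := hb (y := x) (by simpa using hlt)
    simp only [zero_add, FormalMultilinearSeries.partialSum,
      FormalMultilinearSeries.apply_eq_pow_smul_coeff, smul_eq_mul, Real.norm_eq_abs, abs_pow,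
      abs_abs] at this
    simp only [invSqrtCoeff, mul_comm _ (x ^ _)]
    refine this.trans ?_
    calc C₁ * |x| ^ N ≤ (C₁ + (1 + S) / δ ^ N) * |x| ^ N * 1 := by
          rw [mul_one]
          refine mul_le_mul_of_nonneg_right (le_add_of_nonneg_right (by positivity)) hxN
      _ ≤ _ := mul_le_mul_of_nonneg_left hw (by positivity)
  -- Away from 0 no cancellation is needed: |x|^N is at least δ^N, so the trivial bounds are
  -- absorbed by the constant.
  · have h1 : |(1 + x) ^ (-(1 / 2) : ℝ)| ≤ (1 - |x|) ^ (-(1 / 2) : ℝ) := by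
      have h2 := neg_abs_le x
      rw [abs_of_nonneg (Real.rpow_nonneg (by linarith) _)]
      exact Real.rpow_le_rpow_of_nonpos (by linarith) (by linarith) (by norm_num)
    have h2 : |∑ r ∈ Finset.range N, invSqrtCoeff r * x ^ r| ≤ S := by
      refine (Finset.abs_sum_le_sum_abs _ _).trans (Finset.sum_le_sum fun r _ => ?_)
      rw [abs_mul, abs_pow]
      exact mul_le_of_le_one_right (abs_nonneg _) (pow_le_one₀ (abs_nonneg _) hx.le)
    have h3 : 1 ≤ |x| ^ N / δ ^ N := by
      rw [one_le_div (by positivity)]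
      exact pow_le_pow_left₀ hδ.le hge N
    calc _ ≤ (1 - |x|) ^ (-(1 / 2) : ℝ) + S := (abs_sub _ _).trans (add_le_add h1 h2)
      _ ≤ (1 + S) * (1 - |x|) ^ (-(1 / 2) : ℝ) := by nlinarith
      _ ≤ ((1 + S) * (|x| ^ N / δ ^ N)) * (1 - |x|) ^ (-(1 / 2) : ℝ) := by
          refine mul_le_mul_of_nonneg_right ?_ (by linarith)
          exact le_mul_of_one_le_right (by positivity) h3
      _ ≤ _ := by
          refine mul_le_mul_of_nonneg_right ?_ (by linarith)
          have : 0 ≤ C₁ * |x| ^ N := by positivity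
          rw [add_mul C₁, div_mul_eq_mul_div, mul_div_assoc']
          linarith

theorem invSqrtCoeff_zero : invSqrtCoeff 0 = 1 := by
  obtain ⟨C, -, h⟩ := exists_invSqrt_taylor_bound 1
  have := h 0 (by simp)
  simp only [Finset.sum_range_one, pow_zero, mul_one, add_zero, Real.one_rpow, abs_zero, pow_one,
    mul_zero, zero_mul] at this
  linarith [abs_nonpos_iff.1 this]

variable {g : ℝ → ℂ}

/-- The moments of a flat function. -/
def moment (g : ℝ → ℂ) (r : ℝ) : ℂ := ∫ t in Ioi (0 : ℝ), ((t ^ r : ℝ) : ℂ) * g t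

/-- `∫_y^∞ g(t) (t + σ y) ^ (-1/2) dt`. -/
def halfIntegral (g : ℝ → ℂ) (σ y : ℝ) : ℂ :=
  ∫ t in Ioi y, (((t + σ * y) ^ (-(1 / 2) : ℝ) : ℝ) : ℂ) * g t

theorem IsFlat.exists_bound (hg : IsFlat g) (N T : ℕ) : ∃ B : ℝ, 0 ≤ B ∧ ∀ t ∈ Ioc (0 : ℝ) T,
    ‖g t‖ ≤ B * t ^ N := by
  obtain ⟨C, hC0, hC⟩ := (hg.isBigO N).exists_nonneg
  obtain ⟨δ, hδ, hb⟩ := (nhdsGT_basis (0 : ℝ)).eventually_iff.1 hC.bound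
  obtain ⟨K, hK⟩ := (isCompact_Icc (a := δ / 2) (b := (T : ℝ))).exists_bound_of_continuousOn
    (hg.continuousOn.mono fun t ht => lt_of_lt_of_le (half_pos hδ) ht.1)
  refine ⟨C + |K| / (δ / 2) ^ N, by positivity, fun t ht => ?_⟩
  have ht0 : 0 ≤ t ^ N := pow_nonneg ht.1.le N
  rcases lt_or_ge t δ with h | h
  · have := hb ⟨ht.1, h⟩
    rw [Real.rpow_natCast, Real.norm_of_nonneg ht0] at this
    refine this.trans (mul_le_mul_of_nonneg_right (le_add_of_nonneg_right (by positivity)) ht0)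
  · have h1 := (hK t ⟨by linarith, ht.2⟩).trans (le_abs_self K)
    have h2 : 1 ≤ t ^ N / (δ / 2) ^ N := by
      rw [one_le_div (by positivity)]
      exact pow_le_pow_left₀ (by positivity) (by linarith) N
    have h3 : |K| ≤ |K| * (t ^ N / (δ / 2) ^ N) := le_mul_of_one_le_right (abs_nonneg _) h2
    rw [add_mul, div_mul_eq_mul_div]
    have : 0 ≤ C * t ^ N := by positivity
    rw [mul_div_assoc'] at h3
    linarith

theorem integrableOn_sub_rpow_neg_half (y T : ℝ) :
    IntegrableOn (fun t : ℝ => (t - y) ^ (-(1 / 2) : ℝ)) (Ioc y (y + T)) := by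
  rcases le_or_gt T 0 with hT | hT
  · rw [Ioc_eq_empty (by linarith)]; simp
  have h := (intervalIntegral.intervalIntegrable_rpow' (a := 0) (b := T)
    (r := -(1 / 2)) (by norm_num)).comp_sub_right y
  rw [intervalIntegrable_iff_integrableOn_Ioc_of_le (by linarith)] at h
  simpa [add_comm] using h

theorem integral_sub_rpow_neg_half (y : ℝ) :
    ∫ t in Ioc y (y + 1), (t - y) ^ (-(1 / 2) : ℝ) = 2 := by
  rw [← intervalIntegral.integral_of_le (by linarith),
    intervalIntegral.integral_comp_sub_right (fun t : ℝ => t ^ (-(1 / 2) : ℝ)),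
    integral_rpow (Or.inl (by norm_num))]
  norm_num

/-- A uniform bound for the convolution of a flat function with `t ^ (-1/2)`. -/
theorem IsFlat.exists_weighted_bound (hg : IsFlat g) (N : ℕ) : ∃ B : ℝ, 0 ≤ B ∧
    ∀ y ∈ Ioo (0 : ℝ) 1,
      IntegrableOn (fun t : ℝ => t ^ (-(N : ℝ)) * (t - y) ^ (-(1 / 2) : ℝ) * ‖g t‖) (Ioi y) ∧
      ∫ t in Ioi y, t ^ (-(N : ℝ)) * (t - y) ^ (-(1 / 2) : ℝ) * ‖g t‖ ≤ B := by
  obtain ⟨B, hB0, hB⟩ := hg.exists_bound N 2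
  have hint := hg.integrableOn_norm (-(N : ℝ))
  set J := ∫ t in Ioi (0 : ℝ), t ^ (-(N : ℝ)) * ‖g t‖ with hJ
  have hJ0 : 0 ≤ J := setIntegral_nonneg measurableSet_Ioi fun t ht =>
    mul_nonneg (Real.rpow_nonneg (le_of_lt ht) _) (norm_nonneg _)
  refine ⟨B * 2 + J, by positivity, fun y hy => ?_⟩
  have hsub : Ioi y ⊆ Ioi 0 := Ioi_subset_Ioi hy.1.le
  -- Within distance 1 of y, flatness bounds t^{-N}|g(t)| by a constant against the integrable
  -- singularity; beyond it the singular factor is at most 1.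
  set b : ℝ → ℝ := fun t => (Ioc y (y + 1)).indicator (fun t => B * (t - y) ^ (-(1 / 2) : ℝ)) t +
    t ^ (-(N : ℝ)) * ‖g t‖ with hb
  have hi1 : Integrable ((Ioc y (y + 1)).indicator fun t => B * (t - y) ^ (-(1 / 2) : ℝ)) :=
    (integrable_indicator_iff measurableSet_Ioc).2
      ((integrableOn_sub_rpow_neg_half y 1).const_mul B)
  have hbint : IntegrableOn b (Ioi y) := hi1.integrableOn.add (hint.mono_set hsub)
  have hle : ∀ t ∈ Ioi y, t ^ (-(N : ℝ)) * (t - y) ^ (-(1 / 2) : ℝ) * ‖g t‖ ≤ b t := by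
    intro t ht
    have ht' : y < t := ht
    have ht0 : 0 < t := hy.1.trans ht'
    have hG0 : 0 ≤ t ^ (-(N : ℝ)) * ‖g t‖ := by positivity
    have hw0 : 0 ≤ (t - y) ^ (-(1 / 2) : ℝ) := Real.rpow_nonneg (by linarith) _
    have heq : t ^ (-(N : ℝ)) * (t - y) ^ (-(1 / 2) : ℝ) * ‖g t‖ =
      (t ^ (-(N : ℝ)) * ‖g t‖) * (t - y) ^ (-(1 / 2) : ℝ) := by ring
    rw [heq]
    by_cases hT : t ≤ y + 1
    · have hG : t ^ (-(N : ℝ)) * ‖g t‖ ≤ B := by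
        have := hB t ⟨ht0, by push_cast; linarith [hy.2]⟩
        rw [Real.rpow_neg ht0.le, Real.rpow_natCast, inv_mul_le_iff₀ (by positivity), mul_comm]
        exact this
      simp only [hb]
      rw [indicator_of_mem (show t ∈ Ioc y (y + 1) from ⟨ht', hT⟩)]
      have := mul_le_mul_of_nonneg_right hG hw0
      linarith
    · simp only [hb]
      rw [indicator_of_notMem (fun h => hT h.2), zero_add]
      refine mul_le_of_le_one_right hG0 ?_
      exact Real.rpow_le_one_of_one_le_of_nonpos (by linarith) (by norm_num)
  have hmeas : AEStronglyMeasurable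
      (fun t : ℝ => t ^ (-(N : ℝ)) * (t - y) ^ (-(1 / 2) : ℝ) * ‖g t‖)
      (volume.restrict (Ioi y)) := by
    refine ContinuousOn.aestronglyMeasurable ?_ measurableSet_Ioi
    refine ContinuousOn.mul (ContinuousOn.mul ?_ ?_) (hg.continuousOn.mono hsub).norm
    · exact continuousOn_id.rpow_const fun t ht => Or.inl (hy.1.trans ht).ne'
    · exact (continuousOn_id.sub continuousOn_const).rpow_const
        fun t ht => Or.inl (sub_pos.2 ht).ne'
  have hii : IntegrableOn (fun t : ℝ => t ^ (-(N : ℝ)) * (t - y) ^ (-(1 / 2) : ℝ) * ‖g t‖)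
      (Ioi y) := by
    refine Integrable.mono' hbint hmeas ((ae_restrict_iff' measurableSet_Ioi).2
      (ae_of_all _ fun t ht => ?_))
    rw [Real.norm_of_nonneg]
    · exact hle t ht
    · have : 0 < t := hy.1.trans ht
      have h2 : 0 < t - y := sub_pos.2 ht
      positivity
  refine ⟨hii, (setIntegral_mono_on hii hbint measurableSet_Ioi hle).trans ?_⟩
  simp only [hb]
  rw [integral_add hi1.integrableOn (hint.mono_set hsub)]
  refine add_le_add (le_of_eq ?_) ?_
  · rw [setIntegral_indicator measurableSet_Ioc, inter_eq_right.2 Ioc_subset_Ioi_self,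
      integral_const_mul, integral_sub_rpow_neg_half]
  · refine setIntegral_mono_set hint ?_ (LE.le.eventuallyLE hsub)
    exact (ae_restrict_iff' measurableSet_Ioi).2 (ae_of_all _ fun t ht =>
      mul_nonneg (Real.rpow_nonneg (le_of_lt ht) _) (norm_nonneg _))

/-- The difference is the integral over (0, y], where t^r ≤ y^N t^{r-N}. -/
theorem IsFlat.moment_sub_le (hg : IsFlat g) (r : ℝ) (N : ℕ) {y : ℝ} (hy : 0 < y) :
    ‖(∫ t in Ioi y, ((t ^ r : ℝ) : ℂ) * g t) - moment g r‖ ≤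
      y ^ N * ∫ t in Ioi (0 : ℝ), t ^ (r - N) * ‖g t‖ := by
  have hI := hg.integrable r
  have hsub : Ioi y ⊆ Ioi (0 : ℝ) := Ioi_subset_Ioi hy.le
  have h1 : moment g r = (∫ t in Ioc 0 y, ((t ^ r : ℝ) : ℂ) * g t) +
      ∫ t in Ioi y, ((t ^ r : ℝ) : ℂ) * g t := by
    rw [moment, ← Ioc_union_Ioi_eq_Ioi hy.le]
    exact setIntegral_union (Ioc_disjoint_Ioi le_rfl) measurableSet_Ioi
      (hI.mono_set Ioc_subset_Ioi_self) (hI.mono_set hsub)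
  rw [h1, sub_add_cancel_right, norm_neg]
  have hJ : IntegrableOn (fun t : ℝ => y ^ N * (t ^ (r - N) * ‖g t‖)) (Ioi 0) :=
    (hg.integrableOn_norm (r - N)).const_mul (y ^ N)
  rw [← integral_const_mul]
  refine (norm_integral_le_of_norm_le (hJ.mono_set Ioc_subset_Ioi_self)
    ((ae_restrict_iff' measurableSet_Ioc).2 (ae_of_all _ fun t ht => ?_))).trans
    (setIntegral_mono_set hJ ?_ (LE.le.eventuallyLE Ioc_subset_Ioi_self))
  · have ht0 := ht.1
    rw [norm_mul, Complex.norm_real, Real.norm_of_nonneg (by positivity), ← mul_assoc]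
    refine mul_le_mul_of_nonneg_right ?_ (norm_nonneg _)
    rw [Real.rpow_sub ht0, Real.rpow_natCast, mul_div_assoc', le_div_iff₀ (by positivity), mul_comm]
    exact mul_le_mul_of_nonneg_right (pow_le_pow_left₀ ht0.le ht.2 N) (by positivity)
  · refine (ae_restrict_iff' measurableSet_Ioi).2 (ae_of_all _ fun t ht => ?_)
    have ht0 : 0 < t := ht
    simp only [Pi.zero_apply]
    positivity

/-- The asymptotic expansion of half-integrals of flat functions. -/
theorem IsFlat.halfIntegral_expansion (hg : IsFlat g) {σ : ℝ} (hσ : |σ| = 1) (N : ℕ) :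
    (fun y : ℝ => halfIntegral g σ y - ∑ r ∈ Finset.range N,
      (invSqrtCoeff r : ℂ) * moment g (-(1 / 2) - r) * ((σ : ℂ) * y) ^ r)
      =O[𝓝[>] (0 : ℝ)] fun y => y ^ N := by
  obtain ⟨C, hC0, hC⟩ := exists_invSqrt_taylor_bound N
  obtain ⟨B, hB0, hB⟩ := hg.exists_weighted_bound N
  set J : ℕ → ℝ := fun r => ∫ t in Ioi (0 : ℝ), t ^ (-(1 / 2) - (r : ℝ) - N) * ‖g t‖ with hJ
  refine Asymptotics.IsBigO.of_bound (C * B + ∑ r ∈ Finset.range N, |invSqrtCoeff r| * J r) ?_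
  filter_upwards [Ioo_mem_nhdsGT (zero_lt_one (α := ℝ))] with y hy
  obtain ⟨hBi, hBle⟩ := hB y hy
  have hy0 := hy.1
  rw [Real.norm_of_nonneg (pow_nonneg hy0.le N)]
  have hsub : Ioi y ⊆ Ioi (0 : ℝ) := Ioi_subset_Ioi hy0.le
  have hTi : ∀ r : ℕ, IntegrableOn (fun t : ℝ => (invSqrtCoeff r : ℂ) * ((σ : ℂ) * y) ^ r *
      (((t ^ (-(1 / 2) - (r : ℝ)) : ℝ) : ℂ) * g t)) (Ioi y) := fun r =>
    ((hg.integrable _).mono_set hsub).const_mul _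
  have hsum : IntegrableOn (fun t : ℝ => ∑ r ∈ Finset.range N, (invSqrtCoeff r : ℂ) *
      ((σ : ℂ) * y) ^ r * (((t ^ (-(1 / 2) - (r : ℝ)) : ℝ) : ℂ) * g t)) (Ioi y) :=
    integrable_finsetSum _ fun r _ => hTi r
  have hpt : ∀ t ∈ Ioi y, ‖(((t + σ * y) ^ (-(1 / 2) : ℝ) : ℝ) : ℂ) * g t -
      ∑ r ∈ Finset.range N, (invSqrtCoeff r : ℂ) * ((σ : ℂ) * y) ^ r *
        (((t ^ (-(1 / 2) - (r : ℝ)) : ℝ) : ℂ) * g t)‖ ≤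
      C * y ^ N * (t ^ (-(N : ℝ)) * (t - y) ^ (-(1 / 2) : ℝ) * ‖g t‖) := by
    intro t ht
    have hty : y < t := ht
    have ht0 : 0 < t := hy0.trans hty
    have hx : |σ * y / t| = y / t := by
      rw [abs_div, abs_mul, hσ, one_mul, abs_of_pos hy0, abs_of_pos ht0]
    have hx1 : |σ * y / t| < 1 := by rwa [hx, div_lt_one ht0]
    have h1 := hC _ hx1
    have hpos : 0 < 1 + σ * y / t := by linarith [(abs_lt.1 hx1).1]
    have e1 : (t + σ * y) ^ (-(1 / 2) : ℝ) =
        t ^ (-(1 / 2) : ℝ) * (1 + σ * y / t) ^ (-(1 / 2) : ℝ) := by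
      rw [← Real.mul_rpow ht0.le hpos.le]; congr 1; field_simp
    have e2 : (t - y) ^ (-(1 / 2) : ℝ) =
        t ^ (-(1 / 2) : ℝ) * (1 - |σ * y / t|) ^ (-(1 / 2) : ℝ) := by
      rw [← Real.mul_rpow ht0.le (by linarith), hx]; congr 1; field_simp
    have e3 : ∀ r : ℕ, t ^ (-(1 / 2) - (r : ℝ)) = t ^ (-(1 / 2) : ℝ) / t ^ r := fun r => by
      rw [Real.rpow_sub ht0, Real.rpow_natCast]
    have e4 : (((t + σ * y) ^ (-(1 / 2) : ℝ) : ℝ) : ℂ) * g t -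
      ∑ r ∈ Finset.range N, (invSqrtCoeff r : ℂ) * ((σ : ℂ) * y) ^ r *
        (((t ^ (-(1 / 2) - (r : ℝ)) : ℝ) : ℂ) * g t) =
        ((t ^ (-(1 / 2) : ℝ) * ((1 + σ * y / t) ^ (-(1 / 2) : ℝ) -
          ∑ r ∈ Finset.range N, invSqrtCoeff r * (σ * y / t) ^ r) : ℝ) : ℂ) * g t := by
      rw [e1, mul_sub, Finset.mul_sum, Complex.ofReal_sub, sub_mul, Complex.ofReal_sum,
        Finset.sum_mul]
      congr 1
      refine Finset.sum_congr rfl fun r _ => ?_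
      rw [e3, div_pow]
      push_cast
      ring
    rw [e4, norm_mul, Complex.norm_real, Real.norm_eq_abs, abs_mul,
      abs_of_nonneg (Real.rpow_nonneg ht0.le _), e2, ← mul_assoc]
    refine mul_le_mul_of_nonneg_right ?_ (norm_nonneg _)
    refine (mul_le_mul_of_nonneg_left h1 (Real.rpow_nonneg ht0.le _)).trans (le_of_eq ?_)
    rw [Real.rpow_neg ht0.le (N : ℝ), Real.rpow_natCast, hx, div_pow]
    ring
  have hD : IntegrableOn (fun t : ℝ => (((t + σ * y) ^ (-(1 / 2) : ℝ) : ℝ) : ℂ) * g t -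
      ∑ r ∈ Finset.range N, (invSqrtCoeff r : ℂ) * ((σ : ℂ) * y) ^ r *
        (((t ^ (-(1 / 2) - (r : ℝ)) : ℝ) : ℂ) * g t)) (Ioi y) := by
    refine Integrable.mono' (hBi.const_mul (C * y ^ N)) (AEStronglyMeasurable.sub ?_
      hsum.aestronglyMeasurable) ((ae_restrict_iff' measurableSet_Ioi).2 (ae_of_all _ hpt))
    refine ContinuousOn.aestronglyMeasurable ?_ measurableSet_Ioi
    refine ContinuousOn.mul (Complex.continuous_ofReal.comp_continuousOn ?_)
      (hg.continuousOn.mono hsub)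
    refine (continuousOn_id.add continuousOn_const).rpow_const fun t ht => Or.inl ?_
    have h1 : y < t := ht
    have h2 : |σ * y| = y := by rw [abs_mul, hσ, one_mul, abs_of_pos hy0]
    have := neg_abs_le (σ * y)
    change t + σ * y ≠ 0
    linarith
  -- The error has two sources: the Taylor remainder at σy/t under the integral, and the truncation
  -- of the moments at y. Each is O(y^N).
  have hsplit : halfIntegral g σ y - ∑ r ∈ Finset.range N,
      (invSqrtCoeff r : ℂ) * moment g (-(1 / 2) - r) * ((σ : ℂ) * y) ^ r =
      (∫ t in Ioi y, ((((t + σ * y) ^ (-(1 / 2) : ℝ) : ℝ) : ℂ) * g t -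
      ∑ r ∈ Finset.range N, (invSqrtCoeff r : ℂ) * ((σ : ℂ) * y) ^ r *
        (((t ^ (-(1 / 2) - (r : ℝ)) : ℝ) : ℂ) * g t))) +
      ∑ r ∈ Finset.range N, (invSqrtCoeff r : ℂ) * ((σ : ℂ) * y) ^ r *
        ((∫ t in Ioi y, ((t ^ (-(1 / 2) - (r : ℝ)) : ℝ) : ℂ) * g t) -
          moment g (-(1 / 2) - r)) := by
    have h1 := integral_add hD hsum
    simp only [sub_add_cancel] at h1
    rw [halfIntegral, h1, integral_finsetSum _ fun r _ => hTi r]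
    simp only [integral_const_mul, mul_sub, Finset.sum_sub_distrib]
    rw [add_sub_assoc]
    congr 2
    exact Finset.sum_congr rfl fun r _ => by ring
  rw [hsplit, add_mul]
  refine (norm_add_le _ _).trans (add_le_add ?_ ?_)
  · refine (norm_integral_le_of_norm_le (hBi.const_mul (C * y ^ N))
      ((ae_restrict_iff' measurableSet_Ioi).2 (ae_of_all _ hpt))).trans ?_
    rw [integral_const_mul]
    calc _ ≤ C * y ^ N * B := mul_le_mul_of_nonneg_left hBle (by positivity)
      _ = _ := by ring
  · rw [Finset.sum_mul]
    refine (norm_sum_le _ _).trans (Finset.sum_le_sum fun r _ => ?_)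
    rw [norm_mul, norm_mul, norm_pow, norm_mul, Complex.norm_real, Complex.norm_real,
      Complex.norm_real, Real.norm_eq_abs, Real.norm_eq_abs, hσ, one_mul, Real.norm_of_nonneg hy0.le,
      mul_assoc, mul_assoc]
    refine mul_le_mul_of_nonneg_left ?_ (abs_nonneg _)
    have h1 := hg.moment_sub_le (-(1 / 2) - (r : ℝ)) N hy0
    calc _ ≤ 1 * (y ^ N * J r) := mul_le_mul (pow_le_one₀ hy0.le hy.2.le) h1 (norm_nonneg _)
          zero_le_one
      _ = _ := by ring

end

noncomputable section

open Filter MeasureTheory Set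

/-! ### Boundary values of partial theta series as Eichler integrals -/

theorem integral_rpow_neg_half_mul_exp {r : ℝ} (hr : 0 < r) :
    ∫ s in Ioi (0 : ℝ), s ^ (-(1 / 2) : ℝ) * Real.exp (-(r * s)) = √Real.pi / √r := by
  have h := Real.integral_rpow_mul_exp_neg_mul_Ioi (a := 1 / 2) (by norm_num) hr
  rw [Real.Gamma_one_half_eq, ← Real.sqrt_eq_rpow, Real.sqrt_div zero_le_one, Real.sqrt_one] at h
  rw [show (-(1 / 2) : ℝ) = 1 / 2 - 1 by norm_num, h]
  ring

theorem integrableOn_rpow_neg_half_mul_exp {r : ℝ} (hr : 0 < r) :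
    IntegrableOn (fun s : ℝ => s ^ (-(1 / 2) : ℝ) * Real.exp (-(r * s))) (Ioi 0) := by
  have h := integrableOn_rpow_mul_exp_neg_mul_rpow (p := 1) (s := -(1 / 2)) (b := r)
    (by norm_num) one_pos hr
  simpa using h

/-- The half-integral of a `q`-series, computed termwise. -/
theorem integral_rpow_mul_qSeries {c : ℕ → ℂ} (hc : PolyGrowth c) {M : ℕ} (hM : 0 < M) {z : ℂ}
    (hz : 0 < z.im) :
    ∫ s in Ioi (0 : ℝ), ((s ^ (-(1 / 2) : ℝ) : ℝ) : ℂ) *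
      qSeries (fun n => (n : ℂ) * c n) M (z + s * Complex.I) = √(M : ℝ) * qSeries c M z := by
  have hMr : (0 : ℝ) < M := by exact_mod_cast hM
  have hMc : (M : ℂ) ≠ 0 := by exact_mod_cast hM.ne'
  set e : ℕ → ℂ := fun n =>
    c n * Complex.exp (2 * Real.pi * Complex.I * z * ((n : ℂ) ^ 2 / (2 * (M : ℂ)))) with he
  set k : ℕ → ℝ → ℝ := fun n s => n * (s ^ (-(1 / 2) : ℝ) *
    Real.exp (-(Real.pi / M * n ^ 2 * s))) with hk
  have hterm : ∀ (n : ℕ) (s : ℝ), ((s ^ (-(1 / 2) : ℝ) : ℝ) : ℂ) * ((n : ℂ) * c n *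
      Complex.exp (2 * Real.pi * Complex.I * (z + s * Complex.I) *
        ((n : ℂ) ^ 2 / (2 * (M : ℂ))))) = e n * (k n s : ℂ) := by
    intro n s
    have : 2 * Real.pi * Complex.I * (z + s * Complex.I) * ((n : ℂ) ^ 2 / (2 * (M : ℂ))) =
        2 * Real.pi * Complex.I * z * ((n : ℂ) ^ 2 / (2 * (M : ℂ))) +
          ((-(Real.pi / M * n ^ 2 * s) : ℝ) : ℂ) := by
      push_cast
      field_simp
      linear_combination (s * n ^ 2) * Complex.I_sq
    rw [this, Complex.exp_add]
    simp only [he, hk]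
    push_cast
    ring
  -- The kernel vanishes identically for n = 0, where c(0) = 0 saves the formula; for n ≥ 1 the
  -- factor n makes the value independent of n.
  have hint : ∀ n, IntegrableOn (k n) (Ioi 0) ∧ (n ≠ 0 → ∫ s in Ioi (0 : ℝ), k n s = √(M : ℝ)) := by
    intro n
    rcases Nat.eq_zero_or_pos n with rfl | hn
    · simp [hk]
    have hn' : (0 : ℝ) < n := by exact_mod_cast hn
    have hr : 0 < Real.pi / M * n ^ 2 := by positivity
    refine ⟨(integrableOn_rpow_neg_half_mul_exp hr).const_mul _, fun _ => ?_⟩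
    simp only [hk]
    rw [integral_const_mul, integral_rpow_neg_half_mul_exp hr, Real.sqrt_mul (by positivity),
      Real.sqrt_sq hn'.le, Real.sqrt_div Real.pi_pos.le]
    have := Real.sqrt_ne_zero'.2 Real.pi_pos
    have := Real.sqrt_ne_zero'.2 hMr
    field_simp
  have hval : ∀ n, ∫ s in Ioi (0 : ℝ), e n * (k n s : ℂ) = √(M : ℝ) * e n := by
    intro n
    rw [integral_const_mul, integral_complex_ofReal]
    rcases Nat.eq_zero_or_pos n with rfl | hn
    · simp [he, hc.1]
    · rw [(hint n).2 hn.ne', mul_comm]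
  have hnorm : ∀ n, ∫ s in Ioi (0 : ℝ), ‖e n * (k n s : ℂ)‖ = √(M : ℝ) * ‖e n‖ := by
    intro n
    have : ∫ s in Ioi (0 : ℝ), ‖e n * (k n s : ℂ)‖ = ∫ s in Ioi (0 : ℝ), ‖e n‖ * k n s := by
      refine setIntegral_congr_fun measurableSet_Ioi fun s hs => ?_
      have hs' : 0 < s := hs
      simp only [norm_mul, Complex.norm_real]
      rw [Real.norm_of_nonneg (show 0 ≤ k n s by simp only [hk]; positivity)]
    rw [this, integral_const_mul]
    rcases Nat.eq_zero_or_pos n with rfl | hn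
    · simp [he, hc.1]
    · rw [(hint n).2 hn.ne', mul_comm]
  have hsum := summable_qSeries hc hM hz
  have key := hasSum_integral_of_summable_integral_norm (μ := volume.restrict (Ioi (0 : ℝ)))
    (F := fun n s => e n * (k n s : ℂ)) (fun n => (hint n).1.ofReal.const_mul _) (by
      simp only [hnorm]
      exact hsum.norm.mul_left _)
  rw [qSeries, ← tsum_mul_left]
  simp only [hval] at key
  rw [key.tsum_eq]
  congr 1
  funext s
  rw [qSeries, ← tsum_mul_left]
  exact tsum_congr fun n => hterm n s

theorem PolyGrowth.natCast_mul {c : ℕ → ℂ} (hc : PolyGrowth c) :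
    PolyGrowth fun n => (n : ℂ) * c n := by
  obtain ⟨h0, B, p, hB⟩ := hc
  refine ⟨by simp, B, p + 1, fun n => ?_⟩
  rw [norm_mul, Complex.norm_natCast, pow_succ, ← mul_assoc, mul_comm]
  exact mul_le_mul_of_nonneg_right (hB n) (Nat.cast_nonneg n)

theorem halfIntegral_neg_one (F : ℂ → ℂ) (p y : ℝ) :
    halfIntegral (fun t : ℝ => F (p + t * Complex.I)) (-1) y =
      ∫ s in Ioi (0 : ℝ), ((s ^ (-(1 / 2) : ℝ) : ℝ) : ℂ) *
        F ((p + y * Complex.I) + s * Complex.I) := by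
  rw [halfIntegral, ← integral_Ioi_shift]
  congr 1
  funext s
  rw [show y + s + -1 * y = s by ring]
  push_cast
  ring_nf

theorem qSeries_eq_halfIntegral {c : ℕ → ℂ} (hc : PolyGrowth c) {M : ℕ} (hM : 0 < M) (p : ℝ)
    {y : ℝ} (hy : 0 < y) :
    qSeries c M (p + y * Complex.I) = 1 / √(M : ℝ) *
      halfIntegral (fun t : ℝ => qSeries (fun n => (n : ℂ) * c n) M (p + t * Complex.I)) (-1) y := by
  have hMr : (0 : ℝ) < M := by exact_mod_cast hM
  have h0 : ((√(M : ℝ) : ℝ) : ℂ) ≠ 0 := by exact_mod_cast Real.sqrt_ne_zero'.2 hMr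
  rw [halfIntegral_neg_one (qSeries _ M), integral_rpow_mul_qSeries hc hM (by simpa using hy)]
  field_simp

theorem qSeries_natCast_sq_mul {c : ℕ → ℂ} (hc : PolyGrowth c) {M : ℕ} (hM : 0 < M) {z : ℂ}
    (hz : 0 < z.im) :
    qSeries (fun n => (n : ℂ) * ((n : ℂ) * c n)) M z =
      -(M / Real.pi) * (Complex.I * deriv (qSeries c M) z) := by
  have hMc : (M : ℂ) ≠ 0 := by exact_mod_cast hM.ne'
  have hpi : (Real.pi : ℂ) ≠ 0 := by exact_mod_cast Real.pi_ne_zero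
  rw [deriv_qSeries hc hM hz, qSeries, qSeries, ← tsum_mul_left, ← tsum_mul_left]
  refine tsum_congr fun n => ?_
  field_simp
  linear_combination (c n * n ^ 2) * Complex.I_sq

/-- Cauchy's estimate on the disc of radius Im z / 2, which lies in the cone of aperture 2|K| + 1;
one power of Im z is lost. -/
theorem RapidDecay.deriv {F : ℂ → ℂ} {p : ℝ} (hF : DifferentiableOn ℂ F {z : ℂ | 0 < z.im})
    (hp : RapidDecay F p) : RapidDecay (deriv F) p := by
  intro K N
  set K' : ℝ := 2 * |K| + 1 with hK'
  obtain ⟨C, hC0, hC⟩ := (hp K' (N + 1)).exists_nonneg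
  obtain ⟨δ, hδ, hb⟩ := Metric.mem_nhdsWithin_iff.1 hC.bound
  refine Asymptotics.IsBigO.of_bound (C * (3 / 2) ^ (N + 1) * 2) ?_
  filter_upwards [self_mem_nhdsWithin,
    mem_nhdsWithin_of_mem_nhds (Metric.ball_mem_nhds (p : ℂ) (half_pos hδ))] with z hz hzb
  have hy : 0 < z.im := hz.1
  rw [Metric.mem_ball, dist_eq_norm] at hzb
  have hyle : z.im ≤ ‖z - p‖ := by
    have := (le_abs_self _).trans (Complex.abs_im_le_norm (z - p))
    simpa using this
  have him : ∀ w ∈ Metric.closedBall z (z.im / 2), z.im / 2 ≤ w.im ∧ w.im ≤ 3 / 2 * z.im := by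
    intro w hw
    have h1 : |(w - z).im| ≤ ‖w - z‖ := Complex.abs_im_le_norm _
    rw [Metric.mem_closedBall, dist_eq_norm] at hw
    have := abs_le.1 (h1.trans hw)
    rw [Complex.sub_im] at this
    constructor <;> linarith [this.1, this.2]
  have hdc : DiffContOnCl ℂ F (Metric.ball z (z.im / 2)) := by
    refine DifferentiableOn.diffContOnCl fun w hw => ?_
    have hw' := (him w (Metric.closure_ball_subset_closedBall hw)).1
    have : (0 : ℝ) < w.im := by linarith
    exact (hF.differentiableAt (isOpen_im_pos.mem_nhds this)).differentiableWithinAt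
  have := Complex.norm_deriv_le_of_forall_mem_sphere_norm_le
    (C := C * (3 / 2 * z.im) ^ (N + 1)) (half_pos hy) hdc fun w hw => by
      have hwb := Metric.sphere_subset_closedBall hw
      have hw' := him w hwb
      rw [Metric.mem_closedBall, dist_eq_norm] at hwb
      have hwpos : 0 < w.im := by linarith
      have hcone : w ∈ cone p K' := by
        refine ⟨hwpos, ?_⟩
        have h1 : |(w - z).re| ≤ ‖w - z‖ := Complex.abs_re_le_norm _
        rw [Complex.sub_re] at h1
        have h2 : |w.re - p| ≤ |w.re - z.re| + |z.re - p| := abs_sub_le _ _ _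
        have h3 : |z.re - p| ≤ |K| * z.im :=
          hz.2.trans (mul_le_mul_of_nonneg_right (le_abs_self K) hy.le)
        have h4 : |K| * z.im ≤ |K| * (2 * w.im) :=
          mul_le_mul_of_nonneg_left (by linarith) (abs_nonneg K)
        rw [hK']
        linarith
      have hball : w ∈ Metric.ball (p : ℂ) δ := by
        rw [Metric.mem_ball, dist_eq_norm]
        calc ‖w - p‖ = ‖(w - z) + (z - p)‖ := by ring_nf
          _ ≤ ‖w - z‖ + ‖z - p‖ := norm_add_le _ _
          _ < δ := by linarith
      have h5 : ‖F w‖ ≤ C * ‖w.im ^ (N + 1)‖ := hb ⟨hball, hcone⟩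
      rw [Real.norm_of_nonneg (by positivity)] at h5
      exact h5.trans (mul_le_mul_of_nonneg_left (pow_le_pow_left₀ hwpos.le hw'.2 _) hC0)
  refine this.trans (le_of_eq ?_)
  rw [Real.norm_of_nonneg (by positivity), mul_pow, pow_succ z.im]
  field_simp

theorem IsCuspidal.hasDerivAt_vertical {F : ℂ → ℂ} (hF : IsCuspidal F) (p : ℝ) {t : ℝ}
    (ht : 0 < t) : HasDerivAt (fun t : ℝ => F (p + t * Complex.I))
      (Complex.I * _root_.deriv F (p + t * Complex.I)) t := by
  have h1 : HasDerivAt (fun t : ℝ => (p : ℂ) + t * Complex.I) Complex.I t := by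
    simpa using ((Complex.ofRealCLM.hasDerivAt (x := t)).mul_const Complex.I).const_add (p : ℂ)
  have h2 : HasDerivAt F (_root_.deriv F (p + t * Complex.I)) (p + t * Complex.I) :=
    (hF.1.differentiableAt (isOpen_im_pos.mem_nhds (by simpa using ht))).hasDerivAt
  have := h2.comp t h1
  rwa [mul_comm] at this

theorem IsFlat.const_mul {g : ℝ → ℂ} (hg : IsFlat g) (a : ℂ) : IsFlat fun t => a * g t :=
  ⟨continuousOn_const.mul hg.continuousOn, fun r => (hg.isBigO r).const_mul_left a, fun r => by
    have h : IntegrableOn (fun t : ℝ => a * (((t ^ r : ℝ) : ℂ) * g t)) (Ioi 0) :=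
      (hg.integrable r).const_mul a
    exact h.congr_fun (fun t _ => by ring) measurableSet_Ioi⟩

/-- Integration by parts. The boundary term at 0 vanishes by flatness, the one at infinity because
the product and its derivative are both integrable. -/
theorem IsCuspidal.moment_deriv {F : ℂ → ℂ} {p : ℝ} (hF : IsCuspidal F) (hp : RapidDecay F p) :
    moment (fun t : ℝ => Complex.I * _root_.deriv F (p + t * Complex.I)) (-(1 / 2)) =
      1 / 2 * moment (fun t : ℝ => F (p + t * Complex.I)) (-(3 / 2)) := by
  have hflat := hF.isFlat hp
  have hflat' := (hF.deriv.isFlat (hp.deriv hF.1)).const_mul Complex.I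
  have hu : ∀ t ∈ Ioi (0 : ℝ), HasDerivAt (fun t : ℝ => ((t ^ (-(1 / 2) : ℝ) : ℝ) : ℂ))
      (((-(1 / 2) * t ^ (-(3 / 2) : ℝ) : ℝ) : ℂ)) t := by
    intro t ht
    have h1 := (Real.hasDerivAt_rpow_const (x := t) (p := -(1 / 2)) (Or.inl (ne_of_gt ht)))
    rw [show (-(1 / 2) - 1 : ℝ) = -(3 / 2) by norm_num] at h1
    exact h1.ofReal_comp
  have hzero : Tendsto ((fun t : ℝ => ((t ^ (-(1 / 2) : ℝ) : ℝ) : ℂ)) *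
      fun t : ℝ => F (p + t * Complex.I)) (𝓝[>] 0) (𝓝 0) := by
    have h1 := (Complex.isBigO_ofReal_left.2 (Asymptotics.isBigO_refl
      (fun t : ℝ => t ^ (-(1 / 2) : ℝ)) (𝓝[>] 0))).mul (hflat.isBigO (3 / 2))
    refine h1.trans_tendsto ((tendsto_id.mono_left nhdsWithin_le_nhds).congr' ?_)
    filter_upwards [self_mem_nhdsWithin] with t ht
    rw [← Real.rpow_add ht]
    norm_num
  have huv := hflat'.integrable (-(1 / 2))
  have hu'v : IntegrableOn ((fun t : ℝ => ((-(1 / 2) * t ^ (-(3 / 2) : ℝ) : ℝ) : ℂ)) *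
      fun t : ℝ => F (p + t * Complex.I)) (Ioi 0) := by
    have h : IntegrableOn (fun t : ℝ => (-(1 / 2) : ℂ) * (((t ^ (-(3 / 2) : ℝ) : ℝ) : ℂ) *
      F (p + t * Complex.I))) (Ioi 0) := (hflat.integrable (-(3 / 2))).const_mul _
    refine h.congr_fun (fun t _ => ?_) measurableSet_Ioi
    simp only [Pi.mul_apply]
    push_cast
    ring
  have hinf := tendsto_zero_of_hasDerivAt_of_integrableOn_Ioi
    (fun t ht => (hu t ht).mul (hF.hasDerivAt_vertical p ht)) (hu'v.add huv)
    (hflat.integrable (-(1 / 2)))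
  have key := integral_Ioi_mul_deriv_eq_deriv_mul hu
    (fun t ht => hF.hasDerivAt_vertical p ht) huv hu'v hzero hinf
  rw [moment, key, moment, ← integral_const_mul, sub_zero, zero_sub, ← integral_neg]
  congr 1
  funext t
  push_cast
  ring

theorem IsFlat.tendsto_halfIntegral {g : ℝ → ℂ} (hg : IsFlat g) {σ : ℝ} (hσ : |σ| = 1) :
    Tendsto (halfIntegral g σ) (𝓝[>] 0) (𝓝 (moment g (-(1 / 2)))) := by
  have h := hg.halfIntegral_expansion hσ 1
  simp only [Finset.sum_range_one, invSqrtCoeff_zero, Complex.ofReal_one, one_mul, Nat.cast_zero,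
    sub_zero, pow_zero, mul_one, pow_one] at h
  rw [← tendsto_sub_nhds_zero_iff]
  exact h.trans_tendsto (tendsto_id.mono_left nhdsWithin_le_nhds)

theorem cpow_ofReal_mul_I {t : ℝ} (ht : 0 < t) (μ : ℝ) :
    ((t : ℂ) * Complex.I) ^ (μ : ℂ) = ((t ^ μ : ℝ) : ℂ) * Complex.I ^ (μ : ℂ) := by
  have ht' : (t : ℂ) ≠ 0 := by exact_mod_cast ht.ne'
  rw [Complex.cpow_def_of_ne_zero (mul_ne_zero ht' Complex.I_ne_zero),
    Complex.log_ofReal_mul ht Complex.I_ne_zero, add_mul, Complex.exp_add,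
    Complex.cpow_def_of_ne_zero Complex.I_ne_zero, Real.rpow_def_of_pos ht]
  push_cast
  rfl

theorem verticalIntegral_eichlerKernel_ofReal (Φ : ℂ → ℂ) (μ p : ℝ) :
    verticalIntegral (eichlerKernel Φ μ p) p = Complex.I ^ (μ : ℂ) * Complex.I *
      moment (fun t : ℝ => Φ (p + t * Complex.I)) μ := by
  rw [verticalIntegral, moment, ← integral_const_mul]
  refine setIntegral_congr_fun measurableSet_Ioi fun s hs => ?_
  simp only [eichlerKernel, add_sub_cancel_left]
  rw [cpow_ofReal_mul_I hs]
  ring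

/-- On the ray above p + iy, w - τ equals i(t + y) with t = Im w: the sign σ = +1, against σ = -1
for the partial theta series. -/
theorem verticalIntegral_eichlerKernel_conj (Φ : ℂ → ℂ) (p : ℝ) {y : ℝ} (hy : 0 < y) :
    verticalIntegral (eichlerKernel Φ (-(1 / 2)) (p - y * Complex.I)) (p + y * Complex.I) =
      Complex.I ^ ((-(1 / 2) : ℝ) : ℂ) * Complex.I *
        halfIntegral (fun t : ℝ => Φ (p + t * Complex.I)) 1 y := by
  rw [verticalIntegral, halfIntegral,
    ← integral_Ioi_shift (fun t : ℝ => (((t + 1 * y) ^ (-(1 / 2) : ℝ) : ℝ) : ℂ) * _) y,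
    ← integral_const_mul]
  refine setIntegral_congr_fun measurableSet_Ioi fun s hs => ?_
  have hs' : 0 < s := hs
  simp only [eichlerKernel]
  rw [show (p + y * Complex.I + s * Complex.I - (p - y * Complex.I) : ℂ) =
    ((y + s + 1 * y : ℝ) : ℂ) * Complex.I by push_cast; ring, cpow_ofReal_mul_I (by positivity)]
  push_cast
  ring_nf

end

noncomputable section

open Filter MeasureTheory Set

/-! ### The multiplier is unitary -/

theorem extendedJacobi_sq {c d : ℤ} (h : IsCoprime c d) : extendedJacobi c d ^ 2 = 1 := by
  have hg : c.gcd (d.natAbs : ℤ) = 1 := by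
    rw [Int.gcd_eq_natAbs, Int.natAbs_natCast, ← Int.gcd_eq_natAbs]
    exact Int.isCoprime_iff_gcd_eq_one.1 h
  unfold extendedJacobi
  split_ifs <;> rcases jacobiSym.eq_one_or_neg_one hg with h | h <;> simp [h]

theorem conj_multiplier_mul_self {M k₀ : ℕ} (hM : 2 ≤ M) {γ : SL(2, ℤ)} (hγ : γ ∈ GammaM M) :
    conj (multiplier M k₀ γ) * multiplier M k₀ γ = 1 := by
  obtain ⟨-, -, -, -, -, -, -, hcop, -, hodd⟩ := GammaM_entries hM hγ
  have h1 : IsCoprime (2 * γ 1 0 * (M : ℤ)) (γ 1 1) := by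
    refine IsCoprime.mul_left (IsCoprime.mul_left ?_ ?_) hcop.symm
    · obtain ⟨n, hn⟩ := hodd
      exact ⟨-n, 1, by rw [hn]; ring⟩
    · exact ⟨-γ 0 1, γ 0 0, by linear_combination det_eq γ⟩
  have h2 := extendedJacobi_sq h1
  have h3 : Complex.exp (Real.pi * Complex.I * (γ 0 0 : ℂ) * (γ 0 1 : ℂ) * (k₀ : ℂ) / (M : ℂ)) =
      Complex.exp (((Real.pi * γ 0 0 * γ 0 1 * k₀ / M : ℝ) : ℂ) * Complex.I) := by
    congr 1; push_cast; ring
  rw [← Complex.normSq_eq_conj_mul_self, ← Complex.sq_norm]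
  unfold multiplier
  rw [norm_mul, norm_mul, h3, Complex.norm_exp_ofReal_mul_I, one_mul, norm_inv]
  have h4 : ‖epsilonFactor (γ 1 1)‖ = 1 := by
    unfold epsilonFactor; split_ifs <;> simp
  rw [h4, inv_one, mul_one, Complex.norm_intCast, sq_abs]
  exact_mod_cast h2

/-! ### Quantum modularity of boundary values of Eichler integrals -/

variable {Φ : ℂ → ℂ} {m : ℕ} {v v' : ℂ} {γ : SL(2, ℤ)} {τ : ℂ} {k p : ℝ}

theorem weight_cast_eq (hk : (4 - m : ℝ) / 2 = k) : ((m - 4 : ℤ) : ℝ) / 2 = -k := by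
  rw [← hk]; push_cast; ring

theorem autFactor_neg_weight (hk : (4 - m : ℝ) / 2 = k) (γ : SL(2, ℤ)) (τ : ℂ) :
    autFactor (-k) γ τ = (autFactor (1 / 2) γ τ ^ (4 - m : ℤ))⁻¹ := by
  rw [← weight_cast_eq hk, autFactor_half_zpow, ← zpow_neg, neg_sub]

theorem cancel_slash {v A E E' P : ℂ} (hv : conj v * v = 1) (hA : A ≠ 0)
    (h : E' = v * A * (E - P)) : E - conj v * A⁻¹ * E' = P := by
  rw [h]
  have : conj v * A⁻¹ * (v * A * (E - P)) = (conj v * v) * (A⁻¹ * A) * (E - P) := by ring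
  rw [this, hv, inv_mul_cancel₀ hA]
  ring

theorem autFactor_half_ne_zero (he : (γ 1 0 * τ + γ 1 1 : ℂ) ≠ 0) :
    autFactor (1 / 2) γ τ ≠ 0 := by
  intro h
  have := autFactor_half_sq γ τ
  rw [h] at this
  exact he (by rw [← this]; simp)

theorem verticalIntegral_sub_slash (hk : (4 - m : ℝ) / 2 = k) (hm : m ≤ 4) (hΦ : IsCuspidal Φ)
    (ht : TransformsUnder Φ m v γ) (ht' : TransformsUnder Φ m v' γ⁻¹) (hv : conj v * v = 1)
    (h0 : γ 1 0 = 0 → γ 0 0 = 1 ∧ γ 1 1 = 1) (hτ : τ.im ≤ 0)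
    (he : (γ 1 0 * τ + γ 1 1 : ℂ) ≠ 0) {z : ℂ} (hz : 0 < z.im) :
    verticalIntegral (eichlerKernel Φ (-k) τ) z - conj v * autFactor (-k) γ τ *
      verticalIntegral (eichlerKernel Φ (-k) (moebius γ τ)) (moebius γ z) =
      kernelPeriod Φ (-k) γ τ := by
  rw [autFactor_neg_weight hk, ← weight_cast_eq hk]
  exact cancel_slash hv (zpow_ne_zero _ (autFactor_half_ne_zero he))
    (verticalIntegral_moebius hm hΦ ht ht' h0 hτ he hz)

theorem verticalIntegral_sub_slash_ofReal (hk : (4 - m : ℝ) / 2 = k) (hm : m ≤ 4)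
    (hΦ : IsCuspidal Φ) (ht : TransformsUnder Φ m v γ) (ht' : TransformsUnder Φ m v' γ⁻¹)
    (hv : conj v * v = 1) (h0 : γ 1 0 = 0 → γ 0 0 = 1 ∧ γ 1 1 = 1) (hp : RapidDecay Φ p)
    (he : (γ 1 0 : ℝ) * p + (γ 1 1 : ℝ) ≠ 0) :
    verticalIntegral (eichlerKernel Φ (-k) p) p - conj v * autFactor (-k) γ p *
      verticalIntegral (eichlerKernel Φ (-k) (moebius γ p)) (moebius γ p) =
      kernelPeriod Φ (-k) γ p := by
  have heC : (γ 1 0 * (p : ℂ) + γ 1 1 : ℂ) ≠ 0 := by exact_mod_cast he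
  rw [autFactor_neg_weight hk, ← weight_cast_eq hk]
  exact cancel_slash hv (zpow_ne_zero _ (autFactor_half_ne_zero heC))
    (verticalIntegral_moebiusReal hm hΦ ht ht' h0 hp he)

/-! ### Regularity of the period integrals. -/

theorem kernelPeriod_eq (hc : γ 1 0 ≠ 0) (k : ℝ) : kernelPeriod Φ k γ = fun τ =>
    Complex.I * kernelIntegral (fun s : ℝ => Φ (cuspPoint γ + s * Complex.I)) (cuspPoint γ) k τ := by
  funext τ
  rw [kernelPeriod, if_neg hc, verticalIntegral_eichlerKernel]

theorem kernelPeriod_of_eq_zero (hc : γ 1 0 = 0) (k : ℝ) : kernelPeriod Φ k γ = fun _ => 0 := by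
  funext τ
  rw [kernelPeriod, if_pos hc]

theorem contDiffOn_kernelPeriod (hΦ : IsCuspidal Φ) (ht' : TransformsUnder Φ m v' γ⁻¹)
    (hk : k ≤ 0) : ContDiffOn ℝ ∞ (kernelPeriod Φ k γ) closedLower := by
  by_cases hc : γ 1 0 = 0
  · rw [kernelPeriod_of_eq_zero hc]; exact contDiffOn_const
  · rw [kernelPeriod_eq hc]
    exact contDiffOn_const.mul
      ((hΦ.isFlat (rapidDecay_cuspPoint hΦ ht' hc)).contDiffOn_kernelIntegral_infty _ hk)

theorem differentiableOn_kernelPeriod (hΦ : IsCuspidal Φ) (ht' : TransformsUnder Φ m v' γ⁻¹)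
    (hk : k ≤ 0) : DifferentiableOn ℂ (kernelPeriod Φ k γ) {τ : ℂ | τ.im < 0} := by
  by_cases hc : γ 1 0 = 0
  · rw [kernelPeriod_of_eq_zero hc]; exact differentiableOn_const _
  · rw [kernelPeriod_eq hc]
    exact ((hΦ.isFlat (rapidDecay_cuspPoint hΦ ht' hc)).differentiableOn_kernelIntegral _
      hk).const_mul _

theorem analyticOnNhd_kernelPeriod (hΦ : IsCuspidal Φ) (ht' : TransformsUnder Φ m v' γ⁻¹)
    (hk : k ≤ 0) : AnalyticOnNhd ℝ (fun x : ℝ => kernelPeriod Φ k γ x)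
      {x : ℝ | (γ 1 0 : ℝ) * x + (γ 1 1 : ℝ) ≠ 0} := by
  intro x hx
  by_cases hc : γ 1 0 = 0
  · rw [kernelPeriod_of_eq_zero hc]; exact analyticAt_const
  · rw [kernelPeriod_eq hc]
    have hcR : (γ 1 0 : ℝ) ≠ 0 := by exact_mod_cast hc
    refine analyticAt_const.mul
      ((hΦ.isFlat (rapidDecay_cuspPoint hΦ ht' hc)).analyticAt_kernelIntegral hk ?_)
    rintro rfl
    refine hx ?_
    rw [cuspPoint]
    field_simp
    ring

theorem compl_cuspPoint_subset (h0 : γ 1 0 = 0 → γ 0 0 = 1 ∧ γ 1 1 = 1) :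
    ({cuspPoint γ} : Set ℝ)ᶜ ⊆ {x : ℝ | (γ 1 0 : ℝ) * x + (γ 1 1 : ℝ) ≠ 0} := by
  intro x hx h
  by_cases hc : γ 1 0 = 0
  · rw [hc, (h0 hc).2] at h
    simp at h
  · have hcR : (γ 1 0 : ℝ) ≠ 0 := by exact_mod_cast hc
    refine hx ?_
    rw [mem_singleton_iff, cuspPoint, eq_div_iff hcR]
    linarith

/-- If the radial values of `F` are Eichler integrals of a modular form `Φ`, then they are a
quantum modular form. -/
theorem isQuantumModularForm_of_eichler {G : Subgroup SL(2, ℤ)} {χ : SL(2, ℤ) → ℂ} {A : Set ℚ}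
    {F : ℂ → ℂ} {κ : ℂ} (hk : (4 - m : ℝ) / 2 = k) (hm : m ≤ 4) (hΦ : IsCuspidal Φ)
    (ht : ∀ γ ∈ G, TransformsUnder Φ m (χ γ) γ) (hχ : ∀ γ ∈ G, conj (χ γ) * χ γ = 1)
    (h0 : ∀ γ ∈ G, γ 1 0 = 0 → γ 0 0 = 1 ∧ γ 1 1 = 1)
    (hA : ∀ α ∈ A, RapidDecay Φ ((α : ℚ) : ℝ))
    (hF : ∀ α : ℚ, RapidDecay Φ (α : ℝ) → radialValue F α =
      κ * verticalIntegral (eichlerKernel Φ (-k) ((α : ℝ) : ℂ)) ((α : ℝ) : ℂ)) :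
    IsQuantumModularForm k G χ A (radialValue F) fun γ x => κ * kernelPeriod Φ (-k) γ x := by
  have hk0 : -k ≤ 0 := by rw [← weight_cast_eq hk]; exact weight_nonpos hm
  intro γ hγ
  have ht' := ht _ (inv_mem hγ)
  refine ⟨⟨{cuspPoint γ}, finite_singleton _, ?_⟩, fun α hα he => ?_⟩
  · exact (analyticOnNhd_const.mul (analyticOnNhd_kernelPeriod hΦ ht' hk0)).mono
      (compl_cuspPoint_subset (h0 γ hγ))
  · have heR : (γ 1 0 : ℝ) * ((α : ℚ) : ℝ) + (γ 1 1 : ℝ) ≠ 0 := by exact_mod_cast he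
    have hp := hA α hα
    have hβ : (((((γ 0 0 : ℚ) * α + (γ 0 1 : ℚ)) / ((γ 1 0 : ℚ) * α + (γ 1 1 : ℚ)) : ℚ)) : ℝ) =
        moebiusReal γ α := by
      rw [moebiusReal]; push_cast; rfl
    have hβp := hp.moebius (ht γ hγ) heR
    have key := verticalIntegral_sub_slash_ofReal hk hm hΦ (ht γ hγ) ht' (hχ γ hγ) (h0 γ hγ) hp heR
    change _ = κ * kernelPeriod Φ (-k) γ ((α : ℝ) : ℂ)
    rw [slashRat, hF α hp, hF _ (by rw [hβ]; exact hβp), hβ, ofReal_moebiusReal, ← key,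
      ← Complex.ofReal_ratCast]
    ring

/-! ### Partial theta series -/

theorem polyGrowth_of_periodic {f : ℤ → ℂ} {M : ℕ} (hM : 0 < M)
    (hf : Function.Periodic f (M : ℤ)) (h0 : f 0 = 0) : PolyGrowth fun n : ℕ => f n := by
  refine ⟨by simpa using h0, ∑ h ∈ Finset.range M, ‖f h‖, 0, fun n => ?_⟩
  rw [pow_zero, mul_one]
  have h1 : f n = f ((n % M : ℕ) : ℤ) := by
    have := (hf.int_mul ((n / M : ℕ) : ℤ)) ((n % M : ℕ) : ℤ)
    rw [← this]
    congr 1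
    have h2 := (Nat.mod_add_div' n M).symm
    simp only [Int.cast_natCast]
    exact_mod_cast h2
  simp only [h1]
  exact Finset.single_le_sum (f := fun h : ℕ => ‖f h‖) (fun _ _ => norm_nonneg _)
    (Finset.mem_range.2 (Nat.mod_lt _ hM))

theorem I_cpow_half_ne_zero : Complex.I ^ (1 / 2 : ℂ) ≠ 0 := by
  intro h
  have := cpow_half_sq Complex.I
  rw [h, zero_pow two_ne_zero] at this
  exact Complex.I_ne_zero this.symm

theorem exp_pi_div_four : Complex.exp (Real.pi * Complex.I / 4) = Complex.I ^ (1 / 2 : ℂ) := by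
  rw [Complex.cpow_def_of_ne_zero Complex.I_ne_zero, Complex.log_I]
  congr 1
  ring

theorem odd_constant {M : ℕ} (hM : 0 < M) : 1 / (Complex.I * (M : ℂ)) ^ (1 / 2 : ℂ) *
    (Complex.I ^ ((-(1 / 2) : ℝ) : ℂ) * Complex.I) = 1 / √(M : ℝ) := by
  have hMr : (0 : ℝ) < M := by exact_mod_cast hM
  have hs : ((√(M : ℝ) : ℝ) : ℂ) ≠ 0 := by exact_mod_cast Real.sqrt_ne_zero'.2 hMr
  have h1 := cpow_ofReal_mul_I hMr (1 / 2)
  have h2 := cpow_half_int Complex.I (-1)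
  rw [← Real.sqrt_eq_rpow] at h1
  push_cast at h1 h2
  rw [mul_comm Complex.I (M : ℂ), h1]
  rw [show ((-(1 / 2) : ℝ) : ℂ) = -1 / 2 by push_cast; ring, h2, zpow_neg_one]
  have h3 := cpow_half_sq Complex.I
  have h4 := I_cpow_half_ne_zero
  field_simp
  linear_combination -h3

theorem even_constant (M : ℕ) : -((√(M : ℝ) : ℂ) * Complex.exp (Real.pi * Complex.I / 4) /
    (2 * Real.pi)) * (Complex.I ^ ((-(3 / 2) : ℝ) : ℂ) * Complex.I) =
      -(√(M : ℝ) / (2 * Real.pi)) := by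
  have h2 := cpow_half_int Complex.I (-3)
  push_cast at h2
  rw [exp_pi_div_four, show ((-(3 / 2) : ℝ) : ℂ) = -3 / 2 by push_cast; ring, h2]
  have h3 := cpow_half_sq Complex.I
  have h4 := I_cpow_half_ne_zero
  have hpi : (Real.pi : ℂ) ≠ 0 := by exact_mod_cast Real.pi_ne_zero
  rw [show (-3 : ℤ) = -((3 : ℕ) : ℤ) by norm_num, zpow_neg, zpow_natCast]
  field_simp
  linear_combination (√(M : ℝ) : ℂ) * h3

variable {f : ℤ → ℂ} {M : ℕ}

theorem evenPeriod_eq (γ : SL(2, ℤ)) (z : ℂ) : evenPeriod f M γ z =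
    -((√(M : ℝ) : ℂ) * Complex.exp (Real.pi * Complex.I / 4) / (2 * Real.pi)) *
      kernelPeriod (partialTheta f M) (-(3 / 2)) γ (conj z) := by
  rw [evenPeriod, kernelPeriod]
  split_ifs
  · simp
  · congr 2
    funext τ
    simp [evenKernel, eichlerKernel]

theorem evenPeriod_ofReal : (fun (γ : SL(2, ℤ)) (x : ℝ) => evenPeriod f M γ x) = fun γ (x : ℝ) =>
    -((√(M : ℝ) : ℂ) * Complex.exp (Real.pi * Complex.I / 4) / (2 * Real.pi)) *
      kernelPeriod (partialTheta f M) (-(3 / 2)) γ x := by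
  funext γ x
  rw [evenPeriod_eq, Complex.conj_ofReal]

theorem oddKernel_eq (τ : ℂ) :
    oddKernel f M τ = eichlerKernel (partialThetaDeriv f M) (-(1 / 2)) τ := by
  funext w
  simp [oddKernel, eichlerKernel]

theorem evenKernel_eq (z : ℂ) :
    evenKernel f M z = eichlerKernel (partialTheta f M) (-(3 / 2)) (conj z) := by
  funext w
  simp [evenKernel, eichlerKernel]

theorem oddPeriod_eq (γ : SL(2, ℤ)) : oddPeriod f M γ = fun τ =>
    1 / (Complex.I * (M : ℂ)) ^ (1 / 2 : ℂ) *
      kernelPeriod (partialThetaDeriv f M) (-(1 / 2)) γ τ := by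
  funext τ
  rw [oddPeriod, kernelPeriod, oddKernel_eq]
  split_ifs <;> simp

/-- Θ_f is a half-integral of the series with coefficients n² f(n), a multiple of the derivative of
θ_f. In the limit this is a moment of exponent -1/2, which integration by parts turns into the
moment of θ_f of exponent -3/2. -/
theorem tendsto_partialThetaDeriv (hM : 0 < M) (hc : PolyGrowth fun n : ℕ => f n) {p : ℝ}
    (hp : RapidDecay (partialTheta f M) p) :
    Tendsto (fun y : ℝ => partialThetaDeriv f M (p + y * Complex.I)) (𝓝[>] 0)
      (𝓝 (-((√(M : ℝ) : ℂ) * Complex.exp (Real.pi * Complex.I / 4) / (2 * Real.pi)) *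
        verticalIntegral (eichlerKernel (partialTheta f M) (-(3 / 2)) p) p)) := by
  have hcusp : IsCuspidal (partialTheta f M) := isCuspidal_qSeries hc hM
  have hMr : (0 : ℝ) < M := by exact_mod_cast hM
  have hs : ((√(M : ℝ) : ℝ) : ℂ) ≠ 0 := by exact_mod_cast Real.sqrt_ne_zero'.2 hMr
  have hs2 : ((√(M : ℝ) : ℝ) : ℂ) ^ 2 = M := by exact_mod_cast Real.sq_sqrt hMr.le
  have hpi : (Real.pi : ℂ) ≠ 0 := by exact_mod_cast Real.pi_ne_zero
  have hflat := (hcusp.deriv.isFlat (hp.deriv hcusp.1)).const_mul Complex.I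
  have hlim := (hflat.tendsto_halfIntegral (σ := -1) (by simp)).const_mul
    (-(√(M : ℝ) / Real.pi : ℂ))
  rw [hcusp.moment_deriv hp] at hlim
  rw [verticalIntegral_eichlerKernel_ofReal, ← mul_assoc, even_constant]
  generalize moment _ (-(3 / 2)) = m₀ at hlim ⊢
  rw [show -(√(M : ℝ) / (2 * Real.pi) : ℂ) * m₀ = -(√(M : ℝ) / Real.pi : ℂ) * (1 / 2 * m₀) by ring]
  refine hlim.congr' ?_
  filter_upwards [self_mem_nhdsWithin] with y hy
  have hy' : 0 < y := hy
  have h1 := qSeries_eq_halfIntegral hc.natCast_mul hM p hy'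
  refine Eq.trans ?_ h1.symm
  rw [halfIntegral, halfIntegral, ← integral_const_mul, ← integral_const_mul]
  refine setIntegral_congr_fun measurableSet_Ioi fun t ht => ?_
  have ht0 : 0 < t := hy'.trans ht
  rw [qSeries_natCast_sq_mul hc hM (by simpa using ht0)]
  rw [show partialTheta f M = qSeries (fun n => f n) M from rfl]
  field_simp
  rw [hs2]
  ring

theorem partialTheta_eq_halfIntegral (hM : 0 < M) (hc : PolyGrowth fun n : ℕ => f n) (p : ℝ)
    {y : ℝ} (hy : 0 < y) : partialTheta f M (p + y * Complex.I) = 1 / √(M : ℝ) *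
      halfIntegral (fun t : ℝ => partialThetaDeriv f M (p + t * Complex.I)) (-1) y :=
  qSeries_eq_halfIntegral hc hM p hy

theorem eichlerIntegral_eq_halfIntegral (hM : 0 < M) (p : ℝ) {y : ℝ} (hy : 0 < y) :
    eichlerIntegral f M (p - y * Complex.I) = 1 / √(M : ℝ) *
      halfIntegral (fun t : ℝ => partialThetaDeriv f M (p + t * Complex.I)) 1 y := by
  have h : conj ((p : ℂ) - y * Complex.I) = p + y * Complex.I := by simp
  rw [eichlerIntegral, oddKernel_eq, h, verticalIntegral_eichlerKernel_conj _ _ hy, ← mul_assoc,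
    odd_constant hM]

theorem tendsto_partialTheta (hM : 0 < M) (hc : PolyGrowth fun n : ℕ => f n) {p : ℝ}
    (hp : RapidDecay (partialThetaDeriv f M) p) :
    Tendsto (fun y : ℝ => partialTheta f M (p + y * Complex.I)) (𝓝[>] 0)
      (𝓝 (1 / (Complex.I * (M : ℂ)) ^ (1 / 2 : ℂ) *
        verticalIntegral (eichlerKernel (partialThetaDeriv f M) (-(1 / 2)) p) p)) := by
  have hcusp : IsCuspidal (partialThetaDeriv f M) := isCuspidal_qSeries hc.natCast_mul hM
  rw [verticalIntegral_eichlerKernel_ofReal, ← mul_assoc, odd_constant hM]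
  refine (((hcusp.isFlat hp).tendsto_halfIntegral (σ := -1) (by simp)).const_mul _).congr' ?_
  filter_upwards [self_mem_nhdsWithin] with y hy
  exact (partialTheta_eq_halfIntegral hM hc p hy).symm

theorem agreeToInfiniteOrderAt_partialTheta (hM : 0 < M) (hc : PolyGrowth fun n : ℕ => f n)
    {α : ℚ} (hp : RapidDecay (partialThetaDeriv f M) (α : ℝ)) :
    AgreeToInfiniteOrderAt (partialTheta f M) (eichlerIntegral f M) α := by
  have hcusp : IsCuspidal (partialThetaDeriv f M) := isCuspidal_qSeries hc.natCast_mul hM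
  have hflat := hcusp.isFlat hp
  set g : ℝ → ℂ := fun t => partialThetaDeriv f M ((α : ℝ) + t * Complex.I) with hg
  -- The factor i^r converts powers of ±iy into powers of ∓y, so one coefficient sequence serves σ =
  -- -1 above the line and σ = +1 below it.
  refine ⟨fun r => 1 / √(M : ℝ) * ((invSqrtCoeff r : ℂ) * moment g (-(1 / 2) - r)) *
    Complex.I ^ r, fun N => ⟨?_, ?_⟩⟩
  · refine ((hflat.halfIntegral_expansion (σ := -1) (by simp) N).const_mul_left
      (1 / √(M : ℝ) : ℂ)).congr' ?_ EventuallyEq.rfl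
    filter_upwards [self_mem_nhdsWithin] with y hy
    rw [← Complex.ofReal_ratCast, partialTheta_eq_halfIntegral hM hc _ hy, mul_sub,
      Finset.mul_sum]
    congr 1
    refine Finset.sum_congr rfl fun r _ => ?_
    rw [mul_assoc _ (Complex.I ^ r), ← mul_pow, show Complex.I * ((y : ℂ) * Complex.I) =
      ((-1 : ℝ) : ℂ) * y by push_cast; linear_combination (y : ℂ) * Complex.I_sq]
    ring
  · refine ((hflat.halfIntegral_expansion (σ := 1) (by simp) N).const_mul_left
      (1 / √(M : ℝ) : ℂ)).congr' ?_ EventuallyEq.rfl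
    filter_upwards [self_mem_nhdsWithin] with y hy
    rw [← Complex.ofReal_ratCast, eichlerIntegral_eq_halfIntegral hM _ hy, mul_sub,
      Finset.mul_sum]
    congr 1
    refine Finset.sum_congr rfl fun r _ => ?_
    rw [mul_assoc _ (Complex.I ^ r), ← mul_pow, show Complex.I * -((y : ℂ) * Complex.I) =
      ((1 : ℝ) : ℂ) * y by push_cast; linear_combination -(y : ℂ) * Complex.I_sq]
    ring

end

noncomputable section

open Filter MeasureTheory Set

/-! ### Assembly of the theorem. -/

theorem conj_moebius (γ : SL(2, ℤ)) (τ : ℂ) :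
    moebius γ (conj τ) = conj (((γ 0 0 : ℂ) * τ + γ 0 1) / ((γ 1 0 : ℂ) * τ + γ 1 1)) := by
  simp [moebius]

/-- Even partial theta series decay rapidly at all points of `A_M`. -/
theorem rapidDecay_partialTheta {f : ℤ → ℂ} {M k₀ : ℕ} {𝓜 : Finset ℕ} (hM : 2 ≤ M)
    (hper : Function.Periodic f (M : ℤ)) (hsub : 𝓜 ⊆ squareClass M k₀)
    (hsupp : IsSupportedOn f M 𝓜) (heven : Function.Even f) {α : ℚ} (hα : α ∈ setA f M 𝓜) :
    RapidDecay (partialTheta f M) (α : ℝ) := by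
  have hM0 : 0 < M := by omega
  have hf0 := apply_zero_of_supported hsub hsupp
  have ht : ∀ γ ∈ GammaM M, TransformsUnder (partialTheta f M) 1 (multiplier M k₀ γ) γ :=
    fun γ hγ z hz => by
      rw [pow_one]; exact partialTheta_moebius hM hper hsub hsupp heven hγ hz
  rcases hα with ⟨γ, hγ, hc, rfl⟩ | ⟨hsum, γ, hγ, hd, rfl⟩
  · have := (isCuspidal_qSeries (polyGrowth_of_periodic hM0 hper hf0) hM0).rapidDecay_of_transformsUnder
      (ht γ hγ) hc
    push_cast
    exact this
  -- At points equivalent to 0 the decay is established at 0, where it needs the primed sum to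
  -- vanish, and then carried along by γ.
  · have h0 := rapidDecay_partialTheta_zero hM0 hper heven hf0
      (by rw [sum_range_eq_two_mul_primedSum hper heven hsub hsupp, hsum, mul_zero])
    have hdR : (γ 1 1 : ℝ) ≠ 0 := by exact_mod_cast hd
    have := h0.moebius (ht γ hγ) (by simpa using hdR)
    simpa [moebiusReal] using this

end

theorem theorem1p1 (M k₀ : ℕ) (hM : 2 ≤ M) (hk₀ : 1 ≤ k₀) (hk₀' : k₀ < 2 * M)
    (f : ℤ → ℂ) (hper : Function.Periodic f (M : ℤ))
    (𝓜 : Finset ℕ) (hne : 𝓜.Nonempty) (hsub : 𝓜 ⊆ squareClass M k₀)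
    (hsupp : IsSupportedOn f M 𝓜) :
    -- even coefficients
    (Function.Even f →
      (∀ α ∈ setA f M 𝓜, HasRadialLimit (partialThetaDeriv f M) α
        (radialValue (partialThetaDeriv f M) α)) ∧
      IsQuantumModularForm (3 / 2) (GammaM M) (multiplier M k₀) (setA f M 𝓜)
        (radialValue (partialThetaDeriv f M)) (fun γ x => evenPeriod f M γ (x : ℂ)) ∧
      ∀ γ ∈ GammaM M,
        (γ 1 0 ≠ 0 → ∀ x : ℝ, VerticalIntegrable (evenKernel f M (x : ℂ)) (cuspPoint γ : ℂ)) ∧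
        ContDiff ℝ ∞ (fun x : ℝ => evenPeriod f M γ (x : ℂ)) ∧
        AnalyticOnNhd ℝ (fun x : ℝ => evenPeriod f M γ (x : ℂ))
          {x : ℝ | (γ 1 0 : ℝ) * x + (γ 1 1 : ℝ) ≠ 0}) ∧
    -- odd coefficients
    (Function.Odd f →
      (∀ α : ℚ, HasRadialLimit (partialTheta f M) α (radialValue (partialTheta f M) α)) ∧
      (∀ τ : ℂ, τ.im < 0 → VerticalIntegrable (oddKernel f M τ) (conj τ)) ∧
      IsStrongQuantumModularForm (1 / 2) (GammaM M) (multiplier M k₀)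
        (partialTheta f M) (eichlerIntegral f M) (oddPeriod f M) ∧
      IsQuantumModularForm (1 / 2) (GammaM M) (multiplier M k₀) (setB M)
        (radialValue (partialTheta f M)) (fun γ x => oddPeriod f M γ (x : ℂ)) ∧
      ∀ γ ∈ GammaM M,
        (γ 1 0 ≠ 0 → ∀ τ : ℂ, τ.im ≤ 0 →
          VerticalIntegrable (oddKernel f M τ) (cuspPoint γ : ℂ)) ∧
        ContDiff ℝ ∞ (fun x : ℝ => oddPeriod f M γ (x : ℂ)) ∧
        AnalyticOnNhd ℝ (fun x : ℝ => oddPeriod f M γ (x : ℂ))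
          {x : ℝ | (γ 1 0 : ℝ) * x + (γ 1 1 : ℝ) ≠ 0}) := by
  have hM0 : 0 < M := by omega
  have hf0 := apply_zero_of_supported hsub hsupp
  have hc := polyGrowth_of_periodic hM0 hper hf0
  have h0 : ∀ γ ∈ GammaM M, γ 1 0 = 0 → γ 0 0 = 1 ∧ γ 1 1 = 1 := by
    intro γ hγ h
    obtain ⟨c', -, hc', -, -, -, -, -, h', -⟩ := GammaM_entries hM hγ
    refine h' ?_
    rw [hc'] at h
    exact (mul_eq_zero.1 h).resolve_left (by exact_mod_cast hM0.ne')
  have hχ : ∀ γ ∈ GammaM M, conj (multiplier M k₀ γ) * multiplier M k₀ γ = 1 :=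
    fun γ hγ => conj_multiplier_mul_self hM hγ
  refine ⟨fun heven => ?_, fun hodd => ?_⟩
  · have hcusp : IsCuspidal (partialTheta f M) := isCuspidal_qSeries hc hM0
    have ht : ∀ γ ∈ GammaM M, TransformsUnder (partialTheta f M) 1 (multiplier M k₀ γ) γ :=
      fun γ hγ z hz => by
        rw [pow_one]; exact partialTheta_moebius hM hper hsub hsupp heven hγ hz
    have hA : ∀ α ∈ setA f M 𝓜, RapidDecay (partialTheta f M) ((α : ℚ) : ℝ) :=
      fun α hα => rapidDecay_partialTheta hM hper hsub hsupp heven hα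
    have hlim : ∀ α : ℚ, RapidDecay (partialTheta f M) (α : ℝ) →
        HasRadialLimit (partialThetaDeriv f M) α _ := fun α hp => by
      have := tendsto_partialThetaDeriv hM0 hc hp
      rw [Complex.ofReal_ratCast] at this
      exact this
    refine ⟨fun α hα => tendsto_nhds_limUnder ⟨_, hlim α (hA α hα)⟩, ?_, fun γ hγ => ?_⟩
    · rw [evenPeriod_ofReal]
      -- The modular form has weight m/2 = 1/2, so the quantum weight is (4 - m)/2 = 3/2.
      refine isQuantumModularForm_of_eichler (m := 1) (by norm_num) (by norm_num) hcusp ht hχ h0 hA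
        fun α hp => ?_
      rw [radialValue, (hlim α hp).limUnder_eq, Complex.ofReal_ratCast]
    · have ht' := ht _ (inv_mem hγ)
      have hx := congrFun (evenPeriod_ofReal (f := f) (M := M)) γ
      refine ⟨fun hcz x => ?_, ?_, ?_⟩
      · rw [evenKernel_eq, Complex.conj_ofReal]
        exact (isCuspidal_eichlerKernel hcusp (by norm_num) (by simp)).verticalIntegrable_of_rapidDecay
          (rapidDecay_eichlerKernel (rapidDecay_cuspPoint hcusp ht' hcz) (by norm_num) (by simp))
      · rw [hx]
        exact contDiff_const.mul (contDiff_comp_ofReal (contDiffOn_kernelPeriod hcusp ht' (by norm_num)))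
      · rw [hx]
        exact analyticOnNhd_const.mul (analyticOnNhd_kernelPeriod hcusp ht' (by norm_num))
  · have hcusp : IsCuspidal (partialThetaDeriv f M) := isCuspidal_qSeries hc.natCast_mul hM0
    have ht : ∀ γ ∈ GammaM M, TransformsUnder (partialThetaDeriv f M) 3 (multiplier M k₀ γ) γ :=
      fun γ hγ z hz => partialThetaDeriv_moebius hM hper hsub hsupp hodd hγ hz
    have hA := rapidDecay_partialThetaDeriv hM0 hper hodd
    have hlim : ∀ α : ℚ, HasRadialLimit (partialTheta f M) α _ := fun α => by
      have := tendsto_partialTheta hM0 hc (hA α)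
      rw [Complex.ofReal_ratCast] at this
      exact this
    refine ⟨fun α => tendsto_nhds_limUnder ⟨_, hlim α⟩, fun τ hτ => ?_,
      ⟨fun α => agreeToInfiniteOrderAt_partialTheta hM0 hc (hA α), fun γ hγ => ?_⟩, ?_,
      fun γ hγ => ?_⟩
    · rw [oddKernel_eq]
      exact (isCuspidal_eichlerKernel hcusp (by norm_num) hτ.le).verticalIntegrable (by simpa using hτ)
    · have ht' := ht _ (inv_mem hγ)
      refine ⟨fun τ hτ => ?_, ?_, ?_, {cuspPoint γ}, Set.finite_singleton _, ?_⟩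
      · have he : (γ 1 0 * τ + γ 1 1 : ℂ) ≠ 0 := denom_ne_zero γ hτ.ne
        -- The transformation law treats the base point z and the parameter τ as independent; the
        -- non-holomorphic integral is its specialisation to the conjugate of τ, which commutes with
        -- γ.
        have hz : 0 < (conj τ).im := by simpa using hτ
        have key := verticalIntegral_sub_slash (k := 1 / 2) (by norm_num) (by norm_num) hcusp
          (ht γ hγ) ht' (hχ γ hγ) (h0 γ hγ) hτ.le he hz
        simp only [oddPeriod_eq, slashLower, eichlerIntegral, oddKernel_eq]
        rw [← key, conj_moebius]
        unfold moebius
        ring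
      · rw [oddPeriod_eq]
        exact (differentiableOn_kernelPeriod hcusp ht' (by norm_num)).const_mul _
      · rw [oddPeriod_eq]
        exact contDiffOn_const.mul (contDiffOn_kernelPeriod hcusp ht' (by norm_num))
      · rw [oddPeriod_eq]
        exact (analyticOnNhd_const.mul (analyticOnNhd_kernelPeriod hcusp ht' (by norm_num))).mono
          (compl_cuspPoint_subset (h0 γ hγ))
    · simp only [oddPeriod_eq]
      refine isQuantumModularForm_of_eichler (m := 3) (by norm_num) (by norm_num) hcusp ht hχ h0
        (fun α _ => hA α) fun α _ => ?_
      rw [radialValue, (hlim α).limUnder_eq, Complex.ofReal_ratCast]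
    · have ht' := ht _ (inv_mem hγ)
      simp only [oddKernel_eq, oddPeriod_eq]
      refine ⟨fun hcz τ hτ => ?_, ?_, ?_⟩
      · exact (isCuspidal_eichlerKernel hcusp (by norm_num) hτ).verticalIntegrable_of_rapidDecay
          (rapidDecay_eichlerKernel (rapidDecay_cuspPoint hcusp ht' hcz) (by norm_num) hτ)
      · exact contDiff_const.mul (contDiff_comp_ofReal (contDiffOn_kernelPeriod hcusp ht' (by norm_num)))
      · exact analyticOnNhd_const.mul (analyticOnNhd_kernelPeriod hcusp ht' (by norm_num))
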